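/- Let $d\ge 2$ and $d-1\le\alpha\le d$. Let $\gamma\in C^{d+1}([0,1];\mathbb R^d)$ satisfy $\det(\gamma'(t),\gamma''(t),\dots,\gamma^{(d)}(t))\ne 0$ for all $t\in[0,1]$, and let $R>0$, $2\le q\le\infty$ and $\epsilon>0$. Then there is a constant $C>0$, depending only on $d,\alpha,\gamma,R,q,\epsilon$, such that the following holds for every $\lambda>1$, every positive Borel measure $\mu$ supported in the unit ball $B(0,1)\subset\mathbb R^d$ for which there is a finite constant $C_\mu$ with $\mu(B(x,r))\le C_\mu r^\alpha$ for all $x\in\mathbb R^d$ and $r>0$, and every $g\in L^2(\mathbb R^d)$ supported in the $R$-neighborhood $\{\xi:\ |\xi-\lambda\gamma(t)|\le R\text{ for some }t\in[0,1]\}$ of the dilated curve $\lambda\gamma$: $$\|\widehat g\|_{L^q(d\mu)}\le C\,\langle\mu\rangle_\alpha^{1/q}\,\lambda^{\kappa+\epsilon}\,\|g\|_{L^2(\mathbb R^d)},\qquad \kappa=\max\Big(\frac14+\frac{d-\alpha-1}{2q},\ \frac12+\frac{d-\alpha-2}{q}\Big).$$ Here $\widehat g(x)=\int_{\mathbb R^d}e^{ix\cdot\xi}g(\xi)\,d\xi$,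 $\langle\mu\rangle_\alpha=\sup_{x\in\mathbb R^d,\,r>0}r^{-\alpha}\mu(B(x,r))$, and $1/q=0$ when $q=\infty$. -/

import Mathlib

open MeasureTheory Set
open scoped ENNReal NNReal

noncomputable section

/-- `ℝ^d` with its Euclidean norm and Lebesgue measure. -/
abbrev Rd (d : ℕ) : Type := EuclideanSpace ℝ (Fin d)

/-- A nondegenerate `C^{d+1}` curve on `[0,1]`: the vectors
`γ'(t), γ''(t), …, γ^{(d)}(t)` have nonzero determinant at every `t ∈ [0,1]`
(one-sided derivatives at the endpoints). The values of `γ` off `[0,1]` play no role. -/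
structure IsNondegenerateCurve {d : ℕ} (γ : ℝ → Rd d) : Prop where
  contDiffOn : ContDiffOn ℝ ((d + 1 : ℕ) : WithTop ℕ∞) γ (Icc (0 : ℝ) 1)
  det_ne_zero : ∀ t ∈ Icc (0 : ℝ) 1,
    (Matrix.of fun i j : Fin d =>
      iteratedDerivWithin ((j : ℕ) + 1) γ (Icc (0 : ℝ) 1) t i).det ≠ 0

/-- The growth condition `μ(B(x,r)) ≤ C_μ r^α` for all `x` and all `r > 0`. -/
def IsAlphaDimensional {d : ℕ} (α : ℝ) (μ : Measure (Rd d)) : Prop :=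
  ∃ Cμ : ℝ≥0, ∀ (x : Rd d) (r : ℝ), 0 < r →
    μ (Metric.ball x r) ≤ (Cμ : ℝ≥0∞) * ENNReal.ofReal (r ^ α)

/-- `⟨μ⟩_α = sup_{x, r > 0} r^{-α} μ(B(x,r))`. -/
def growthNorm {d : ℕ} (α : ℝ) (μ : Measure (Rd d)) : ℝ≥0∞ :=
  ⨆ (x : Rd d) (r : ℝ) (_ : 0 < r), ENNReal.ofReal (r ^ (-α)) * μ (Metric.ball x r)

/-- The Fourier transform `ĝ(x) = ∫ e^{i x·ξ} g(ξ) dξ`. -/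
def fourierHat {d : ℕ} (g : Rd d → ℂ) (x : Rd d) : ℂ :=
  ∫ ξ : Rd d, Complex.exp (Complex.I * ((inner ℝ x ξ : ℝ) : ℂ)) * g ξ

/-- `lam γ([0,1]) + O(1)`, with `R` the constant in `O(1)`: the closed `R`-neighborhood of the
dilated curve. -/
def curveNbhd {d : ℕ} (γ : ℝ → Rd d) (lam R : ℝ) : Set (Rd d) :=
  {ξ | ∃ t ∈ Icc (0 : ℝ) 1, dist ξ (lam • γ t) ≤ R}

/-- `κ = max (1/4 + (d-α-1)/(2q), 1/2 + (d-α-2)/q)`, where `1/q = 0` if `q = ∞`. -/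
def kappa (d : ℕ) (α : ℝ) (q : ℝ≥0∞) : ℝ :=
  max (1 / 4 + ((d : ℝ) - α - 1) / 2 * (1 / q).toReal)
    (1 / 2 + ((d : ℝ) - α - 2) * (1 / q).toReal)

end

/-! The square of `ĝ` is treated bilinearly. The curve is cut into finitely many arcs on which two
linear coordinates turn it into a convex graph (`LocalFrame`). The product of such an arc with
itself is split by a Whitney decomposition (`mul_self_le_whitney_sum`) into pairs of subarcs of
length about `θ` at distance about `θ`, with `λ^{-1/2} ≲ θ ≤ 1`; adjacent pairs survive only at the
last scale `θ ~ λ^{-1/2}`.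

For such a pair, `ĝ₁ ĝ₂` is the transform of `g₁ ⋆ g₂`, which lives in a ball of radius `O(λθ)`. The
tangents of the two arcs differ by about `θ`, so `supp g₁` and `ζ - supp g₂` overlap in volume
`O(1/θ)` (`exists_volume_transverse_le`) and `‖g₁ ⋆ g₂‖₂² ≲ θ⁻¹ ‖g₁‖₂² ‖g₂‖₂²`. A function with
frequencies in a ball of radius `ρ` is essentially constant at scale `1/ρ`, so passing from Lebesgue
measure to `μ` costs `⟨μ⟩ ρ^{d-α}` (`lintegral_fourierHat_sq_le_of_support_closedBall`). This is the
`L²(μ)` bound. For `L¹(μ)` the unit ball is cut into slabs of width about `θ` normal to the tangent.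
This blurs frequencies by `1/θ` along the tangent, which the overlap bound tolerates. Each slab has
`μ`-measure `≲ ⟨μ⟩ θ^{α-d+1}`, and Cauchy–Schwarz on the slabs with Bessel's inequality across them
gives a bound in which all powers of `θ` cancel (`sq_lintegral_fourierHat_mul_le`). The `L^∞` bound
is Cauchy–Schwarz on an arc neighbourhood of volume `O(λθ)`.

Interpolation at `p = q/2` (`lintegral_rpow_le_of_endpoints`) gives an exponent affine in `log θ`;
its values at `θ = λ^{-1/2}` and `θ = 1` account for the two entries of `κ`. Pairs at one scale are
summed by disjointness of the pieces, and the `O(log λ)` scales are absorbed in `λ^ε`. -/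

/-! ### The Fourier integral: normalization, Plancherel, Cauchy–Schwarz. -/

open FourierTransform in
/-- `fourierHat` in terms of Mathlib's Fourier transform. -/
theorem fourierHat_eq_fourier {d : ℕ} (g : Rd d → ℂ) (x : Rd d) :
    fourierHat g x = 𝓕 g ((-(2 * Real.pi)⁻¹) • x) := by
  rw [Real.fourier_eq']
  unfold fourierHat
  congr 1
  ext ξ
  rw [smul_eq_mul]
  congr 2
  rw [inner_smul_right, real_inner_comm]
  have : (-2 * Real.pi * (-(2 * Real.pi)⁻¹ * inner ℝ ξ x) : ℝ) = inner ℝ ξ x := by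
    field_simp
  rw [this, mul_comm]

theorem norm_cexp_I_mul (r : ℝ) : ‖Complex.exp (Complex.I * (r : ℂ))‖ = 1 := by
  rw [mul_comm, Complex.norm_exp_ofReal_mul_I]

theorem integrable_cexp_inner_mul {d : ℕ} {g : Rd d → ℂ} (hg : Integrable g) (x : Rd d) :
    Integrable fun ξ : Rd d => Complex.exp (Complex.I * ((inner ℝ x ξ : ℝ) : ℂ)) * g ξ := by
  refine hg.bdd_mul (c := 1) (by fun_prop) (Filter.Eventually.of_forall fun ξ => ?_)
  rw [norm_cexp_I_mul]

theorem continuous_fourierHat {d : ℕ} {g : Rd d → ℂ} (hg : Integrable g) :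
    Continuous (fourierHat g) := by
  refine continuous_of_dominated (bound := fun ξ => ‖g ξ‖) ?_ ?_ hg.norm ?_
  · exact fun x => (integrable_cexp_inner_mul hg x).aestronglyMeasurable
  · intro x
    filter_upwards with ξ
    rw [norm_mul, norm_cexp_I_mul, one_mul]
  · filter_upwards with ξ
    fun_prop

theorem enorm_fourierHat_le {d : ℕ} (g : Rd d → ℂ) (x : Rd d) :
    ‖fourierHat g x‖ₑ ≤ ∫⁻ ξ, ‖g ξ‖ₑ := by
  refine (enorm_integral_le_lintegral_enorm _).trans (le_of_eq ?_)
  congr 1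
  ext ξ
  rw [enorm_mul, ← ofReal_norm, norm_cexp_I_mul, ENNReal.ofReal_one, one_mul]

/-- The Fourier transform of an `L²` function agrees a.e. with the Fourier integral when the
function is also integrable. -/
theorem fourier_toLp_ae_eq {d : ℕ} {g : Rd d → ℂ} (hg : Integrable g) (hg2 : MemLp g 2 volume) :
    (FourierTransform.fourier (hg2.toLp g) : Lp ℂ 2 (volume : Measure (Rd d)))
      =ᵐ[volume] FourierTransform.fourier g := by
  set F : Lp ℂ 2 (volume : Measure (Rd d)) := FourierTransform.fourier (hg2.toLp g) with hF
  have hcont : Continuous (FourierTransform.fourier g) :=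
    VectorFourier.fourierIntegral_continuous Real.continuous_fourierChar
      (by exact continuous_inner) hg
  -- Both functions are tested against smooth compactly supported `φ`: the `L²` transform passes to
  -- `φ` through tempered distributions, the Fourier integral through Fubini.
  refine ae_eq_of_integral_contDiff_smul_eq ?_ hcont.locallyIntegrable ?_
  · exact (Lp.memLp F).locallyIntegrable (by norm_num)
  · intro φ hφ hc
    have hφ' : ContDiff ℝ (↑(⊤ : ℕ∞)) fun x => (φ x : ℂ) :=
      Complex.ofRealCLM.contDiff.comp hφ
    have hc' : HasCompactSupport fun x => (φ x : ℂ) := hc.comp_left Complex.ofReal_zero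
    let ψ : SchwartzMap (Rd d) ℂ := hc'.toSchwartzMap hφ'
    have hψ : ∀ x, ψ x = (φ x : ℂ) := fun x => rfl
    have h1 := congrArg (fun T : TemperedDistribution (Rd d) ℂ => T ψ)
      (Lp.fourier_toTemperedDistribution_eq (hg2.toLp g))
    simp only [TemperedDistribution.fourier_apply, Lp.toTemperedDistribution_apply] at h1
    have h2 : ∫ x, (FourierTransform.fourier g x) • (ψ x) =
        ∫ x, g x • (FourierTransform.fourier (ψ : Rd d → ℂ) x) := by
      have := VectorFourier.integral_fourierIntegral_smul_eq_flip (μ := (volume : Measure (Rd d)))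
        (ν := volume) (L := innerₗ (Rd d)) (f := g) (g := (ψ : Rd d → ℂ))
        Real.continuous_fourierChar (by exact continuous_inner) hg ψ.integrable
      rw [flip_innerₗ] at this
      exact this
    calc ∫ x, φ x • F x = ∫ x, ψ x • F x := by simp [hψ]
      _ = ∫ x, (FourierTransform.fourier ψ : SchwartzMap (Rd d) ℂ) x • (hg2.toLp g) x := h1.symm
      _ = ∫ x, g x • (FourierTransform.fourier (ψ : Rd d → ℂ) x) := by
          refine integral_congr_ae ?_
          filter_upwards [hg2.coeFn_toLp] with x hx
          rw [hx, SchwartzMap.fourier_coe, smul_eq_mul, smul_eq_mul, mul_comm]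
      _ = ∫ x, φ x • FourierTransform.fourier g x := by
          rw [← h2]
          refine integral_congr_ae (Filter.Eventually.of_forall fun x => ?_)
          simp [hψ, mul_comm]

theorem lintegral_comp_smul_eq {d : ℕ} {r : ℝ} (hr : r ≠ 0) {f : Rd d → ℝ≥0∞}
    (hf : Measurable f) :
    ∫⁻ x, f (r • x) = ENNReal.ofReal |(r ^ d)⁻¹| * ∫⁻ x, f x := by
  rw [← lintegral_map hf (measurable_const_smul r), Measure.map_addHaar_smul _ hr,
    lintegral_smul_measure, finrank_euclideanSpace_fin, smul_eq_mul]

theorem memLp_two_of_lintegral_sq_lt_top {d : ℕ} {μ : Measure (Rd d)} {g : Rd d → ℂ}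
    (hg : AEStronglyMeasurable g μ)
    (h : ∫⁻ ξ, ‖g ξ‖ₑ ^ 2 ∂μ < ∞) : MemLp g 2 μ := by
  refine ⟨hg, ?_⟩
  rw [eLpNorm_lt_top_iff_lintegral_rpow_enorm_lt_top (by norm_num) (by norm_num)]
  simpa using h

theorem eLpNorm_two_sq {d : ℕ} {μ : Measure (Rd d)} (g : Rd d → ℂ) :
    eLpNorm g 2 μ ^ 2 = ∫⁻ ξ, ‖g ξ‖ₑ ^ 2 ∂μ := by
  rw [eLpNorm_eq_lintegral_rpow_enorm_toReal (by norm_num) (by norm_num)]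
  rw [← ENNReal.rpow_natCast, ← ENNReal.rpow_mul]
  simp

/-- The upper half of Plancherel's theorem, for the normalization of `fourierHat`. -/
theorem lintegral_fourierHat_sq_le {d : ℕ} {g : Rd d → ℂ} (hg : Integrable g) :
    ∫⁻ x, ‖fourierHat g x‖ₑ ^ 2 ≤ ENNReal.ofReal ((2 * Real.pi) ^ d) * ∫⁻ ξ, ‖g ξ‖ₑ ^ 2 := by
  have hpi : (0 : ℝ) < 2 * Real.pi := by positivity
  rcases eq_or_ne (∫⁻ ξ, ‖g ξ‖ₑ ^ 2) ∞ with h | h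
  · rw [h, ENNReal.mul_top (by simpa using by positivity)]
    exact le_top
  have hg2 : MemLp g 2 volume :=
    memLp_two_of_lintegral_sq_lt_top hg.aestronglyMeasurable h.lt_top
  have hcont : Continuous (FourierTransform.fourier g) :=
    VectorFourier.fourierIntegral_continuous Real.continuous_fourierChar
      (by exact continuous_inner) hg
  simp_rw [fourierHat_eq_fourier]
  rw [lintegral_comp_smul_eq (f := fun x => ‖FourierTransform.fourier g x‖ₑ ^ 2)
    (by simp) (by fun_prop)]
  have h1 : |((-(2 * Real.pi)⁻¹) ^ d)⁻¹| = (2 * Real.pi) ^ d := by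
    rw [abs_inv, abs_pow, abs_neg, abs_of_pos (by positivity), inv_pow, inv_inv]
  rw [h1]
  refine mul_le_mul_right (le_of_eq ?_) _
  have h2 := Lp.norm_fourier_eq (hg2.toLp g)
  rw [Lp.norm_def, Lp.norm_def, ENNReal.toReal_eq_toReal_iff' (Lp.eLpNorm_ne_top _)
    (Lp.eLpNorm_ne_top _), eLpNorm_congr_ae (fourier_toLp_ae_eq hg hg2),
    eLpNorm_congr_ae hg2.coeFn_toLp] at h2
  rw [← eLpNorm_two_sq, ← eLpNorm_two_sq, h2]

/-- The Cauchy–Schwarz inequality for `ℝ≥0∞`-valued functions. -/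
theorem lintegral_mul_sq_le {X : Type*} [MeasurableSpace X] {μ : Measure X} {f g : X → ℝ≥0∞}
    (hf : AEMeasurable f μ) (hg : AEMeasurable g μ) :
    (∫⁻ x, f x * g x ∂μ) ^ 2 ≤ (∫⁻ x, f x ^ 2 ∂μ) * ∫⁻ x, g x ^ 2 ∂μ := by
  have h := ENNReal.lintegral_mul_norm_pow_le (hf.pow_const 2) (hg.pow_const 2)
    (p := 1 / 2) (q := 1 / 2) (by norm_num) (by norm_num) (by norm_num)
  have hs : ∀ y : ℝ≥0∞, (y ^ 2) ^ (1 / 2 : ℝ) = y := fun y => by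
    rw [← ENNReal.rpow_natCast, ← ENNReal.rpow_mul]; simp
  have hs' : ∀ y : ℝ≥0∞, (y ^ (1 / 2 : ℝ)) ^ 2 = y := fun y => by
    rw [← ENNReal.rpow_natCast, ← ENNReal.rpow_mul]; simp
  simp only [hs] at h
  refine (pow_le_pow_left₀ (by simp) h 2).trans (le_of_eq ?_)
  rw [mul_pow, hs', hs']

theorem lintegral_sq_le {X : Type*} [MeasurableSpace X] {μ : Measure X} {f : X → ℝ≥0∞}
    (hf : AEMeasurable f μ) :
    (∫⁻ x, f x ∂μ) ^ 2 ≤ μ univ * ∫⁻ x, f x ^ 2 ∂μ := by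
  have := lintegral_mul_sq_le (f := fun _ => 1) (aemeasurable_const) hf
  simpa using this

theorem tsum_mul_sq_le {ι : Type*} (f g : ι → ℝ≥0∞) :
    (∑' i, f i * g i) ^ 2 ≤ (∑' i, f i ^ 2) * ∑' i, g i ^ 2 := by
  let _ : MeasurableSpace ι := ⊤
  have := lintegral_mul_sq_le (μ := Measure.count) (f := f) (g := g)
    (measurable_from_top).aemeasurable (measurable_from_top).aemeasurable
  simpa [lintegral_count] using this

/-! ### The `L²(μ)` bound for functions with frequencies in a ball. -/

theorem measure_ball_le_growthNorm {d : ℕ} (α : ℝ) (μ : Measure (Rd d)) (x : Rd d) {r : ℝ}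
    (hr : 0 < r) :
    μ (Metric.ball x r) ≤ growthNorm α μ * ENNReal.ofReal (r ^ α) := by
  have h : ENNReal.ofReal (r ^ (-α)) * μ (Metric.ball x r) ≤ growthNorm α μ :=
    le_iSup_of_le x (le_iSup_of_le r (le_iSup_of_le hr le_rfl))
  have h1 : ENNReal.ofReal (r ^ α) * ENNReal.ofReal (r ^ (-α)) = 1 := by
    rw [← ENNReal.ofReal_mul (by positivity), ← Real.rpow_add hr]
    simp
  calc μ (Metric.ball x r)
      = ENNReal.ofReal (r ^ α) * ENNReal.ofReal (r ^ (-α)) * μ (Metric.ball x r) := by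
        rw [h1, one_mul]
    _ = ENNReal.ofReal (r ^ (-α)) * μ (Metric.ball x r) * ENNReal.ofReal (r ^ α) := by ring
    _ ≤ _ := by gcongr

theorem isFiniteMeasure_of_isAlphaDimensional {d : ℕ} {α : ℝ} {μ : Measure (Rd d)}
    (hμ : IsAlphaDimensional α μ) (hs : μ (Metric.closedBall (0 : Rd d) 1)ᶜ = 0) :
    IsFiniteMeasure μ := by
  obtain ⟨C, hC⟩ := hμ
  refine ⟨?_⟩
  have h1 : μ (Metric.closedBall 0 1) ≤ μ (Metric.ball 0 2) :=
    measure_mono (Metric.closedBall_subset_ball (by norm_num))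
  have h2 := hC 0 2 (by norm_num)
  rw [← union_compl_self (Metric.closedBall (0 : Rd d) 1)]
  refine (measure_union_le _ _).trans_lt ?_
  rw [hs, add_zero]
  refine (h1.trans h2).trans_lt ?_
  exact ENNReal.mul_lt_top (by simp) (by simp)

theorem fourierHat_translate {d : ℕ} (g : Rd d → ℂ) (c x : Rd d) :
    fourierHat (fun ξ => g (ξ + c)) x
      = Complex.exp (-(Complex.I * ((inner ℝ x c : ℝ) : ℂ))) * fourierHat g x := by
  unfold fourierHat
  rw [← integral_const_mul,
    ← integral_add_right_eq_self (fun ξ => Complex.exp (-(Complex.I * ((inner ℝ x c : ℝ) : ℂ))) *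
      (Complex.exp (Complex.I * ((inner ℝ x ξ : ℝ) : ℂ)) * g ξ)) c]
  congr 1
  ext ξ
  rw [← mul_assoc, ← Complex.exp_add, inner_add_right]
  congr 2
  push_cast
  ring

theorem norm_fourierHat_translate {d : ℕ} (g : Rd d → ℂ) (c x : Rd d) :
    ‖fourierHat (fun ξ => g (ξ + c)) x‖ₑ = ‖fourierHat g x‖ₑ := by
  rw [fourierHat_translate, enorm_mul, ← ofReal_norm, ← mul_neg, ← Complex.ofReal_neg,
    norm_cexp_I_mul, ENNReal.ofReal_one, one_mul]

/-- The Fourier transform of `1_B` multiplied into `H` becomes integration of the Fourier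
transform of `H` over translates of `B`. -/
theorem fourierHat_mul_fourierHat_indicator {d : ℕ} {H : Rd d → ℂ} (hH : Integrable H)
    {B : Set (Rd d)} (hB : MeasurableSet B) (hBv : volume B ≠ ∞) (x : Rd d) :
    fourierHat (fun ξ => fourierHat (B.indicator 1) ξ * H ξ) x
      = ∫ y in B, fourierHat H (x + y) := by
  have hB1 : Integrable (B.indicator (1 : Rd d → ℂ)) :=
    (integrable_indicator_iff hB).2 (integrableOn_const hBv)
  have h0 : Integrable (fun p : Rd d × Rd d =>
      Complex.exp (Complex.I * ((inner ℝ (x + p.2) p.1 : ℝ) : ℂ)) *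
        (H p.1 * B.indicator 1 p.2)) (volume.prod volume) := by
    refine (hH.mul_prod hB1).bdd_mul (c := 1) ?_ (Filter.Eventually.of_forall fun p => ?_)
    · exact Continuous.aestronglyMeasurable (by fun_prop)
    · rw [norm_cexp_I_mul]
  calc fourierHat (fun ξ => fourierHat (B.indicator 1) ξ * H ξ) x
      = ∫ ξ, ∫ y, Complex.exp (Complex.I * ((inner ℝ (x + y) ξ : ℝ) : ℂ)) *
        (H ξ * B.indicator 1 y) := by
        unfold fourierHat
        congr 1
        ext ξ
        beta_reduce
        rw [← integral_mul_const, ← integral_const_mul]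
        congr 1
        ext y
        rw [inner_add_left, Complex.ofReal_add, mul_add, Complex.exp_add, real_inner_comm y ξ]
        ring
    _ = ∫ y, ∫ ξ, Complex.exp (Complex.I * ((inner ℝ (x + y) ξ : ℝ) : ℂ)) *
        (H ξ * B.indicator 1 y) := integral_integral_swap h0
    _ = ∫ y, B.indicator (fun y => fourierHat H (x + y)) y := by
        congr 1
        ext y
        by_cases hy : y ∈ B
        · simp [hy, fourierHat]
        · simp [hy]
    _ = _ := integral_indicator hB

/-- The phase is at most `1/2` on the ball, so the real part of the integrand is at least `1/2` and
nothing cancels. This lets the multiplier be divided out on frequencies of size at most `ρ`. -/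
theorem norm_fourierHat_indicator_ball_ge {d : ℕ} {r ρ : ℝ} (hr : 0 < r) (hρ : r * ρ ≤ 1 / 2)
    {ξ : Rd d} (hξ : ‖ξ‖ ≤ ρ) :
    volume.real (Metric.ball (0 : Rd d) r) / 2
      ≤ ‖fourierHat ((Metric.ball (0 : Rd d) r).indicator 1) ξ‖ := by
  have hint : IntegrableOn (fun y : Rd d => Complex.exp (Complex.I * ((inner ℝ ξ y : ℝ) : ℂ)))
      (Metric.ball (0 : Rd d) r) := by
    refine Integrable.mono' (g := fun _ => (1 : ℝ)) (integrableOn_const measure_ball_lt_top.ne)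
      (Continuous.aestronglyMeasurable (by fun_prop)) (Filter.Eventually.of_forall fun p => ?_)
    rw [norm_cexp_I_mul]
  have h1 : fourierHat ((Metric.ball (0 : Rd d) r).indicator 1) ξ
      = ∫ y in Metric.ball (0 : Rd d) r, Complex.exp (Complex.I * ((inner ℝ ξ y : ℝ) : ℂ)) := by
    rw [← integral_indicator Metric.isOpen_ball.measurableSet]
    unfold fourierHat
    congr 1
    ext y
    by_cases hy : y ∈ Metric.ball (0 : Rd d) r
    · rw [indicator_of_mem hy, indicator_of_mem hy]; simp
    · rw [indicator_of_notMem hy, indicator_of_notMem hy]; simp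
  refine le_trans ?_ (Complex.re_le_norm _)
  rw [h1]
  have h2 : (∫ y in Metric.ball (0 : Rd d) r,
      Complex.exp (Complex.I * ((inner ℝ ξ y : ℝ) : ℂ))).re
      = ∫ y in Metric.ball (0 : Rd d) r,
        (Complex.exp (Complex.I * ((inner ℝ ξ y : ℝ) : ℂ))).re := by
    simpa using (integral_re hint).symm
  rw [h2]
  have h3 : volume.real (Metric.ball (0 : Rd d) r) / 2
      = ∫ y in Metric.ball (0 : Rd d) r, (1 / 2 : ℝ) := by
    rw [setIntegral_const, smul_eq_mul]; ring
  rw [h3]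
  refine setIntegral_mono_on (integrableOn_const measure_ball_lt_top.ne) hint.re
    Metric.isOpen_ball.measurableSet fun y hy => ?_
  rw [mul_comm, Complex.exp_ofReal_mul_I_re]
  have hy' : ‖y‖ < r := by simpa using hy
  have h4 : |inner ℝ ξ y| ≤ 1 / 2 := by
    refine (abs_real_inner_le_norm ξ y).trans ?_
    nlinarith [norm_nonneg ξ, norm_nonneg y]
  have h5 := Real.one_sub_sq_div_two_le_cos (x := inner ℝ ξ y)
  have h6 := sq_abs (inner ℝ ξ y : ℝ)
  nlinarith [abs_nonneg (inner ℝ ξ y : ℝ)]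

/-- Averaging over balls of radius `r`: if `H` is integrable, the `L²(μ)` norm of the averages of
`fourierHat H` is controlled by its `L²` norm. -/
theorem lintegral_sq_average_le {d : ℕ} (α : ℝ) (μ : Measure (Rd d)) [SFinite μ] {r : ℝ}
    (hr : 0 < r) {F : Rd d → ℝ≥0∞} (hF : Measurable F) :
    ∫⁻ x, (∫⁻ y in Metric.ball (0 : Rd d) r, F (x + y)) ^ 2 ∂μ
      ≤ volume (Metric.ball (0 : Rd d) r) * (growthNorm α μ * ENNReal.ofReal (r ^ α)) *
        ∫⁻ z, F z ^ 2 := by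
  set b := volume (Metric.ball (0 : Rd d) r)
  have hshift : ∀ x, ∫⁻ y in Metric.ball (0 : Rd d) r, F (x + y) ^ 2
      = ∫⁻ z, (Metric.ball x r).indicator (fun z => F z ^ 2) z := by
    intro x
    rw [← lintegral_indicator Metric.isOpen_ball.measurableSet,
      ← lintegral_add_left_eq_self (fun z => (Metric.ball x r).indicator (fun z => F z ^ 2) z) x]
    congr 1
    ext y
    by_cases hy : y ∈ Metric.ball (0 : Rd d) r
    · have : x + y ∈ Metric.ball x r := by simpa using hy
      rw [indicator_of_mem hy, indicator_of_mem this]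
    · have : x + y ∉ Metric.ball x r := by simpa using hy
      rw [indicator_of_notMem hy, indicator_of_notMem this]
  have hm : Measurable (Function.uncurry fun (x z : Rd d) =>
      (Metric.ball x r).indicator (fun z => F z ^ 2) z) := by
    have hS : MeasurableSet {p : Rd d × Rd d | dist p.2 p.1 < r} :=
      (isOpen_lt (by fun_prop) continuous_const).measurableSet
    have := ((hF.comp measurable_snd).pow_const 2).indicator hS
    convert this using 1
    ext p
    simp [Function.uncurry, indicator]
  calc ∫⁻ x, (∫⁻ y in Metric.ball (0 : Rd d) r, F (x + y)) ^ 2 ∂μ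
      ≤ ∫⁻ x, (b * ∫⁻ z, (Metric.ball x r).indicator (fun z => F z ^ 2) z) ∂μ := by
        refine lintegral_mono fun x => ?_
        rw [← hshift]
        refine (lintegral_sq_le (by fun_prop)).trans (le_of_eq ?_)
        rw [Measure.restrict_apply_univ]
    _ = b * ∫⁻ x, (∫⁻ z, (Metric.ball x r).indicator (fun z => F z ^ 2) z) ∂μ := by
        rw [lintegral_const_mul']
        exact measure_ball_lt_top.ne
    -- By symmetry of `z ∈ ball x r`, the inner integral becomes the `μ`-measure of a ball around
    -- `z`.
    _ = b * ∫⁻ z, (∫⁻ x, (Metric.ball x r).indicator (fun z => F z ^ 2) z ∂μ) := by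
        rw [lintegral_lintegral_swap hm.aemeasurable]
    _ = b * ∫⁻ z, F z ^ 2 * μ (Metric.ball z r) := by
        congr 2
        ext z
        rw [← setLIntegral_const, ← lintegral_indicator Metric.isOpen_ball.measurableSet]
        congr 1
        ext x
        simp only [indicator, Metric.mem_ball, dist_comm]
    _ ≤ b * ∫⁻ z, (growthNorm α μ * ENNReal.ofReal (r ^ α)) * F z ^ 2 := by
        refine mul_le_mul_right (lintegral_mono fun z => ?_) _
        rw [mul_comm]
        refine mul_le_mul_left ?_ _
        exact measure_ball_le_growthNorm α μ z hr
    _ = _ := by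
        rw [lintegral_const_mul _ (by fun_prop)]
        ring

/-- Uncertainty principle: `Ĝ` is the integral over balls of radius `1/(2ρ)` of some `Ĥ` with `‖H‖₂`
comparable to `‖G‖₂` divided by the volume of the ball. Averaging at that scale makes `μ` look like
Lebesgue measure, up to its growth. -/
theorem lintegral_fourierHat_sq_le_of_support_closedBall_zero {d : ℕ} (α : ℝ) :
    ∃ K : ℝ≥0, ∀ (μ : Measure (Rd d)) [SFinite μ] (ρ : ℝ), 0 < ρ → ∀ G : Rd d → ℂ, Measurable G →
      Integrable G → Function.support G ⊆ Metric.closedBall 0 ρ →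
      ∫⁻ x, ‖fourierHat G x‖ₑ ^ 2 ∂μ
        ≤ K * growthNorm α μ * ENNReal.ofReal (ρ ^ ((d : ℝ) - α)) * ∫⁻ ξ, ‖G ξ‖ₑ ^ 2 := by
  set v := volume.real (Metric.ball (0 : Rd d) 1) with hv
  have hvpos : 0 < v := ENNReal.toReal_pos
    (Metric.measure_ball_pos _ _ one_pos).ne' measure_ball_lt_top.ne
  -- This collects `b * r ^ α * (2π) ^ d * (2 / b) ^ 2` with `b = r ^ d * v` and `r = 1 / (2ρ)`.
  refine ⟨Real.toNNReal (4 * (2 * Real.pi) ^ d * (1 / 2) ^ (α - d) / v), ?_⟩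
  intro μ _ ρ hρ G hGm hG hsupp
  set r : ℝ := 1 / (2 * ρ) with hr_def
  have hr : 0 < r := by positivity
  have hrρ : r * ρ ≤ 1 / 2 := by rw [hr_def]; field_simp; norm_num
  set B := Metric.ball (0 : Rd d) r with hB
  set b := volume.real B with hb
  have hbv : b = r ^ d * v := by
    rw [hb, hB, Measure.real, Measure.addHaar_ball_of_pos _ _ hr, ENNReal.toReal_mul,
      finrank_euclideanSpace_fin, ENNReal.toReal_ofReal (by positivity), hv, Measure.real]
  have hbpos : 0 < b := by rw [hbv]; positivity
  set m := fourierHat (B.indicator (1 : Rd d → ℂ)) with hm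
  have hmc : Continuous m := continuous_fourierHat
    ((integrable_indicator_iff Metric.isOpen_ball.measurableSet).2
      (integrableOn_const measure_ball_lt_top.ne))
  set H : Rd d → ℂ := fun ξ => G ξ / m ξ with hH
  have hHm : Measurable H := hGm.div hmc.measurable
  have hHle : ∀ ξ, ‖H ξ‖ ≤ 2 / b * ‖G ξ‖ := by
    intro ξ
    by_cases hξ : G ξ = 0
    · simp [hH, hξ]
    · have h1 : ‖ξ‖ ≤ ρ := by simpa using hsupp hξ
      have h2 := norm_fourierHat_indicator_ball_ge hr hrρ h1
      rw [hH, norm_div, div_le_iff₀ (by linarith [half_pos hbpos])]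
      calc ‖G ξ‖ = 2 / b * ‖G ξ‖ * (b / 2) := by field_simp
        _ ≤ _ := by gcongr
  have hmul : (fun ξ => m ξ * H ξ) = G := by
    ext ξ
    by_cases hξ : G ξ = 0
    · simp [hH, hξ]
    · have h1 : ‖ξ‖ ≤ ρ := by simpa using hsupp hξ
      have h2 := norm_fourierHat_indicator_ball_ge hr hrρ h1
      have h3 : m ξ ≠ 0 := by
        rw [← norm_pos_iff]
        linarith [half_pos hbpos]
      simp only [hH]
      field_simp
  have hHi : Integrable H := (hG.norm.const_mul (2 / b)).mono' hHm.aestronglyMeasurable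
    (Filter.Eventually.of_forall hHle)
  have hb' : volume B = ENNReal.ofReal b := by
    rw [hb, ofReal_measureReal measure_ball_lt_top.ne]
  calc ∫⁻ x, ‖fourierHat G x‖ₑ ^ 2 ∂μ
      ≤ ∫⁻ x, (∫⁻ y in B, ‖fourierHat H (x + y)‖ₑ) ^ 2 ∂μ := by
        refine lintegral_mono fun x => ?_
        gcongr
        rw [← hmul, hm, fourierHat_mul_fourierHat_indicator hHi Metric.isOpen_ball.measurableSet
          measure_ball_lt_top.ne]
        exact enorm_integral_le_lintegral_enorm _
    _ ≤ volume B * (growthNorm α μ * ENNReal.ofReal (r ^ α)) * ∫⁻ z, ‖fourierHat H z‖ₑ ^ 2 :=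
        lintegral_sq_average_le α μ hr (continuous_fourierHat hHi).measurable.enorm
    _ ≤ volume B * (growthNorm α μ * ENNReal.ofReal (r ^ α)) *
        (ENNReal.ofReal ((2 * Real.pi) ^ d) * ∫⁻ ξ, ‖H ξ‖ₑ ^ 2) := by
        gcongr
        exact lintegral_fourierHat_sq_le hHi
    _ ≤ volume B * (growthNorm α μ * ENNReal.ofReal (r ^ α)) *
        (ENNReal.ofReal ((2 * Real.pi) ^ d) *
          (ENNReal.ofReal ((2 / b) ^ 2) * ∫⁻ ξ, ‖G ξ‖ₑ ^ 2)) := by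
        gcongr
        rw [← lintegral_const_mul _ (by fun_prop)]
        refine lintegral_mono fun ξ => ?_
        rw [ENNReal.ofReal_pow (by positivity), ← mul_pow]
        gcongr
        rw [← ofReal_norm, ← ofReal_norm, ← ENNReal.ofReal_mul (by positivity)]
        exact ENNReal.ofReal_le_ofReal (hHle ξ)
    _ = growthNorm α μ * (ENNReal.ofReal b * ENNReal.ofReal (r ^ α) *
        ENNReal.ofReal ((2 * Real.pi) ^ d) * ENNReal.ofReal ((2 / b) ^ 2)) *
          ∫⁻ ξ, ‖G ξ‖ₑ ^ 2 := by rw [hb']; ring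
    _ = growthNorm α μ * (ENNReal.ofReal (4 * (2 * Real.pi) ^ d * (1 / 2) ^ (α - d) / v) *
        ENNReal.ofReal (ρ ^ ((d : ℝ) - α))) * ∫⁻ ξ, ‖G ξ‖ₑ ^ 2 := by
        congr 2
        rw [← ENNReal.ofReal_mul (by positivity), ← ENNReal.ofReal_mul (by positivity),
          ← ENNReal.ofReal_mul (by positivity), ← ENNReal.ofReal_mul (by positivity)]
        congr 1
        have h1 : r ^ α = (1 / 2) ^ (α - d) * ρ ^ ((d : ℝ) - α) * r ^ d := by
          have h2 : r = (1 / 2) * ρ⁻¹ := by rw [hr_def]; field_simp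
          have h3 : ρ ^ ((d : ℝ) - α) = ρ⁻¹ ^ (α - d) := by
            rw [Real.inv_rpow hρ.le, ← Real.rpow_neg hρ.le]; congr 1; ring
          rw [h3, ← Real.mul_rpow (by norm_num) (by positivity), ← h2, ← Real.rpow_natCast r d,
            ← Real.rpow_add hr]
          congr 1; ring
        rw [h1, hbv]
        field_simp
        ring
    _ = _ := by
        rw [ENNReal.ofReal]
        ring

/-- If `G` is supported in a ball of radius `ρ`, then
`∫ |Ĝ|² dμ ≲ ⟨μ⟩_α ρ^{d-α} ‖G‖₂²`. -/
theorem lintegral_fourierHat_sq_le_of_support_closedBall {d : ℕ} (α : ℝ) :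
    ∃ K : ℝ≥0, ∀ (μ : Measure (Rd d)) [SFinite μ] (c : Rd d) (ρ : ℝ), 0 < ρ → ∀ G : Rd d → ℂ,
      Measurable G → Integrable G → Function.support G ⊆ Metric.closedBall c ρ →
      ∫⁻ x, ‖fourierHat G x‖ₑ ^ 2 ∂μ
        ≤ K * growthNorm α μ * ENNReal.ofReal (ρ ^ ((d : ℝ) - α)) * ∫⁻ ξ, ‖G ξ‖ₑ ^ 2 := by
  obtain ⟨K, hK⟩ := lintegral_fourierHat_sq_le_of_support_closedBall_zero (d := d) α
  refine ⟨K, fun μ _ c ρ hρ G hGm hG hsupp => ?_⟩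
  have h := hK μ ρ hρ (fun ξ => G (ξ + c)) (by fun_prop) (hG.comp_add_right c) (by
    intro ξ hξ
    have : ξ + c ∈ Metric.closedBall c ρ := hsupp hξ
    simpa using this)
  simp_rw [norm_fourierHat_translate] at h
  rwa [lintegral_add_right_eq_self (fun ξ => ‖G ξ‖ₑ ^ 2) c] at h

/-! ### The bilinear `L²(μ)` estimate through convolution. -/

open scoped Convolution in
theorem fourierHat_mul_eq_fourierHat_convolution {d : ℕ} {h₁ h₂ : Rd d → ℂ} (hi₁ : Integrable h₁)
    (hi₂ : Integrable h₂) (x : Rd d) :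
    fourierHat (h₁ ⋆[ContinuousLinearMap.mul ℂ ℂ] h₂) x = fourierHat h₁ x * fourierHat h₂ x := by
  simp_rw [fourierHat_eq_fourier]
  exact Real.fourier_mul_convolution_eq hi₁ hi₂ _

open scoped Convolution in
/-- If for every `ζ` the set of `ξ` with `ξ ∈ supp h₁`, `ζ - ξ ∈ supp h₂` has measure at most `V`,
then `‖h₁ ⋆ h₂‖₂² ≤ V ‖h₁‖₂² ‖h₂‖₂²`. -/
theorem lintegral_convolution_sq_le {d : ℕ} {h₁ h₂ : Rd d → ℂ} (hm₁ : Measurable h₁)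
    (hm₂ : Measurable h₂) {V : ℝ≥0∞}
    (hV : ∀ ζ, volume {ξ | h₁ ξ ≠ 0 ∧ h₂ (ζ - ξ) ≠ 0} ≤ V) :
    ∫⁻ ζ, ‖(h₁ ⋆[ContinuousLinearMap.mul ℂ ℂ] h₂) ζ‖ₑ ^ 2
      ≤ V * ((∫⁻ ξ, ‖h₁ ξ‖ₑ ^ 2) * ∫⁻ ξ, ‖h₂ ξ‖ₑ ^ 2) := by
  have hS : ∀ ζ, MeasurableSet {ξ | h₁ ξ ≠ 0 ∧ h₂ (ζ - ξ) ≠ 0} := fun ζ =>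
    (hm₁ (measurableSet_singleton 0).compl).inter
      ((hm₂.comp (measurable_const.sub measurable_id)) (measurableSet_singleton 0).compl)
  have h1 : ∀ ζ, ‖(h₁ ⋆[ContinuousLinearMap.mul ℂ ℂ] h₂) ζ‖ₑ ^ 2
      ≤ V * ∫⁻ ξ, ‖h₁ ξ‖ₑ ^ 2 * ‖h₂ (ζ - ξ)‖ₑ ^ 2 := by
    intro ζ
    calc ‖(h₁ ⋆[ContinuousLinearMap.mul ℂ ℂ] h₂) ζ‖ₑ ^ 2
        ≤ (∫⁻ ξ, ‖h₁ ξ‖ₑ * ‖h₂ (ζ - ξ)‖ₑ) ^ 2 := by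
          gcongr
          refine (enorm_integral_le_lintegral_enorm _).trans (le_of_eq ?_)
          simp
      -- Restricting to the overlap before Cauchy–Schwarz is what produces the factor `V`.
      _ = (∫⁻ ξ in {ξ | h₁ ξ ≠ 0 ∧ h₂ (ζ - ξ) ≠ 0}, ‖h₁ ξ‖ₑ * ‖h₂ (ζ - ξ)‖ₑ) ^ 2 := by
          rw [← lintegral_indicator (hS ζ)]
          congr 2
          ext ξ
          by_cases h : h₁ ξ ≠ 0 ∧ h₂ (ζ - ξ) ≠ 0
          · rw [indicator_of_mem (by exact h)]
          · rw [indicator_of_notMem (by exact h)]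
            by_cases h' : h₁ ξ = 0
            · simp [h']
            · have : h₂ (ζ - ξ) = 0 := by tauto
              simp [this]
      _ ≤ volume.restrict {ξ | h₁ ξ ≠ 0 ∧ h₂ (ζ - ξ) ≠ 0} univ *
          ∫⁻ ξ in {ξ | h₁ ξ ≠ 0 ∧ h₂ (ζ - ξ) ≠ 0}, (‖h₁ ξ‖ₑ * ‖h₂ (ζ - ξ)‖ₑ) ^ 2 :=
          lintegral_sq_le (by fun_prop)
      _ ≤ V * ∫⁻ ξ, (‖h₁ ξ‖ₑ * ‖h₂ (ζ - ξ)‖ₑ) ^ 2 := by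
          rw [Measure.restrict_apply_univ]
          gcongr
          · exact hV ζ
          · exact Measure.restrict_le_self
      _ = _ := by simp_rw [mul_pow]
  calc _ ≤ ∫⁻ ζ, V * ∫⁻ ξ, ‖h₁ ξ‖ₑ ^ 2 * ‖h₂ (ζ - ξ)‖ₑ ^ 2 := lintegral_mono h1
    _ = V * ∫⁻ ζ, ∫⁻ ξ, ‖h₁ ξ‖ₑ ^ 2 * ‖h₂ (ζ - ξ)‖ₑ ^ 2 := by
        rw [lintegral_const_mul]
        exact Measurable.lintegral_prod_right' (f := fun p : Rd d × Rd d =>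
          ‖h₁ p.2‖ₑ ^ 2 * ‖h₂ (p.1 - p.2)‖ₑ ^ 2) (by fun_prop)
    _ = V * ∫⁻ ξ, ∫⁻ ζ, ‖h₁ ξ‖ₑ ^ 2 * ‖h₂ (ζ - ξ)‖ₑ ^ 2 := by
        rw [lintegral_lintegral_swap]
        exact Measurable.aemeasurable (by unfold Function.uncurry; fun_prop)
    _ = V * ∫⁻ ξ, ‖h₁ ξ‖ₑ ^ 2 * ∫⁻ ζ, ‖h₂ ζ‖ₑ ^ 2 := by
        congr 2
        ext ξ
        rw [lintegral_const_mul _ (by fun_prop)]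
        congr 1
        exact lintegral_sub_right_eq_self (fun ζ => ‖h₂ ζ‖ₑ ^ 2) ξ
    _ = _ := by rw [lintegral_mul_const _ (by fun_prop)]

open scoped Convolution in
/-- Bilinear `L²(μ)` estimate under a transversality hypothesis on the supports. -/
theorem lintegral_fourierHat_mul_sq_le {d : ℕ} (α : ℝ) :
    ∃ K : ℝ≥0, ∀ (μ : Measure (Rd d)) [SFinite μ] (c : Rd d) (ρ : ℝ), 0 < ρ →
      ∀ h₁ h₂ : Rd d → ℂ, Measurable h₁ → Measurable h₂ → Integrable h₁ → Integrable h₂ →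
      (∀ ξ η, h₁ ξ ≠ 0 → h₂ η ≠ 0 → ξ + η ∈ Metric.closedBall c ρ) →
      ∀ V : ℝ≥0∞, (∀ ζ, volume {ξ | h₁ ξ ≠ 0 ∧ h₂ (ζ - ξ) ≠ 0} ≤ V) →
      ∫⁻ x, (‖fourierHat h₁ x‖ₑ * ‖fourierHat h₂ x‖ₑ) ^ 2 ∂μ
        ≤ K * growthNorm α μ * ENNReal.ofReal (ρ ^ ((d : ℝ) - α)) *
          (V * ((∫⁻ ξ, ‖h₁ ξ‖ₑ ^ 2) * ∫⁻ ξ, ‖h₂ ξ‖ₑ ^ 2)) := by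
  obtain ⟨K, hK⟩ := lintegral_fourierHat_sq_le_of_support_closedBall (d := d) α
  refine ⟨K, fun μ _ c ρ hρ h₁ h₂ hm₁ hm₂ hi₁ hi₂ hball V hV => ?_⟩
  have hGm : Measurable (h₁ ⋆[ContinuousLinearMap.mul ℂ ℂ] h₂) := by
    have : Measurable fun p : Rd d × Rd d => h₁ p.2 * h₂ (p.1 - p.2) := by fun_prop
    exact (this.stronglyMeasurable.integral_prod_right' (ν := volume)).measurable
  have h := hK μ c ρ hρ (h₁ ⋆[ContinuousLinearMap.mul ℂ ℂ] h₂) hGm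
    (hi₁.integrable_convolution _ hi₂) ?_
  · refine le_trans (le_of_eq ?_) (h.trans ?_)
    · congr 1
      ext x
      rw [fourierHat_mul_eq_fourierHat_convolution hi₁ hi₂, enorm_mul]
    · gcongr
      exact lintegral_convolution_sq_le hm₁ hm₂ hV
  · intro ζ hζ
    by_contra hcon
    refine hζ ?_
    rw [convolution_def]
    refine integral_eq_zero_of_ae (Filter.Eventually.of_forall fun ξ => ?_)
    by_cases h1 : h₁ ξ = 0
    · simp [h1]
    · by_cases h2 : h₂ (ζ - ξ) = 0
      · simp [h2]
      · refine absurd ?_ hcon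
        simpa using hball ξ (ζ - ξ) h1 h2

/-! ### Localization to parallel slabs. -/

/-- Bessel's inequality for functions on `[-1,1] ⊂ [-π,π]`. -/
theorem tsum_enorm_integral_cexp_sq_le {f : ℝ → ℂ} (hf : Measurable f) :
    ∑' k : ℤ, ‖∫ u in Icc (-1 : ℝ) 1, Complex.exp (Complex.I * ((k * u : ℝ) : ℂ)) * f u‖ₑ ^ 2
      ≤ ENNReal.ofReal (2 * Real.pi) * ∫⁻ u in Icc (-1 : ℝ) 1, ‖f u‖ₑ ^ 2 := by
  have hpi := Real.pi_pos
  have hpi3 := Real.pi_gt_three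
  rcases eq_or_ne (∫⁻ u in Icc (-1 : ℝ) 1, ‖f u‖ₑ ^ 2) ∞ with h | h
  · rw [h, ENNReal.mul_top (by simpa using hpi)]
    exact le_top
  set F : ℝ → ℂ := (Icc (-1 : ℝ) 1).indicator f with hF
  have hab : -Real.pi < Real.pi := by linarith
  have hsub : Icc (-1 : ℝ) 1 ⊆ Ioc (-Real.pi) Real.pi := fun x hx =>
    ⟨by linarith [hx.1], by linarith [hx.2]⟩
  have hFm : Measurable F := hf.indicator measurableSet_Icc
  have hFsq : ∀ s : Set ℝ, Icc (-1 : ℝ) 1 ⊆ s →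
      ∫⁻ u in s, ‖F u‖ₑ ^ 2 = ∫⁻ u in Icc (-1 : ℝ) 1, ‖f u‖ₑ ^ 2 := by
    intro s hs
    have : (fun u => ‖F u‖ₑ ^ 2) = (Icc (-1 : ℝ) 1).indicator (fun u => ‖f u‖ₑ ^ 2) := by
      ext u
      by_cases hu : u ∈ Icc (-1 : ℝ) 1
      · simp only [hF, indicator_of_mem hu]
      · simp only [hF, indicator_of_notMem hu]; simp
    rw [this, setLIntegral_indicator measurableSet_Icc, inter_eq_left.2 hs]
  have hL2 : MemLp F 2 (volume.restrict (Ioc (-Real.pi) Real.pi)) := by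
    refine ⟨hFm.aestronglyMeasurable, ?_⟩
    rw [eLpNorm_lt_top_iff_lintegral_rpow_enorm_lt_top (by norm_num) (by norm_num)]
    have := hFsq _ hsub
    simp only [ENNReal.toReal_ofNat, ENNReal.rpow_ofNat]
    rw [this]
    exact h.lt_top
  have hP := hasSum_sq_fourierCoeffOn hab hL2
  -- Fourier coefficients carry `e^{-iku}`, hence the index `-k`. Extending `f` by zero to a period
  -- of length `2π` makes integer frequencies orthogonal.
  have hcoeff : ∀ k : ℤ, ∫ u in Icc (-1 : ℝ) 1, Complex.exp (Complex.I * ((k * u : ℝ) : ℂ)) * f u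
      = (2 * Real.pi : ℝ) * fourierCoeffOn hab F (-k) := by
    intro k
    rw [fourierCoeffOn_eq_integral, intervalIntegral.integral_of_le hab.le]
    have h1 : ∀ u : ℝ, (fourier (-(-k)) (u : AddCircle (Real.pi - -Real.pi))) • F u
        = (Icc (-1 : ℝ) 1).indicator
          (fun u => Complex.exp (Complex.I * ((k * u : ℝ) : ℂ)) * f u) u := by
      intro u
      by_cases hu : u ∈ Icc (-1 : ℝ) 1
      · simp only [hF, indicator_of_mem hu]
        rw [fourier_coe_apply, smul_eq_mul]
        congr 2
        have : (Real.pi : ℂ) ≠ 0 := by exact_mod_cast hpi.ne'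
        push_cast
        field_simp
        ring
      · simp only [hF, indicator_of_notMem hu]; simp
    simp_rw [h1]
    rw [setIntegral_indicator measurableSet_Icc, inter_eq_right.2 hsub, Complex.real_smul,
      ← mul_assoc, ← Complex.ofReal_mul]
    have : (2 * Real.pi * (1 / (Real.pi - -Real.pi))) = 1 := by field_simp; ring
    rw [this]; simp
  have hreal : HasSum (fun k : ℤ => ‖∫ u in Icc (-1 : ℝ) 1,
      Complex.exp (Complex.I * ((k * u : ℝ) : ℂ)) * f u‖ ^ 2)
      ((2 * Real.pi) ^ 2 * ((Real.pi - -Real.pi)⁻¹ • ∫ x in (-Real.pi)..Real.pi, ‖F x‖ ^ 2)) := by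
    have h2 := (hP.mul_left ((2 * Real.pi) ^ 2))
    have h3 := (Equiv.neg ℤ).hasSum_iff.2 h2
    refine cast (congrArg (fun φ : ℤ → ℝ => HasSum φ _) (funext fun k => ?_)) h3
    simp only [Function.comp, Equiv.neg_apply]
    rw [hcoeff k, norm_mul, Complex.norm_real, Real.norm_of_nonneg (by positivity)]
    ring
  have hint : ENNReal.ofReal (∫ x in (-Real.pi)..Real.pi, ‖F x‖ ^ 2)
      = ∫⁻ u in Icc (-1 : ℝ) 1, ‖f u‖ₑ ^ 2 := by
    rw [intervalIntegral.integral_of_le hab.le, ofReal_integral_eq_lintegral_ofReal, ← hFsq _ hsub]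
    · congr 1
      ext u
      rw [ENNReal.ofReal_pow (norm_nonneg _), ofReal_norm]
    · exact hL2.integrable_norm_pow (by norm_num)
    · exact Filter.Eventually.of_forall fun u => by positivity
  rw [← hint, ← ENNReal.ofReal_mul (by positivity)]
  have h4 := ENNReal.ofReal_tsum_of_nonneg (fun k : ℤ => by positivity) hreal.summable
  rw [hreal.tsum_eq] at h4
  have h5 : ∀ k : ℤ, ENNReal.ofReal (‖∫ u in Icc (-1 : ℝ) 1,
      Complex.exp (Complex.I * ((k * u : ℝ) : ℂ)) * f u‖ ^ 2) = ‖∫ u in Icc (-1 : ℝ) 1,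
      Complex.exp (Complex.I * ((k * u : ℝ) : ℂ)) * f u‖ₑ ^ 2 := fun k => by
    rw [ENNReal.ofReal_pow (norm_nonneg _), ofReal_norm]
  simp_rw [h5] at h4
  rw [← h4]
  refine ENNReal.ofReal_le_ofReal (le_of_eq ?_)
  rw [smul_eq_mul]
  field_simp
  ring

/-- A piece of `g` whose Fourier transform is essentially localized to the slab
`|⟨x, v⟩ - k| ≲ 1`. -/
noncomputable def slabPiece {d : ℕ} (g : Rd d → ℂ) (v : Rd d) (k : ℤ) (ξ : Rd d) : ℂ :=
  ∫ u in Icc (-1 : ℝ) 1, Complex.exp (Complex.I * ((k * u : ℝ) : ℂ)) * g (ξ + u • v)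

theorem measurable_slabPiece {d : ℕ} {g : Rd d → ℂ} (hg : Measurable g) (v : Rd d) (k : ℤ) :
    Measurable (slabPiece g v k) := by
  have : Measurable fun p : Rd d × ℝ =>
      Complex.exp (Complex.I * ((k * p.2 : ℝ) : ℂ)) * g (p.1 + p.2 • v) := by fun_prop
  exact (this.stronglyMeasurable.integral_prod_right'
    (ν := volume.restrict (Icc (-1 : ℝ) 1))).measurable

theorem exists_ne_zero_of_slabPiece_ne_zero {d : ℕ} {g : Rd d → ℂ} {v : Rd d} {k : ℤ} {ξ : Rd d}
    (h : slabPiece g v k ξ ≠ 0) : ∃ u ∈ Icc (-1 : ℝ) 1, g (ξ + u • v) ≠ 0 := by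
  by_contra! hcon
  refine h ?_
  refine setIntegral_eq_zero_of_forall_eq_zero fun u hu => ?_
  rw [hcon u hu, mul_zero]

theorem integrable_shear {d : ℕ} {g : Rd d → ℂ} (hgm : Measurable g) (hg : Integrable g)
    (v : Rd d) : Integrable (fun p : Rd d × ℝ => g (p.1 + p.2 • v))
      (volume.prod (volume.restrict (Icc (-1 : ℝ) 1))) := by
  rw [integrable_prod_iff']
  · refine ⟨Filter.Eventually.of_forall fun u => ?_, ?_⟩
    · exact hg.comp_add_right (u • v)
    have : ∀ u : ℝ, ∫ ξ : Rd d, ‖g (ξ + u • v)‖ = ∫ ξ, ‖g ξ‖ := fun u =>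
      integral_add_right_eq_self (fun ξ => ‖g ξ‖) _
    simp_rw [this]
    exact integrable_const _
  · exact Measurable.aestronglyMeasurable (by fun_prop)

theorem integrable_shear_cexp {d : ℕ} {g : Rd d → ℂ} (hgm : Measurable g) (hg : Integrable g)
    (v : Rd d) (k : ℤ) : Integrable (fun p : Rd d × ℝ =>
      Complex.exp (Complex.I * ((k * p.2 : ℝ) : ℂ)) * g (p.1 + p.2 • v))
      (volume.prod (volume.restrict (Icc (-1 : ℝ) 1))) := by
  refine (integrable_shear hgm hg v).bdd_mul (c := 1)
    (Continuous.aestronglyMeasurable (by fun_prop)) (Filter.Eventually.of_forall fun p => ?_)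
  rw [norm_cexp_I_mul]

theorem integrable_slabPiece {d : ℕ} {g : Rd d → ℂ} (hgm : Measurable g) (hg : Integrable g)
    (v : Rd d) (k : ℤ) : Integrable (slabPiece g v k) :=
  (integrable_shear_cexp hgm hg v k).integral_prod_left

/-- Translating `g` by `u • v` multiplies `ĝ` by a character in `⟨x, v⟩`, so averaging against
`e^{iku}` multiplies `ĝ` by a bump function of `k - ⟨x, v⟩`. -/
theorem fourierHat_slabPiece {d : ℕ} {g : Rd d → ℂ} (hgm : Measurable g) (hg : Integrable g)
    (v : Rd d) (k : ℤ) (x : Rd d) :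
    fourierHat (slabPiece g v k) x =
      (∫ u in Icc (-1 : ℝ) 1, Complex.exp (Complex.I * (((k - inner ℝ x v) * u : ℝ) : ℂ))) *
        fourierHat g x := by
  have h0 : Integrable (fun p : Rd d × ℝ => Complex.exp (Complex.I * ((inner ℝ x p.1 : ℝ) : ℂ)) *
      (Complex.exp (Complex.I * ((k * p.2 : ℝ) : ℂ)) * g (p.1 + p.2 • v)))
      (volume.prod (volume.restrict (Icc (-1 : ℝ) 1))) := by
    refine (integrable_shear_cexp hgm hg v k).bdd_mul (c := 1)
      (Continuous.aestronglyMeasurable (by fun_prop)) (Filter.Eventually.of_forall fun p => ?_)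
    rw [norm_cexp_I_mul]
  calc fourierHat (slabPiece g v k) x
      = ∫ ξ, ∫ u in Icc (-1 : ℝ) 1, Complex.exp (Complex.I * ((inner ℝ x ξ : ℝ) : ℂ)) *
      (Complex.exp (Complex.I * ((k * u : ℝ) : ℂ)) * g (ξ + u • v)) := by
        unfold fourierHat slabPiece
        congr 1
        ext ξ
        rw [← integral_const_mul]
    _ = ∫ u in Icc (-1 : ℝ) 1, (∫ ξ, Complex.exp (Complex.I * ((inner ℝ x ξ : ℝ) : ℂ)) *
      (Complex.exp (Complex.I * ((k * u : ℝ) : ℂ)) * g (ξ + u • v))) :=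
        integral_integral_swap h0
    _ = ∫ u in Icc (-1 : ℝ) 1, Complex.exp (Complex.I * (((k - inner ℝ x v) * u : ℝ) : ℂ)) *
        fourierHat g x := by
        congr 1
        ext u
        have h1 := fourierHat_translate g (u • v) x
        have h2 : ∫ ξ, Complex.exp (Complex.I * ((inner ℝ x ξ : ℝ) : ℂ)) *
            (Complex.exp (Complex.I * ((k * u : ℝ) : ℂ)) * g (ξ + u • v))
            = Complex.exp (Complex.I * ((k * u : ℝ) : ℂ)) *
              fourierHat (fun ξ => g (ξ + u • v)) x := by
          unfold fourierHat
          rw [← integral_const_mul]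
          congr 1
          ext ξ
          ring
        rw [h2, h1, ← mul_assoc, ← Complex.exp_add, inner_smul_right]
        congr 2
        push_cast
        ring
    _ = _ := integral_mul_const _ _

/-- On the slab the multiplier has modulus at least `1`: its integrand has real part at least `1/2`
on an interval of length `2`. -/
theorem enorm_fourierHat_le_slabPiece {d : ℕ} {g : Rd d → ℂ} (hgm : Measurable g)
    (hg : Integrable g) (v : Rd d) (k : ℤ) (x : Rd d) (hx : |inner ℝ x v - k| ≤ 1 / 2) :
    ‖fourierHat g x‖ₑ ≤ ‖fourierHat (slabPiece g v k) x‖ₑ := by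
  rw [fourierHat_slabPiece hgm hg, enorm_mul]
  set y : ℝ := k - inner ℝ x v with hy
  have hyle : |y| ≤ 1 / 2 := by rwa [hy, abs_sub_comm]
  have hcont : Continuous fun u : ℝ => Complex.exp (Complex.I * ((y * u : ℝ) : ℂ)) := by fun_prop
  have hint : IntegrableOn (fun u : ℝ => Complex.exp (Complex.I * ((y * u : ℝ) : ℂ)))
      (Icc (-1 : ℝ) 1) := hcont.continuousOn.integrableOn_Icc
  have h1 : (1 : ℝ) ≤ ‖∫ u in Icc (-1 : ℝ) 1, Complex.exp (Complex.I * ((y * u : ℝ) : ℂ))‖ := by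
    refine le_trans ?_ (Complex.re_le_norm _)
    have h2 : (∫ u in Icc (-1 : ℝ) 1, Complex.exp (Complex.I * ((y * u : ℝ) : ℂ))).re
        = ∫ u in Icc (-1 : ℝ) 1, (Complex.exp (Complex.I * ((y * u : ℝ) : ℂ))).re := by
      simpa using (integral_re hint).symm
    have h3 : (1 : ℝ) = ∫ u in Icc (-1 : ℝ) 1, (1 / 2 : ℝ) := by
      rw [setIntegral_const, smul_eq_mul]
      norm_num [Measure.real, Real.volume_Icc]
    rw [h2]
    refine h3.le.trans ?_
    refine setIntegral_mono_on (integrableOn_const (by simp)) hint.re measurableSet_Icc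
      fun u hu => ?_
    rw [mul_comm Complex.I, Complex.exp_ofReal_mul_I_re]
    have h4 := Real.one_sub_sq_div_two_le_cos (x := y * u)
    have h5 : |y * u| ≤ 1 / 2 := by
      rw [abs_mul]
      have := abs_le.2 hu
      nlinarith [abs_nonneg y, abs_nonneg u]
    have h6 := sq_abs (y * u)
    nlinarith [abs_nonneg (y * u)]
  calc ‖fourierHat g x‖ₑ = 1 * ‖fourierHat g x‖ₑ := (one_mul _).symm
    _ ≤ _ := by
      gcongr
      rw [← ofReal_norm]
      exact ENNReal.one_le_ofReal.2 h1

/-- For fixed `ξ` the numbers `slabPiece g v k ξ` are, up to normalization, Fourier coefficients of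
`u ↦ g (ξ + u • v)`, so Bessel applies pointwise in `ξ`. The constant is `2π` times the length `2`
of the `u`-interval. -/
theorem tsum_lintegral_slabPiece_sq_le {d : ℕ} {g : Rd d → ℂ} (hgm : Measurable g) (v : Rd d) :
    ∑' k : ℤ, ∫⁻ ξ, ‖slabPiece g v k ξ‖ₑ ^ 2
      ≤ ENNReal.ofReal (4 * Real.pi) * ∫⁻ ξ, ‖g ξ‖ₑ ^ 2 := by
  rw [← lintegral_tsum fun k => ((measurable_slabPiece hgm v k).enorm.pow_const 2).aemeasurable]
  calc ∫⁻ ξ, ∑' k : ℤ, ‖slabPiece g v k ξ‖ₑ ^ 2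
      ≤ ∫⁻ ξ, ENNReal.ofReal (2 * Real.pi) * ∫⁻ u in Icc (-1 : ℝ) 1, ‖g (ξ + u • v)‖ₑ ^ 2 :=
        lintegral_mono fun ξ => tsum_enorm_integral_cexp_sq_le (by fun_prop)
    _ = ENNReal.ofReal (2 * Real.pi) *
        ∫⁻ ξ, ∫⁻ u in Icc (-1 : ℝ) 1, ‖g (ξ + u • v)‖ₑ ^ 2 := by
        rw [lintegral_const_mul]
        exact Measurable.lintegral_prod_right' (f := fun p : Rd d × ℝ =>
          ‖g (p.1 + p.2 • v)‖ₑ ^ 2) (by fun_prop)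
    _ = ENNReal.ofReal (2 * Real.pi) *
        ∫⁻ u in Icc (-1 : ℝ) 1, (∫⁻ ξ, ‖g (ξ + u • v)‖ₑ ^ 2) := by
        rw [lintegral_lintegral_swap]
        exact Measurable.aemeasurable (by unfold Function.uncurry; fun_prop)
    _ = ENNReal.ofReal (2 * Real.pi) * ∫⁻ u in Icc (-1 : ℝ) 1, (∫⁻ ξ, ‖g ξ‖ₑ ^ 2) := by
        congr 2
        ext u
        exact lintegral_add_right_eq_self (fun ξ => ‖g ξ‖ₑ ^ 2) (u • v)
    _ = _ := by
        rw [setLIntegral_const, Real.volume_Icc, mul_comm (lintegral _ _), ← mul_assoc,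
          ← ENNReal.ofReal_mul (by positivity)]
        congr 2
        ring

/-- Cauchy–Schwarz in the index after taking square roots; it recombines the slabs without loss. -/
theorem sq_tsum_le_of_sq_le {ι : Type*} {a b c : ι → ℝ≥0∞} {P : ℝ≥0∞}
    (h : ∀ i, a i ^ 2 ≤ P * (b i * c i)) :
    (∑' i, a i) ^ 2 ≤ P * ((∑' i, b i) * ∑' i, c i) := by
  have hs : ∀ y : ℝ≥0∞, (y ^ 2) ^ (1 / 2 : ℝ) = y := fun y => by
    rw [← ENNReal.rpow_natCast, ← ENNReal.rpow_mul]; simp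
  have hs' : ∀ y : ℝ≥0∞, (y ^ (1 / 2 : ℝ)) ^ 2 = y := fun y => by
    rw [← ENNReal.rpow_natCast, ← ENNReal.rpow_mul]; simp
  have h1 : ∀ i, a i ≤ P ^ (1 / 2 : ℝ) * (b i ^ (1 / 2 : ℝ) * c i ^ (1 / 2 : ℝ)) := by
    intro i
    have := ENNReal.rpow_le_rpow (h i) (show (0 : ℝ) ≤ 1 / 2 by norm_num)
    rwa [hs, ENNReal.mul_rpow_of_nonneg _ _ (by norm_num),
      ENNReal.mul_rpow_of_nonneg _ _ (by norm_num)] at this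
  calc (∑' i, a i) ^ 2
      ≤ (∑' i, P ^ (1 / 2 : ℝ) * (b i ^ (1 / 2 : ℝ) * c i ^ (1 / 2 : ℝ))) ^ 2 := by
        gcongr with i
        exact h1 i
    _ = P * (∑' i, b i ^ (1 / 2 : ℝ) * c i ^ (1 / 2 : ℝ)) ^ 2 := by
        rw [ENNReal.tsum_mul_left, mul_pow, hs']
    _ ≤ P * ((∑' i, (b i ^ (1 / 2 : ℝ)) ^ 2) * ∑' i, (c i ^ (1 / 2 : ℝ)) ^ 2) := by
        gcongr
        exact tsum_mul_sq_le _ _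
    _ = _ := by simp_rw [hs']

/-! ### Measure of slabs and the bilinear `L¹(μ)` estimate. -/

theorem measurableSet_slab {d : ℕ} (r : ℝ) (v : Rd d) (k B : ℝ) :
    MeasurableSet {x : Rd d | x ∈ Metric.closedBall 0 r ∧ |inner ℝ x v - k| ≤ B} := by
  have h : IsClosed {x : Rd d | |inner ℝ x v - k| ≤ B} :=
    isClosed_le (by fun_prop) continuous_const
  exact Metric.isClosed_closedBall.measurableSet.inter h.measurableSet

/-- A slab of width `≲ B / ‖v‖` has volume `≲ B / ‖v‖` inside a ball: disjoint translates of it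
are packed into a larger ball. -/
theorem volume_slab_le {d : ℕ} (v : Rd d) (k : ℝ) {B : ℝ} (hB : 0 < B) :
    ENNReal.ofReal ‖v‖ * volume {x : Rd d | x ∈ Metric.closedBall 0 2 ∧ |inner ℝ x v - k| ≤ B}
      ≤ ENNReal.ofReal (3 * B) * volume (Metric.closedBall (0 : Rd d) 3) := by
  rcases eq_or_ne v 0 with rfl | hv
  · simp
  have hv0 : 0 < ‖v‖ := norm_pos_iff.2 hv
  set S := {x : Rd d | x ∈ Metric.closedBall 0 2 ∧ |inner ℝ x v - k| ≤ B} with hS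
  have hSm : MeasurableSet S := measurableSet_slab _ _ _ _
  -- Shifting by `w` moves `⟨x, v⟩` by `3B`, more than the full width `2B`, so the translates are
  -- disjoint; `M` shifts amount to length at most `1`, which keeps them in the ball of radius `3`.
  set w : Rd d := (3 * B / ‖v‖ ^ 2) • v with hw
  have hwv : inner ℝ w v = 3 * B := by
    rw [hw, inner_smul_left, real_inner_self_eq_norm_sq]
    simp only [conj_trivial]
    field_simp
  have hwn : ‖w‖ = 3 * B / ‖v‖ := by
    rw [hw, norm_smul, Real.norm_of_nonneg (by positivity)]
    field_simp
  set M := ⌊‖v‖ / (3 * B)⌋₊ with hM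
  have hMle : (M : ℝ) ≤ ‖v‖ / (3 * B) := Nat.floor_le (by positivity)
  have hMlt : ‖v‖ / (3 * B) < M + 1 := Nat.lt_floor_add_one _
  set Sm : ℕ → Set (Rd d) := fun m => (fun x => x + (-((m : ℝ) • w))) ⁻¹' S with hSmdef
  have hmeas : ∀ m, MeasurableSet (Sm m) := fun m => (measurable_add_const _) hSm
  have hvol : ∀ m, volume (Sm m) = volume S := fun m => measure_preimage_add_right _ _ _
  have hdisj : Pairwise (Function.onFun Disjoint Sm) := by
    intro m n hmn
    refine Set.disjoint_left.2 fun x hx hx' => ?_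
    have h1 := hx.2
    have h2 := hx'.2
    simp only [inner_add_left, inner_neg_left, inner_smul_left, hwv, conj_trivial] at h1 h2
    have h3 : |((m : ℝ) - n) * (3 * B)| ≤ 2 * B := by
      rw [abs_le] at h1 h2 ⊢
      constructor <;> nlinarith
    rw [abs_mul, abs_of_pos (by positivity : 0 < 3 * B)] at h3
    have h4 : (1 : ℝ) ≤ |(m : ℝ) - n| := by
      have : (1 : ℤ) ≤ |(m : ℤ) - n| := Int.one_le_abs (by omega)
      exact_mod_cast this
    nlinarith
  have hsub : (⋃ m ∈ Finset.range (M + 1), Sm m) ⊆ Metric.closedBall 0 3 := by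
    intro x hx
    simp only [mem_iUnion, Finset.mem_range] at hx
    obtain ⟨m, hm, hx⟩ := hx
    have h1 : ‖x + (-((m : ℝ) • w))‖ ≤ 2 := by simpa using hx.1
    have h2 : ‖(m : ℝ) • w‖ ≤ 1 := by
      rw [norm_smul, Real.norm_of_nonneg (by positivity), hwn]
      have : (m : ℝ) ≤ M := by exact_mod_cast Nat.lt_succ_iff.1 hm
      calc (m : ℝ) * (3 * B / ‖v‖) ≤ ‖v‖ / (3 * B) * (3 * B / ‖v‖) := by
            gcongr; exact this.trans hMle
        _ = 1 := by field_simp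
    have h3 : x = (x + (-((m : ℝ) • w))) + (m : ℝ) • w := by abel
    rw [mem_closedBall_zero_iff, h3]
    refine (norm_add_le _ _).trans ?_
    linarith
  have hsum : ((M + 1 : ℕ) : ℝ≥0∞) * volume S ≤ volume (Metric.closedBall (0 : Rd d) 3) := by
    calc ((M + 1 : ℕ) : ℝ≥0∞) * volume S = ∑ m ∈ Finset.range (M + 1), volume (Sm m) := by
          simp [hvol]
      _ = volume (⋃ m ∈ Finset.range (M + 1), Sm m) :=
          (measure_biUnion_finset (fun i _ j _ hij => hdisj hij) fun m _ => hmeas m).symm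
      _ ≤ _ := measure_mono hsub
  have h5 : ENNReal.ofReal ‖v‖ ≤ ENNReal.ofReal (3 * B) * ((M + 1 : ℕ) : ℝ≥0∞) := by
    rw [← ENNReal.ofReal_natCast, ← ENNReal.ofReal_mul (by positivity)]
    refine ENNReal.ofReal_le_ofReal ?_
    rw [div_lt_iff₀ (by positivity)] at hMlt
    push_cast
    linarith
  calc ENNReal.ofReal ‖v‖ * volume S
      ≤ ENNReal.ofReal (3 * B) * ((M + 1 : ℕ) : ℝ≥0∞) * volume S := by gcongr
    _ ≤ _ := by rw [mul_assoc]; gcongr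

/-- Covering a set by `r`-balls, in integrated form. -/
theorem volume_ball_mul_measure_le {d : ℕ} (α : ℝ) (μ : Measure (Rd d)) [SFinite μ] {r : ℝ}
    (hr : 0 < r) {T T' : Set (Rd d)} (hT : MeasurableSet T) (hT' : MeasurableSet T')
    (hTT' : ∀ x ∈ T, ∀ y, dist y x < r → y ∈ T') :
    volume (Metric.ball (0 : Rd d) r) * μ T
      ≤ growthNorm α μ * ENNReal.ofReal (r ^ α) * volume T' := by
  set f : Rd d → Rd d → ℝ≥0∞ := fun x y =>
    {p : Rd d × Rd d | p.1 ∈ T ∧ dist p.2 p.1 < r}.indicator 1 (x, y) with hf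
  have hS : MeasurableSet {p : Rd d × Rd d | p.1 ∈ T ∧ dist p.2 p.1 < r} := by
    have h : IsOpen {p : Rd d × Rd d | dist p.2 p.1 < r} :=
      isOpen_lt (by fun_prop) continuous_const
    exact (measurable_fst hT).inter h.measurableSet
  have hfm : Measurable (Function.uncurry f) := measurable_one.indicator hS
  calc volume (Metric.ball (0 : Rd d) r) * μ T
      = ∫⁻ x in T, volume (Metric.ball x r) ∂μ := by
        simp_rw [Measure.addHaar_ball_center]
        rw [setLIntegral_const]
    _ = ∫⁻ x, (∫⁻ y, f x y) ∂μ := by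
        rw [← lintegral_indicator hT]
        congr 1
        ext x
        by_cases hx : x ∈ T
        · rw [indicator_of_mem hx, ← lintegral_indicator_one Metric.isOpen_ball.measurableSet]
          congr 1
          ext y
          simp [hf, indicator, hx]
        · rw [indicator_of_notMem hx]
          simp [hf, indicator, hx]
    _ = ∫⁻ y, (∫⁻ x, f x y ∂μ) := lintegral_lintegral_swap hfm.aemeasurable
    _ ≤ ∫⁻ y in T', growthNorm α μ * ENNReal.ofReal (r ^ α) := by
        rw [← lintegral_indicator hT']
        refine lintegral_mono fun y => ?_
        by_cases hy : y ∈ T'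
        · rw [indicator_of_mem hy]
          refine le_trans ?_ (measure_ball_le_growthNorm α μ y hr)
          rw [← lintegral_indicator_one Metric.isOpen_ball.measurableSet]
          refine lintegral_mono fun x => ?_
          simp only [hf, indicator, mem_ofPred_eq, Metric.mem_ball, Pi.one_apply]
          split_ifs with h1 h2
          · exact le_rfl
          · exact absurd (by rw [dist_comm]; exact h1.2) h2
          · exact zero_le_one
          · exact le_rfl
        · rw [indicator_of_notMem hy]
          refine le_of_eq (lintegral_eq_zero_of_ae_eq_zero (Filter.Eventually.of_forall fun x => ?_))
          simp only [hf, indicator, mem_ofPred_eq, Pi.zero_apply]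
          rw [if_neg]
          exact fun h => hy (hTT' x h.1 y h.2)
    _ = _ := by rw [setLIntegral_const]

/-- The `μ`-measure of a slab of width `θ`. -/
theorem measure_slab_le {d : ℕ} (α : ℝ) {E₁ E₂ : ℝ} (hE₁ : 0 < E₁) :
    ∃ K : ℝ≥0, ∀ (μ : Measure (Rd d)) [SFinite μ] (θ : ℝ), 0 < θ → θ ≤ 1 → ∀ e : Rd d,
      E₁ ≤ ‖e‖ → ‖e‖ ≤ E₂ → ∀ k : ℝ,
      μ {x : Rd d | x ∈ Metric.closedBall 0 1 ∧ |inner ℝ x (θ⁻¹ • e) - k| ≤ 1 / 2}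
        ≤ K * growthNorm α μ * ENNReal.ofReal (θ ^ (α - d + 1)) := by
  set b := volume.real (Metric.ball (0 : Rd d) 1) with hb
  have hbpos : 0 < b := ENNReal.toReal_pos
    (Metric.measure_ball_pos _ _ one_pos).ne' measure_ball_lt_top.ne
  set b3 := volume.real (Metric.closedBall (0 : Rd d) 3) with hb3
  have hb3' : volume (Metric.closedBall (0 : Rd d) 3) = ENNReal.ofReal b3 := by
    rw [hb3, ofReal_measureReal measure_closedBall_lt_top.ne]
  refine ⟨Real.toNNReal (3 * (1 / 2 + E₂) / E₁ * b3 / b), ?_⟩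
  intro μ _ θ hθ hθ1 e he1 he2 k
  have hE₂ : 0 < E₂ := by linarith
  set v : Rd d := θ⁻¹ • e with hv
  have hvn : ‖v‖ = ‖e‖ / θ := by
    rw [hv, norm_smul, Real.norm_of_nonneg (by positivity)]; field_simp
  have hepos : 0 < ‖e‖ := hE₁.trans_le he1
  have hvpos : 0 < ‖v‖ := by rw [hvn]; positivity
  set T := {x : Rd d | x ∈ Metric.closedBall 0 1 ∧ |inner ℝ x v - k| ≤ 1 / 2}
  -- Moving a point by `θ` changes its inner product with `v = θ⁻¹ • e` by at most `‖e‖ ≤ E₂`, so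
  -- the `θ`-neighbourhood of `T` stays in this wider slab.
  set T' := {x : Rd d | x ∈ Metric.closedBall 0 2 ∧ |inner ℝ x v - k| ≤ 1 / 2 + E₂} with hT'
  have hTm : MeasurableSet T := measurableSet_slab _ _ _ _
  have hTm' : MeasurableSet T' := measurableSet_slab _ _ _ _
  have hvol := volume_slab_le v k (B := 1 / 2 + E₂) (by positivity)
  have hvol' : volume T' ≤ ENNReal.ofReal (3 * (1 / 2 + E₂) / E₁ * b3 * θ) := by
    have h1 : ENNReal.ofReal ‖v‖ * volume T' ≤ ENNReal.ofReal (3 * (1 / 2 + E₂) * b3) := by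
      refine hvol.trans (le_of_eq ?_)
      rw [hb3', ← ENNReal.ofReal_mul (by positivity)]
    have h2 : volume T' ≤ ENNReal.ofReal (3 * (1 / 2 + E₂) * b3) / ENNReal.ofReal ‖v‖ := by
      rw [ENNReal.le_div_iff_mul_le (by left; simpa using hvpos) (by simp), mul_comm]
      exact h1
    refine h2.trans ?_
    rw [← ENNReal.ofReal_div_of_pos hvpos]
    refine ENNReal.ofReal_le_ofReal ?_
    rw [hvn]
    have hb30 : 0 ≤ b3 := measureReal_nonneg
    calc 3 * (1 / 2 + E₂) * b3 / (‖e‖ / θ) = 3 * (1 / 2 + E₂) * b3 * θ / ‖e‖ := by field_simp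
      _ ≤ 3 * (1 / 2 + E₂) * b3 * θ / E₁ := by gcongr
      _ = _ := by ring
  have hmain := volume_ball_mul_measure_le α μ hθ hTm hTm' (fun x hx y hy => by
    have hyx : ‖y - x‖ ≤ θ := by rw [← dist_eq_norm]; exact hy.le
    refine ⟨?_, ?_⟩
    · have h1 : ‖x‖ ≤ 1 := by simpa using hx.1
      rw [mem_closedBall_zero_iff]
      calc ‖y‖ = ‖x + (y - x)‖ := by congr 1; abel
        _ ≤ ‖x‖ + ‖y - x‖ := norm_add_le _ _
        _ ≤ 2 := by linarith
    · have h2 : inner ℝ y v - k = (inner ℝ x v - k) + inner ℝ (y - x) v := by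
        rw [inner_sub_left]; ring
      have h3 : |inner ℝ (y - x) v| ≤ E₂ := by
        refine (abs_real_inner_le_norm _ _).trans ?_
        rw [hvn]
        calc ‖y - x‖ * (‖e‖ / θ) ≤ θ * (‖e‖ / θ) := by gcongr
          _ = ‖e‖ := by field_simp
          _ ≤ E₂ := he2
      rw [h2]
      exact (abs_add_le _ _).trans (add_le_add hx.2 h3))
  have hball : volume (Metric.ball (0 : Rd d) θ) = ENNReal.ofReal (θ ^ d * b) := by
    rw [Measure.addHaar_ball_of_pos _ _ hθ, finrank_euclideanSpace_fin,
      ENNReal.ofReal_mul (by positivity), hb, ofReal_measureReal measure_ball_lt_top.ne]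
  have hpos : 0 < θ ^ d * b := by positivity
  have hb30 : 0 ≤ b3 := measureReal_nonneg
  have h6 : μ T ≤ growthNorm α μ * ENNReal.ofReal (θ ^ α) *
      ENNReal.ofReal (3 * (1 / 2 + E₂) / E₁ * b3 * θ) / ENNReal.ofReal (θ ^ d * b) := by
    rw [ENNReal.le_div_iff_mul_le (by left; simpa using hpos) (by simp), mul_comm, ← hball]
    refine hmain.trans ?_
    gcongr
  refine h6.trans (le_of_eq ?_)
  rw [mul_assoc, ← ENNReal.ofReal_mul (by positivity), mul_div_assoc,
    ← ENNReal.ofReal_div_of_pos hpos]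
  have h7 : θ ^ α * (3 * (1 / 2 + E₂) / E₁ * b3 * θ) / (θ ^ d * b)
      = (3 * (1 / 2 + E₂) / E₁ * b3 / b) * θ ^ (α - d + 1) := by
    rw [Real.rpow_add hθ, Real.rpow_sub hθ, Real.rpow_natCast, Real.rpow_one]
    field_simp
  rw [h7, ENNReal.ofReal_mul (by positivity), ENNReal.ofReal]
  ring

/-- Bilinear `L¹(μ)` estimate: the functions are localized to slabs of width `θ` normal to `e`,
and the bilinear `L²(μ)` estimate is applied on each slab. -/
theorem sq_lintegral_fourierHat_mul_le {d : ℕ} (α : ℝ) {E₁ E₂ : ℝ} (hE₁ : 0 < E₁) :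
    ∃ K : ℝ≥0, ∀ (μ : Measure (Rd d)) [SFinite μ], μ (Metric.closedBall (0 : Rd d) 1)ᶜ = 0 →
      ∀ θ : ℝ, 0 < θ → θ ≤ 1 → ∀ e : Rd d, E₁ ≤ ‖e‖ → ‖e‖ ≤ E₂ →
      ∀ (c : Rd d) (ρ : ℝ), 0 < ρ →
      ∀ g₁ g₂ : Rd d → ℂ, Measurable g₁ → Measurable g₂ → Integrable g₁ → Integrable g₂ →
      (∀ ξ η, (∃ u ∈ Icc (-1 : ℝ) 1, g₁ (ξ + u • (θ⁻¹ • e)) ≠ 0) →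
        (∃ u ∈ Icc (-1 : ℝ) 1, g₂ (η + u • (θ⁻¹ • e)) ≠ 0) → ξ + η ∈ Metric.closedBall c ρ) →
      ∀ V : ℝ≥0∞, (∀ ζ, volume {ξ | (∃ u ∈ Icc (-1 : ℝ) 1, g₁ (ξ + u • (θ⁻¹ • e)) ≠ 0) ∧
        ∃ u ∈ Icc (-1 : ℝ) 1, g₂ (ζ - ξ + u • (θ⁻¹ • e)) ≠ 0} ≤ V) →
      (∫⁻ x, ‖fourierHat g₁ x‖ₑ * ‖fourierHat g₂ x‖ₑ ∂μ) ^ 2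
        ≤ K * growthNorm α μ ^ 2 *
          (ENNReal.ofReal (θ ^ (α - d + 1)) * ENNReal.ofReal (ρ ^ ((d : ℝ) - α))) *
          (V * ((∫⁻ ξ, ‖g₁ ξ‖ₑ ^ 2) * ∫⁻ ξ, ‖g₂ ξ‖ₑ ^ 2)) := by
  obtain ⟨K₁, hK₁⟩ := measure_slab_le (d := d) α (E₂ := E₂) hE₁
  obtain ⟨K₂, hK₂⟩ := lintegral_fourierHat_mul_sq_le (d := d) α
  refine ⟨K₁ * K₂ * Real.toNNReal (4 * Real.pi) ^ 2, ?_⟩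
  intro μ _ hμs θ hθ hθ1 e he1 he2 c ρ hρ g₁ g₂ hm₁ hm₂ hi₁ hi₂ hball V hV
  set v : Rd d := θ⁻¹ • e with hv
  set T : ℤ → Set (Rd d) := fun k =>
    {x : Rd d | x ∈ Metric.closedBall 0 1 ∧ |inner ℝ x v - k| ≤ 1 / 2} with hT
  have hTm : ∀ k, MeasurableSet (T k) := fun k => measurableSet_slab _ _ _ _
  set F : Rd d → ℝ≥0∞ := fun x => ‖fourierHat g₁ x‖ₑ * ‖fourierHat g₂ x‖ₑ with hF
  have hFm : Measurable F := (continuous_fourierHat hi₁).measurable.enorm.mul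
    (continuous_fourierHat hi₂).measurable.enorm
  have hcover : ∫⁻ x, F x ∂μ ≤ ∑' k, ∫⁻ x in T k, F x ∂μ := by
    calc ∫⁻ x, F x ∂μ = ∫⁻ x in ⋃ k, T k, F x ∂μ := by
          congr 1
          symm
          refine Measure.restrict_eq_self_of_ae_mem ?_
          have h1 : ∀ᵐ x ∂μ, x ∈ Metric.closedBall (0 : Rd d) 1 := by
            rw [ae_iff]; exact hμs
          filter_upwards [h1] with x hx
          exact mem_iUnion.2 ⟨round (inner ℝ x v), hx, abs_sub_round _⟩
      _ ≤ _ := lintegral_iUnion_le _ _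
  set P : ℝ≥0∞ := (K₁ * growthNorm α μ * ENNReal.ofReal (θ ^ (α - d + 1))) *
    (K₂ * growthNorm α μ * ENNReal.ofReal (ρ ^ ((d : ℝ) - α)) * V) with hP
  have hk : ∀ k, (∫⁻ x in T k, F x ∂μ) ^ 2
      ≤ P * ((∫⁻ ξ, ‖slabPiece g₁ v k ξ‖ₑ ^ 2) * ∫⁻ ξ, ‖slabPiece g₂ v k ξ‖ₑ ^ 2) := by
    intro k
    -- Cauchy–Schwarz gains the `μ`-measure of the slab. There the slab pieces dominate `ĝ₁` and
    -- `ĝ₂`, and the `L²(μ)` bound is applied to them; their supports are thickened along `v`, which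
    -- is why the hypotheses concern thickened supports.
    calc (∫⁻ x in T k, F x ∂μ) ^ 2
        ≤ μ.restrict (T k) univ * ∫⁻ x in T k, F x ^ 2 ∂μ := lintegral_sq_le hFm.aemeasurable
      _ ≤ (K₁ * growthNorm α μ * ENNReal.ofReal (θ ^ (α - d + 1))) *
          ∫⁻ x, (‖fourierHat (slabPiece g₁ v k) x‖ₑ *
            ‖fourierHat (slabPiece g₂ v k) x‖ₑ) ^ 2 ∂μ := by
          rw [Measure.restrict_apply_univ]
          refine mul_le_mul' (hK₁ μ θ hθ hθ1 e he1 he2 k) ?_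
          refine le_trans ?_ (setLIntegral_le_lintegral (T k) _)
          refine setLIntegral_mono' (hTm k) fun x hx => ?_
          gcongr
          refine mul_le_mul' (enorm_fourierHat_le_slabPiece hm₁ hi₁ v k x hx.2)
            (enorm_fourierHat_le_slabPiece hm₂ hi₂ v k x hx.2)
      _ ≤ (K₁ * growthNorm α μ * ENNReal.ofReal (θ ^ (α - d + 1))) *
          (K₂ * growthNorm α μ * ENNReal.ofReal (ρ ^ ((d : ℝ) - α)) *
          (V * ((∫⁻ ξ, ‖slabPiece g₁ v k ξ‖ₑ ^ 2) * ∫⁻ ξ, ‖slabPiece g₂ v k ξ‖ₑ ^ 2))) := by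
          gcongr
          refine hK₂ μ c ρ hρ _ _ (measurable_slabPiece hm₁ v k) (measurable_slabPiece hm₂ v k)
            (integrable_slabPiece hm₁ hi₁ v k) (integrable_slabPiece hm₂ hi₂ v k) ?_ V ?_
          · intro ξ η h1 h2
            exact hball ξ η (exists_ne_zero_of_slabPiece_ne_zero h1)
              (exists_ne_zero_of_slabPiece_ne_zero h2)
          · intro ζ
            refine (measure_mono fun ξ hξ => ?_).trans (hV ζ)
            exact ⟨exists_ne_zero_of_slabPiece_ne_zero hξ.1,
              exists_ne_zero_of_slabPiece_ne_zero hξ.2⟩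
      _ = _ := by rw [hP]; ring
  calc (∫⁻ x, F x ∂μ) ^ 2 ≤ (∑' k, ∫⁻ x in T k, F x ∂μ) ^ 2 := by gcongr
    _ ≤ P * ((∑' k, ∫⁻ ξ, ‖slabPiece g₁ v k ξ‖ₑ ^ 2) * ∑' k, ∫⁻ ξ, ‖slabPiece g₂ v k ξ‖ₑ ^ 2) :=
        sq_tsum_le_of_sq_le hk
    _ ≤ P * ((ENNReal.ofReal (4 * Real.pi) * ∫⁻ ξ, ‖g₁ ξ‖ₑ ^ 2) *
        (ENNReal.ofReal (4 * Real.pi) * ∫⁻ ξ, ‖g₂ ξ‖ₑ ^ 2)) := by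
        gcongr
        · exact tsum_lintegral_slabPiece_sq_le hm₁ v
        · exact tsum_lintegral_slabPiece_sq_le hm₂ v
    _ = _ := by
        have h4 : ENNReal.ofReal (4 * Real.pi) = (Real.toNNReal (4 * Real.pi) : ℝ≥0∞) := rfl
        rw [hP, h4]
        push_cast
        ring

/-! ### Geometry of arcs in a local frame. -/

/-- The volume of a neighbourhood of a Lipschitz arc of parameter length `L`. -/
theorem volume_nbhd_lipschitz_arc_le {d : ℕ} {f : ℝ → Rd d} {a L W r : ℝ} (hL : 0 ≤ L)
    (hf : ∀ s ∈ Icc a (a + L), ∀ t ∈ Icc a (a + L), |t - s| ≤ 1 → ‖f t - f s‖ ≤ W)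
    {A : Set (Rd d)} (hA : ∀ ξ ∈ A, ∃ t ∈ Icc a (a + L), ‖ξ - f t‖ ≤ r) :
    volume A ≤ ENNReal.ofReal (L + 1) * volume (Metric.closedBall (0 : Rd d) (r + W)) := by
  -- The arc is sampled at unit parameter steps, between which it moves by at most `W`.
  have hsub : A ⊆ ⋃ i ∈ Finset.range (⌊L⌋₊ + 1), Metric.closedBall (f (a + i)) (r + W) := by
    intro ξ hξ
    obtain ⟨t, ht, hξt⟩ := hA ξ hξ
    have h0 : 0 ≤ t - a := by linarith [ht.1]
    have h1 := Nat.floor_le h0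
    have h2 := Nat.lt_floor_add_one (t - a)
    simp only [mem_iUnion, Finset.mem_range]
    refine ⟨⌊t - a⌋₊, Nat.lt_succ_of_le (Nat.floor_le_floor (by linarith [ht.2])), ?_⟩
    rw [Metric.mem_closedBall, dist_eq_norm]
    have h3 := hf (a + ⌊t - a⌋₊) ⟨by linarith [Nat.cast_nonneg (α := ℝ) ⌊t - a⌋₊],
      by linarith [ht.2]⟩ t ht (by rw [abs_le]; constructor <;> linarith)
    calc ‖ξ - f (a + ⌊t - a⌋₊)‖ = ‖(ξ - f t) + (f t - f (a + ⌊t - a⌋₊))‖ := by congr 1; abel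
      _ ≤ _ := (norm_add_le _ _).trans (add_le_add hξt h3)
  calc volume A ≤ volume (⋃ i ∈ Finset.range (⌊L⌋₊ + 1), Metric.closedBall (f (a + i)) (r + W)) :=
        measure_mono hsub
    _ ≤ ∑ i ∈ Finset.range (⌊L⌋₊ + 1), volume (Metric.closedBall (f (a + (i : ℕ))) (r + W)) :=
        measure_biUnion_finset_le _ _
    _ = ((⌊L⌋₊ + 1 : ℕ) : ℝ≥0∞) * volume (Metric.closedBall (0 : Rd d) (r + W)) := by
        simp [Measure.addHaar_closedBall_center]
    _ ≤ _ := by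
        gcongr
        rw [← ENNReal.ofReal_natCast]
        refine ENNReal.ofReal_le_ofReal ?_
        push_cast
        linarith [Nat.floor_le hL]

/-- Quantitative data on an arc `γ([a,b])` on which, in the coordinates `(X, Y)`, the curve is a
convex graph; `V` is the velocity and `m` the slope. -/
structure LocalFrame {d : ℕ} (γ V : ℝ → Rd d) (X Y : Rd d →L[ℝ] ℝ) (m : ℝ → ℝ) (a b B : ℝ) :
    Prop where
  one_le : 1 ≤ B
  taylor : ∀ r ∈ Icc a b, ∀ s ∈ Icc a b, ∀ t ∈ Icc a b, ∀ D, |t - r| ≤ D → |s - r| ≤ D →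
    ‖γ t - γ s - (t - s) • V r‖ ≤ B * |t - s| * D
  norm_velocity_le : ∀ r ∈ Icc a b, ‖V r‖ ≤ B
  le_norm_velocity : ∀ r ∈ Icc a b, B⁻¹ ≤ ‖V r‖
  norm_fst_le : ‖X‖ ≤ B
  norm_snd_le : ‖Y‖ ≤ B
  abs_slope_le : ∀ r ∈ Icc a b, |m r| ≤ B
  velocity : ∀ r ∈ Icc a b, Y (V r) = m r * X (V r)
  chord : ∀ s ∈ Icc a b, ∀ t ∈ Icc a b, ∃ x ∈ uIcc s t, Y (γ t - γ s) = m x * X (γ t - γ s)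
  slope_lower : ∀ s ∈ Icc a b, ∀ t ∈ Icc a b, s ≤ t → (t - s) / 2 ≤ m t - m s
  slope_upper : ∀ s ∈ Icc a b, ∀ t ∈ Icc a b, s ≤ t → m t - m s ≤ 2 * (t - s)
  chord_lower : ∀ s ∈ Icc a b, ∀ t ∈ Icc a b, |t - s| ≤ 2 * |X (γ t - γ s)|

namespace LocalFrame

variable {d : ℕ} {γ V : ℝ → Rd d} {X Y : Rd d →L[ℝ] ℝ} {m : ℝ → ℝ} {a b B : ℝ}

theorem abs_slope_sub_le (F : LocalFrame γ V X Y m a b B) {s t : ℝ} (hs : s ∈ Icc a b)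
    (ht : t ∈ Icc a b) : |m t - m s| ≤ 2 * |t - s| := by
  rcases le_total s t with h | h
  · have h1 := F.slope_lower s hs t ht h
    have h2 := F.slope_upper s hs t ht h
    rw [abs_of_nonneg (by linarith), abs_of_nonneg (by linarith)]
    exact h2
  · have h1 := F.slope_lower t ht s hs h
    have h2 := F.slope_upper t ht s hs h
    rw [abs_of_nonpos (by linarith), abs_of_nonpos (by linarith)]
    linarith

theorem le_abs_slope_sub (F : LocalFrame γ V X Y m a b B) {s t : ℝ} (hs : s ∈ Icc a b)
    (ht : t ∈ Icc a b) : |t - s| / 2 ≤ |m t - m s| := by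
  rcases le_total s t with h | h
  · have h1 := F.slope_lower s hs t ht h
    rw [abs_of_nonneg (by linarith), abs_of_nonneg (by linarith)]
    exact h1
  · have h1 := F.slope_lower t ht s hs h
    rw [abs_of_nonpos (by linarith), abs_of_nonpos (by linarith)]
    linarith

/-- Two points of `N(λγ(I₁)) ∩ (ζ - N(λγ(I₂)))` have parameters within `O(1/(λθ))`, if the arcs
`I₁`, `I₂` of length `O(θ)` are `θ`-separated. The neighbourhoods are thickened by `1/θ` in the
direction of `V t₀`. -/
theorem abs_sub_le_of_separated (F : LocalFrame γ V X Y m a b B) {lam R θ D c t₀ : ℝ}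
    (hlam : 0 < lam) (hθ : 0 < θ) (hθ1 : θ ≤ 1) (hR : 0 ≤ R) (hD : 0 ≤ D) (hc : 0 < c)
    (ht₀ : t₀ ∈ Icc a b) {t₁ t₂ s₁ s₂ : ℝ} (ht₁ : t₁ ∈ Icc a b) (ht₂ : t₂ ∈ Icc a b)
    (hs₁ : s₁ ∈ Icc a b) (hs₂ : s₂ ∈ Icc a b)
    (hsd : ∀ y ∈ uIcc s₂ s₁, |y - t₀| ≤ D * θ)
    (hsep : ∀ x ∈ uIcc t₂ t₁, ∀ y ∈ uIcc s₂ s₁, c * θ ≤ |x - y|)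
    {U : ℝ} {ρ : Rd d} (hU : |U| ≤ 4) (hρ : ‖ρ‖ ≤ 4 * R)
    (heq : lam • (γ t₁ - γ t₂) + lam • (γ s₁ - γ s₂) = U • (θ⁻¹ • V t₀) + ρ) :
    lam * |t₁ - t₂| ≤ 4 * ((B + B * B) * (4 * R) + 2 * D * (4 * B * B + B * (4 * R))) / c / θ := by
  have hB := F.one_le
  obtain ⟨x, hx, hx'⟩ := F.chord t₂ ht₂ t₁ ht₁
  obtain ⟨y, hy, hy'⟩ := F.chord s₂ hs₂ s₁ hs₁
  set p := X (γ t₁ - γ t₂) with hp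
  set q := X (γ s₁ - γ s₂) with hq
  have hxI : x ∈ Icc a b := (ordConnected_Icc).uIcc_subset ht₂ ht₁ hx
  have hyI : y ∈ Icc a b := (ordConnected_Icc).uIcc_subset hs₂ hs₁ hy
  have hX := congrArg X heq
  have hY := congrArg Y heq
  simp only [map_add, map_smul, smul_eq_mul] at hX hY
  rw [← hp, ← hq] at hX
  rw [hx', hy', F.velocity t₀ ht₀] at hY
  have hXρ : |X ρ| ≤ B * (4 * R) := (X.le_opNorm ρ).trans
    (mul_le_mul F.norm_fst_le hρ (norm_nonneg _) (by linarith))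
  have hYρ : |Y ρ| ≤ B * (4 * R) := (Y.le_opNorm ρ).trans
    (mul_le_mul F.norm_snd_le hρ (norm_nonneg _) (by linarith))
  have hXV : |X (V t₀)| ≤ B * B := (X.le_opNorm _).trans
    (mul_le_mul F.norm_fst_le (F.norm_velocity_le t₀ ht₀) (norm_nonneg _) (by linarith))
  have hm0 := F.abs_slope_le t₀ ht₀
  have h1 : |lam * p + lam * q| ≤ (4 * B * B + B * (4 * R)) / θ := by
    rw [hX]
    refine (abs_add_le _ _).trans ?_
    rw [abs_mul, abs_mul, abs_of_pos (inv_pos.2 hθ), add_div]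
    have h2 : |U| * (θ⁻¹ * |X (V t₀)|) ≤ 4 * B * B / θ := by
      calc |U| * (θ⁻¹ * |X (V t₀)|) ≤ 4 * (θ⁻¹ * (B * B)) := by gcongr
        _ = _ := by field_simp
    have h3 : |X ρ| ≤ B * (4 * R) / θ := by
      rw [le_div_iff₀ hθ]
      calc |X ρ| * θ ≤ (B * (4 * R)) * 1 := by gcongr
        _ = _ := mul_one _
    exact add_le_add h2 h3
  -- The functional `Y - m t₀ * X` annihilates `V t₀`, so the displacement of size `1/θ` drops out
  -- and only an `O(R)` error remains, whereas `X` alone gives `O(1/θ)`.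
  have h2 : |(m x - m t₀) * (lam * p) + (m y - m t₀) * (lam * q)| ≤ (B + B * B) * (4 * R) := by
    have h3 : (m x - m t₀) * (lam * p) + (m y - m t₀) * (lam * q) = Y ρ - m t₀ * X ρ := by
      linear_combination hY - m t₀ * hX
    rw [h3]
    refine (abs_sub _ _).trans ?_
    rw [abs_mul]
    calc |Y ρ| + |m t₀| * |X ρ| ≤ B * (4 * R) + B * (B * (4 * R)) := by gcongr
      _ = _ := by ring
  have hmy : |m y - m t₀| ≤ 2 * (D * θ) :=
    (F.abs_slope_sub_le ht₀ hyI).trans (by linarith [hsd y hy])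
  -- Eliminating `q` costs `|m y - m t₀| = O(θ)` times the `O(1/θ)` bound for `lam * (p + q)`, hence
  -- `O(1)`. The slope gap `c * θ / 2` then bounds `lam * |p|` by `O(1/θ)`.
  have h4 : |(m x - m y) * (lam * p)|
      ≤ (B + B * B) * (4 * R) + 2 * D * (4 * B * B + B * (4 * R)) := by
    have h5 : (m x - m y) * (lam * p) = ((m x - m t₀) * (lam * p) + (m y - m t₀) * (lam * q))
        - (m y - m t₀) * (lam * p + lam * q) := by ring
    rw [h5]
    refine (abs_sub _ _).trans (add_le_add h2 ?_)
    rw [abs_mul]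
    calc |m y - m t₀| * |lam * p + lam * q|
        ≤ (2 * (D * θ)) * ((4 * B * B + B * (4 * R)) / θ) := by gcongr
      _ = _ := by field_simp
  have h6 : c * θ / 2 ≤ |m x - m y| := by
    have := F.le_abs_slope_sub hyI hxI
    linarith [hsep x hx y hy]
  have h7 : |t₁ - t₂| ≤ 2 * |p| := F.chord_lower t₂ ht₂ t₁ ht₁
  rw [abs_mul, abs_mul, abs_of_pos hlam] at h4
  have h8 : c * θ / 2 * (lam * |p|)
      ≤ (B + B * B) * (4 * R) + 2 * D * (4 * B * B + B * (4 * R)) :=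
    le_trans (by gcongr) h4
  rw [div_div, le_div_iff₀ (by positivity)]
  calc lam * |t₁ - t₂| * (c * θ) ≤ lam * (2 * |p|) * (c * θ) := by gcongr
    _ = 4 * (c * θ / 2 * (lam * |p|)) := by ring
    _ ≤ _ := by gcongr

/-- The transversality bound for thickened neighbourhoods of two arcs: they are either
`θ`-separated, or `θ ≲ λ^{-1/2}`. -/
theorem exists_volume_transverse_le (F : LocalFrame γ V X Y m a b B) {R D c : ℝ} (hR : 0 ≤ R)
    (hD : 0 ≤ D) (hc : 0 < c) :
    ∃ C : ℝ≥0, ∀ lam θ t₀ : ℝ, 0 < lam → 0 < θ → θ ≤ 1 → t₀ ∈ Icc a b →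
      ∀ I₁ I₂ : Set ℝ, I₁.OrdConnected → I₂.OrdConnected → I₁ ⊆ Icc a b → I₂ ⊆ Icc a b →
      (∀ t ∈ I₁, |t - t₀| ≤ D * θ) → (∀ t ∈ I₂, |t - t₀| ≤ D * θ) →
      ((∀ t ∈ I₁, ∀ s ∈ I₂, c * θ ≤ |t - s|) ∨ lam * θ ^ 2 ≤ 4) →
      ∀ A₁ A₂ : Set (Rd d), (∀ ξ ∈ A₁, ∃ t ∈ I₁, dist ξ (lam • γ t) ≤ R) →
      (∀ ξ ∈ A₂, ∃ t ∈ I₂, dist ξ (lam • γ t) ≤ R) → ∀ ζ : Rd d,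
      volume {ξ | (∃ u ∈ Icc (-1 : ℝ) 1, ξ + u • (θ⁻¹ • V t₀) ∈ A₁) ∧
        ∃ u ∈ Icc (-1 : ℝ) 1, ζ - ξ + u • (θ⁻¹ • V t₀) ∈ A₂} ≤ C * ENNReal.ofReal θ⁻¹ := by
  have hB := F.one_le
  -- The first entry serves separated arcs. The second serves `lam * θ ^ 2 ≤ 4`, where `lam * |t₁ -
  -- t₂| * θ ≤ 2 * D * (lam * θ ^ 2)` holds trivially.
  set C₁ := max (4 * ((B + B * B) * (4 * R) + 2 * D * (4 * B * B + B * (4 * R))) / c) (8 * D)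
    with hC₁
  have hC₁0 : 0 ≤ C₁ := le_max_of_le_right (by positivity)
  refine ⟨Real.toNNReal (2 * (C₁ + 2) + 1) *
    (volume (Metric.closedBall (0 : Rd d) ((2 * R + B * C₁ * D) + B))).toNNReal, ?_⟩
  intro lam θ t₀ hlam hθ hθ1 ht₀ I₁ I₂ hI₁ hI₂ hI₁s hI₂s hI₁d hI₂d hsep A₁ A₂ hA₁ hA₂ ζ
  set S := {ξ | (∃ u ∈ Icc (-1 : ℝ) 1, ξ + u • (θ⁻¹ • V t₀) ∈ A₁) ∧
        ∃ u ∈ Icc (-1 : ℝ) 1, ζ - ξ + u • (θ⁻¹ • V t₀) ∈ A₂} with hS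
  rcases S.eq_empty_or_nonempty with hemp | ⟨ξ₂, hξ₂⟩
  · rw [hemp]; simp
  -- With one point `ξ₂` of `S` fixed, all others lie within `O(1)` of a segment through `ξ₂` of
  -- length `O(1/θ)` in the direction `V t₀`.
  have hdiff : ∀ ξ₁ ∈ S, ∃ u : ℝ, |u| ≤ C₁ + 2 ∧
      ‖ξ₁ - ξ₂ - u • (θ⁻¹ • V t₀)‖ ≤ 2 * R + B * C₁ * D := by
    intro ξ₁ hξ₁
    obtain ⟨⟨u₁, hu₁, hu₁A⟩, ⟨w₁, hw₁, hw₁A⟩⟩ := hξ₁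
    obtain ⟨⟨u₂, hu₂, hu₂A⟩, ⟨w₂, hw₂, hw₂A⟩⟩ := hξ₂
    obtain ⟨t₁, ht₁, hr₁⟩ := hA₁ _ hu₁A
    obtain ⟨t₂, ht₂, hr₂⟩ := hA₁ _ hu₂A
    obtain ⟨s₁, hs₁, hr₁'⟩ := hA₂ _ hw₁A
    obtain ⟨s₂, hs₂, hr₂'⟩ := hA₂ _ hw₂A
    rw [dist_eq_norm] at hr₁ hr₂ hr₁' hr₂'
    set v := θ⁻¹ • V t₀ with hv
    have hclose : lam * |t₁ - t₂| ≤ C₁ / θ := by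
      rcases hsep with hsep | hsep
      · refine (F.abs_sub_le_of_separated hlam hθ hθ1 hR hD hc ht₀ (hI₁s ht₁) (hI₁s ht₂)
          (hI₂s hs₁) (hI₂s hs₂) (fun y hy => hI₂d y (hI₂.uIcc_subset hs₂ hs₁ hy))
          (fun x hx y hy => hsep x (hI₁.uIcc_subset ht₂ ht₁ hx) y (hI₂.uIcc_subset hs₂ hs₁ hy))
          -- Taking the differences of the four membership relations cancels `ξ₁`, `ξ₂` and `ζ`; `ρ`
          -- collects the four errors of size `R`.
          (U := (u₁ - u₂) + (w₁ - w₂))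
          (ρ := -(ξ₁ + u₁ • v - lam • γ t₁) + (ξ₂ + u₂ • v - lam • γ t₂)
            - (ζ - ξ₁ + w₁ • v - lam • γ s₁) + (ζ - ξ₂ + w₂ • v - lam • γ s₂)) ?_ ?_ ?_).trans ?_
        · rw [abs_le]
          constructor <;> linarith [hu₁.1, hu₁.2, hu₂.1, hu₂.2, hw₁.1, hw₁.2, hw₂.1, hw₂.2]
        · refine (norm_add_le _ _).trans ?_
          have h1 := norm_sub_le (-(ξ₁ + u₁ • v - lam • γ t₁) + (ξ₂ + u₂ • v - lam • γ t₂))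
            (ζ - ξ₁ + w₁ • v - lam • γ s₁)
          have h2 := norm_add_le (-(ξ₁ + u₁ • v - lam • γ t₁)) (ξ₂ + u₂ • v - lam • γ t₂)
          rw [norm_neg] at h2
          linarith
        · module
        · gcongr
          exact le_max_left _ _
      · have h1 : |t₁ - t₂| ≤ 2 * (D * θ) := by
          have h2 := abs_le.1 (hI₁d t₁ ht₁)
          have h3 := abs_le.1 (hI₁d t₂ ht₂)
          rw [abs_le]
          constructor <;> linarith
        rw [le_div_iff₀ hθ]
        calc lam * |t₁ - t₂| * θ ≤ lam * (2 * (D * θ)) * θ := by gcongr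
          _ = 2 * D * (lam * θ ^ 2) := by ring
          _ ≤ 2 * D * 4 := by gcongr
          _ = 8 * D := by ring
          _ ≤ C₁ := le_max_right _ _
    refine ⟨lam * θ * (t₁ - t₂) - (u₁ - u₂), ?_, ?_⟩
    · refine (abs_sub _ _).trans (add_le_add ?_ ?_)
      · rw [abs_mul, abs_of_pos (by positivity)]
        calc lam * θ * |t₁ - t₂| = lam * |t₁ - t₂| * θ := by ring
          _ ≤ C₁ / θ * θ := by gcongr
          _ = C₁ := by field_simp
      · rw [abs_le]
        constructor <;> linarith [hu₁.1, hu₁.2, hu₂.1, hu₂.2]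
    -- Replacing the chord by the tangent at `t₀` costs `lam * |t₁ - t₂| * O(θ)`, which is `O(1)` by
    -- `hclose`.
    · have htay := F.taylor t₀ ht₀ t₂ (hI₁s ht₂) t₁ (hI₁s ht₁) (D * θ) (hI₁d t₁ ht₁) (hI₁d t₂ ht₂)
      have h1 : (lam * θ * (t₁ - t₂)) • v = lam • ((t₁ - t₂) • V t₀) := by
        rw [hv, smul_smul, smul_smul]
        congr 1
        field_simp
      have h2 : ξ₁ - ξ₂ - (lam * θ * (t₁ - t₂) - (u₁ - u₂)) • v
          = (ξ₁ + u₁ • v - lam • γ t₁) - (ξ₂ + u₂ • v - lam • γ t₂)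
            + lam • (γ t₁ - γ t₂ - (t₁ - t₂) • V t₀) := by
        rw [sub_smul (lam * θ * (t₁ - t₂)), h1]
        module
      rw [h2]
      refine (norm_add_le _ _).trans (add_le_add ?_ ?_)
      · exact (norm_sub_le _ _).trans (by linarith)
      · rw [norm_smul, Real.norm_of_nonneg hlam.le]
        calc lam * ‖γ t₁ - γ t₂ - (t₁ - t₂) • V t₀‖ ≤ lam * (B * |t₁ - t₂| * (D * θ)) := by gcongr
          _ = (lam * |t₁ - t₂|) * (B * D * θ) := by ring
          _ ≤ (C₁ / θ) * (B * D * θ) := by gcongr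
          _ = _ := by field_simp
  set L := 2 * ((C₁ + 2) / θ) with hL
  have hvol := volume_nbhd_lipschitz_arc_le (f := fun τ : ℝ => ξ₂ + τ • V t₀)
    (a := -((C₁ + 2) / θ)) (L := L) (W := B) (r := 2 * R + B * C₁ * D) (by positivity)
    (fun s _ t _ hst => by
      have h1 : ξ₂ + t • V t₀ - (ξ₂ + s • V t₀) = (t - s) • V t₀ := by module
      rw [h1, norm_smul, Real.norm_eq_abs]
      calc |t - s| * ‖V t₀‖ ≤ 1 * B := by
            gcongr
            exact F.norm_velocity_le t₀ ht₀
        _ = B := one_mul B) (A := S) (fun ξ hξ => by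
      obtain ⟨u, hu, hξu⟩ := hdiff ξ hξ
      refine ⟨u / θ, ?_, ?_⟩
      · rw [hL]
        have h1 := abs_le.1 hu
        constructor
        · rw [← neg_div]; gcongr; exact h1.1
        · have : u / θ ≤ (C₁ + 2) / θ := by gcongr; exact h1.2
          linarith
      · refine le_trans (le_of_eq ?_) hξu
        congr 1
        rw [smul_smul, div_eq_mul_inv]
        abel)
  refine hvol.trans ?_
  rw [ENNReal.coe_mul, ENNReal.coe_toNNReal measure_closedBall_lt_top.ne,
    mul_right_comm (ENNReal.ofNNReal _)]
  refine mul_le_mul_left ?_ _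
  change _ ≤ ENNReal.ofReal _ * _
  rw [← ENNReal.ofReal_mul (by positivity)]
  refine ENNReal.ofReal_le_ofReal ?_
  have h1 : 1 ≤ θ⁻¹ := (one_le_inv₀ hθ).2 hθ1
  rw [hL]
  calc 2 * ((C₁ + 2) / θ) + 1 ≤ 2 * ((C₁ + 2) / θ) + θ⁻¹ := by gcongr
    _ = _ := by field_simp

theorem norm_sub_le_of_abs_sub_le (F : LocalFrame γ V X Y m a b B) {s t D : ℝ} (hs : s ∈ Icc a b)
    (ht : t ∈ Icc a b) (h : |t - s| ≤ D) (hD : D ≤ 1) : ‖γ t - γ s‖ ≤ 2 * B * D := by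
  have hB := F.one_le
  have h1 := F.taylor s hs s hs t ht |t - s| le_rfl (by simp)
  have h2 : γ t - γ s = (γ t - γ s - (t - s) • V s) + (t - s) • V s := by abel
  rw [h2]
  refine (norm_add_le _ _).trans ?_
  rw [norm_smul, Real.norm_eq_abs]
  have hD0 : 0 ≤ D := (abs_nonneg _).trans h
  have h3 : |t - s| * ‖V s‖ ≤ D * B := by
    gcongr
    exact F.norm_velocity_le s hs
  have h4 : B * |t - s| * |t - s| ≤ B * D * 1 := by
    gcongr
    exact h.trans hD
  linarith

/-- The sum of the two thickened neighbourhoods lies in a ball of radius `O(λθ)`. -/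
theorem exists_add_mem_closedBall (F : LocalFrame γ V X Y m a b B) {R D : ℝ} (hR : 0 ≤ R)
    (hD : 0 ≤ D) (hab : b - a ≤ 1) :
    ∃ C : ℝ, 0 < C ∧ ∀ lam θ t₀ : ℝ, 0 < lam → 0 < θ → θ ≤ 1 → 1 ≤ lam * θ ^ 2 → t₀ ∈ Icc a b →
      ∀ I₁ I₂ : Set ℝ, I₁ ⊆ Icc a b → I₂ ⊆ Icc a b →
      (∀ t ∈ I₁, |t - t₀| ≤ D * θ) → (∀ t ∈ I₂, |t - t₀| ≤ D * θ) →
      ∀ A₁ A₂ : Set (Rd d), (∀ ξ ∈ A₁, ∃ t ∈ I₁, dist ξ (lam • γ t) ≤ R) →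
      (∀ ξ ∈ A₂, ∃ t ∈ I₂, dist ξ (lam • γ t) ≤ R) → ∀ ξ η : Rd d,
      (∃ u ∈ Icc (-1 : ℝ) 1, ξ + u • (θ⁻¹ • V t₀) ∈ A₁) →
      (∃ u ∈ Icc (-1 : ℝ) 1, η + u • (θ⁻¹ • V t₀) ∈ A₂) →
      ξ + η ∈ Metric.closedBall ((2 * lam) • γ t₀) (C * (lam * θ)) := by
  have hB := F.one_le
  refine ⟨2 * (R + B + 2 * B * D), by positivity, ?_⟩
  intro lam θ t₀ hlam hθ hθ1 hlt ht₀ I₁ I₂ hI₁s hI₂s hI₁d hI₂d A₁ A₂ hA₁ hA₂ ξ η hξ hη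
  -- The thickening by `1/θ` is absorbed into the length `λθ` of the dilated arc.
  have h1 : θ⁻¹ ≤ lam * θ := by
    rw [inv_le_iff_one_le_mul₀ hθ]; linarith [hlt, sq θ, mul_assoc lam θ θ]
  have h2 : 1 ≤ lam * θ := ((one_le_inv₀ hθ).2 hθ1).trans h1
  have key : ∀ I : Set ℝ, I ⊆ Icc a b → (∀ t ∈ I, |t - t₀| ≤ D * θ) → ∀ A : Set (Rd d),
      (∀ ξ ∈ A, ∃ t ∈ I, dist ξ (lam • γ t) ≤ R) → ∀ ξ : Rd d,
      (∃ u ∈ Icc (-1 : ℝ) 1, ξ + u • (θ⁻¹ • V t₀) ∈ A) →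
      ‖ξ - lam • γ t₀‖ ≤ (R + B + 2 * B * D) * (lam * θ) := by
    intro I hI hId A hA ξ hξ
    obtain ⟨u, hu, huA⟩ := hξ
    obtain ⟨t, ht, hr⟩ := hA _ huA
    rw [dist_eq_norm] at hr
    have h3 : ξ - lam • γ t₀ = (ξ + u • (θ⁻¹ • V t₀) - lam • γ t) - u • (θ⁻¹ • V t₀)
      + lam • (γ t - γ t₀) := by module
    have h4 : ‖u • (θ⁻¹ • V t₀)‖ ≤ B * (lam * θ) := by
      rw [norm_smul, norm_smul, Real.norm_of_nonneg (by positivity : 0 ≤ θ⁻¹), Real.norm_eq_abs]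
      have : |u| ≤ 1 := abs_le.2 hu
      calc |u| * (θ⁻¹ * ‖V t₀‖) ≤ 1 * ((lam * θ) * B) := by
            gcongr
            exact F.norm_velocity_le t₀ ht₀
        _ = _ := by ring
    have h5 : ‖γ t - γ t₀‖ ≤ 2 * B * (D * θ) := by
      have h6 : |t - t₀| ≤ 1 := by
        have := hI ht
        rw [abs_le]; constructor <;> linarith [this.1, this.2, ht₀.1, ht₀.2]
      refine (F.norm_sub_le_of_abs_sub_le ht₀ (hI ht) le_rfl h6).trans ?_
      gcongr
      exact hId t ht
    have h6 : ‖lam • (γ t - γ t₀)‖ ≤ 2 * B * D * (lam * θ) := by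
      rw [norm_smul, Real.norm_of_nonneg hlam.le]
      calc lam * ‖γ t - γ t₀‖ ≤ lam * (2 * B * (D * θ)) := by gcongr
        _ = _ := by ring
    have h7 : R ≤ R * (lam * θ) := le_mul_of_one_le_right hR h2
    rw [h3]
    refine (norm_add_le _ _).trans ?_
    have h8 := norm_sub_le (ξ + u • (θ⁻¹ • V t₀) - lam • γ t) (u • (θ⁻¹ • V t₀))
    linarith
  rw [Metric.mem_closedBall, dist_eq_norm]
  have h9 : ξ + η - (2 * lam) • γ t₀ = (ξ - lam • γ t₀) + (η - lam • γ t₀) := by module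
  rw [h9]
  refine (norm_add_le _ _).trans ?_
  have h10 := key I₁ hI₁s hI₁d A₁ hA₁ ξ hξ
  have h11 := key I₂ hI₂s hI₂d A₂ hA₂ η hη
  linarith

/-- The neighbourhood of an arc of length `O(θ)` has volume `O(λθ)`. -/
theorem exists_volume_nbhd_le (F : LocalFrame γ V X Y m a b B) {R D : ℝ}
    (hD : 0 ≤ D) :
    ∃ C : ℝ≥0, ∀ lam θ t₀ : ℝ, 1 < lam → 0 < θ → 1 ≤ lam * θ → t₀ ∈ Icc a b →
      ∀ A : Set (Rd d), (∀ ξ ∈ A, ∃ t ∈ Icc a b, |t - t₀| ≤ D * θ ∧ dist ξ (lam • γ t) ≤ R) →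
      volume A ≤ C * ENNReal.ofReal (lam * θ) := by
  have hB := F.one_le
  refine ⟨Real.toNNReal (2 * D + 1) *
    (volume (Metric.closedBall (0 : Rd d) (R + 2 * B))).toNNReal, ?_⟩
  intro lam θ t₀ hlam hθ hlt ht₀ A hA
  have hlam0 : 0 < lam := by linarith
  set p := max a (t₀ - D * θ) with hp
  set q := min b (t₀ + D * θ) with hq
  have hpq : p ≤ q := max_le (le_min (ht₀.1.trans ht₀.2) (by nlinarith [ht₀.1, mul_nonneg hD hθ.le]))
    (le_min (by linarith [ht₀.2, mul_nonneg hD hθ.le]) (by linarith [mul_nonneg hD hθ.le]))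
  have hqp : q - p ≤ 2 * D * θ := by
    have h1 : q ≤ t₀ + D * θ := min_le_right _ _
    have h2 : t₀ - D * θ ≤ p := le_max_right _ _
    linarith
  have hsub : ∀ τ ∈ Icc (lam * p) (lam * p + lam * (q - p)), τ / lam ∈ Icc a b := by
    intro τ hτ
    constructor
    · refine (le_max_left a (t₀ - D * θ)).trans ?_
      rw [le_div_iff₀ hlam0]; linarith [hτ.1]
    · refine le_trans ?_ (min_le_left b (t₀ + D * θ))
      rw [div_le_iff₀ hlam0]; linarith [hτ.2]
  -- In the parameter `τ = lam * t` the dilated curve moves by at most `2 * B` per unit step.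
  have hvol := volume_nbhd_lipschitz_arc_le (f := fun τ : ℝ => lam • γ (τ / lam))
    (a := lam * p) (L := lam * (q - p)) (W := 2 * B) (r := R) (A := A)
    (mul_nonneg hlam0.le (by linarith))
    (fun s hs t ht hst => by
      rw [← smul_sub, norm_smul, Real.norm_of_nonneg hlam0.le]
      have h1 : |t / lam - s / lam| ≤ 1 / lam := by
        rw [← sub_div, abs_div, abs_of_pos hlam0]
        gcongr
      have h2 := F.norm_sub_le_of_abs_sub_le (hsub s hs) (hsub t ht) h1
        ((div_le_one hlam0).2 hlam.le)
      calc lam * ‖γ (t / lam) - γ (s / lam)‖ ≤ lam * (2 * B * (1 / lam)) := by gcongr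
        _ = 2 * B := by field_simp)
    (fun ξ hξ => by
      obtain ⟨t, ht, htd, hr⟩ := hA ξ hξ
      have h1 := abs_le.1 htd
      have h2 : p ≤ t := max_le ht.1 (by linarith)
      have h3 : t ≤ q := le_min ht.2 (by linarith)
      refine ⟨lam * t, ⟨by gcongr, ?_⟩, ?_⟩
      · have : lam * t ≤ lam * q := by gcongr
        linarith
      · have : lam * t / lam = t := by field_simp
        beta_reduce
        rw [this, ← dist_eq_norm]
        exact hr)
  refine hvol.trans ?_
  rw [ENNReal.coe_mul, ENNReal.coe_toNNReal measure_closedBall_lt_top.ne,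
    mul_right_comm (ENNReal.ofNNReal _)]
  refine mul_le_mul_left ?_ _
  change _ ≤ ENNReal.ofReal _ * _
  rw [← ENNReal.ofReal_mul (by positivity)]
  refine ENNReal.ofReal_le_ofReal ?_
  calc lam * (q - p) + 1 ≤ lam * (2 * D * θ) + lam * θ := by gcongr
    _ = _ := by ring

end LocalFrame

/-! ### Existence of local frames on nondegenerate curves. -/

namespace IsNondegenerateCurve

variable {d : ℕ} {γ : ℝ → Rd d}

theorem hasDerivWithinAt_iteratedDerivWithin (hγ : IsNondegenerateCurve γ) {k : ℕ} (hk : k ≤ d)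
    {t : ℝ} (ht : t ∈ Icc (0 : ℝ) 1) :
    HasDerivWithinAt (iteratedDerivWithin k γ (Icc (0 : ℝ) 1))
      (iteratedDerivWithin (k + 1) γ (Icc (0 : ℝ) 1) t) (Icc (0 : ℝ) 1) t := by
  have h := hγ.contDiffOn.differentiableOn_iteratedDerivWithin (m := k)
    (by exact_mod_cast Nat.lt_succ_of_le hk) (uniqueDiffOn_Icc_zero_one) t ht
  rw [iteratedDerivWithin_succ]
  exact h.hasDerivWithinAt

theorem continuousOn_iteratedDerivWithin (hγ : IsNondegenerateCurve γ) {k : ℕ} (hk : k ≤ d + 1) :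
    ContinuousOn (iteratedDerivWithin k γ (Icc (0 : ℝ) 1)) (Icc (0 : ℝ) 1) :=
  hγ.contDiffOn.continuousOn_iteratedDerivWithin (by exact_mod_cast hk) uniqueDiffOn_Icc_zero_one

/-- At each point there are linear coordinates in which the first two derivatives of the curve
are the first two standard basis vectors. -/
theorem exists_dual (hγ : IsNondegenerateCurve γ) (hd : 2 ≤ d) {t : ℝ} (ht : t ∈ Icc (0 : ℝ) 1) :
    ∃ X Y : Rd d →L[ℝ] ℝ,
      X (iteratedDerivWithin 1 γ (Icc (0 : ℝ) 1) t) = 1 ∧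
      X (iteratedDerivWithin 2 γ (Icc (0 : ℝ) 1) t) = 0 ∧
      Y (iteratedDerivWithin 1 γ (Icc (0 : ℝ) 1) t) = 0 ∧
      Y (iteratedDerivWithin 2 γ (Icc (0 : ℝ) 1) t) = 1 := by
  set M : Matrix (Fin d) (Fin d) ℝ := Matrix.of fun i j : Fin d =>
      iteratedDerivWithin ((j : ℕ) + 1) γ (Icc (0 : ℝ) 1) t i with hM
  have hdet : IsUnit M.det := (hγ.det_ne_zero t ht).isUnit
  have hmul := Matrix.nonsing_inv_mul M hdet
  -- The rows of `M⁻¹` are dual to the derivatives of the curve. Rows `0` and `1` serve as `X` and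
  -- `Y`, which needs `2 ≤ d`.
  have key : ∀ i j : Fin d, (∑ k, M⁻¹ i k • (EuclideanSpace.proj k : Rd d →L[ℝ] ℝ))
      (iteratedDerivWithin ((j : ℕ) + 1) γ (Icc (0 : ℝ) 1) t) = (1 : Matrix (Fin d) (Fin d) ℝ) i j := by
    intro i j
    rw [← hmul, Matrix.mul_apply]
    simp [hM]
  refine ⟨∑ k, M⁻¹ ⟨0, by omega⟩ k • (EuclideanSpace.proj k : Rd d →L[ℝ] ℝ),
    ∑ k, M⁻¹ ⟨1, by omega⟩ k • (EuclideanSpace.proj k : Rd d →L[ℝ] ℝ), ?_, ?_, ?_, ?_⟩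
  · have := key ⟨0, by omega⟩ ⟨0, by omega⟩
    simpa using this
  · have := key ⟨0, by omega⟩ ⟨1, by omega⟩
    simpa using this
  · have := key ⟨1, by omega⟩ ⟨0, by omega⟩
    simpa using this
  · have := key ⟨1, by omega⟩ ⟨1, by omega⟩
    simpa using this

/-- Near each parameter the curve admits a local frame. -/
theorem exists_localFrame (hγ : IsNondegenerateCurve γ) (hd : 2 ≤ d) {t₀ : ℝ}
    (ht₀ : t₀ ∈ Icc (0 : ℝ) 1) :
    ∃ δ > 0, ∃ (V : ℝ → Rd d) (X Y : Rd d →L[ℝ] ℝ) (m : ℝ → ℝ) (B : ℝ), ∀ a b : ℝ,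
      Icc a b ⊆ Icc 0 1 ∩ Metric.ball t₀ δ → LocalFrame γ V X Y m a b B := by
  obtain ⟨X, Y, hX1, hX2, hY1, hY2⟩ := hγ.exists_dual hd ht₀
  set V := iteratedDerivWithin 1 γ (Icc (0 : ℝ) 1) with hV
  set W := iteratedDerivWithin 2 γ (Icc (0 : ℝ) 1) with hW
  have hderγ : ∀ t ∈ Icc (0 : ℝ) 1, HasDerivWithinAt γ (V t) (Icc (0 : ℝ) 1) t := fun t ht => by
    have h0 : iteratedDerivWithin 0 γ (Icc (0 : ℝ) 1) = γ := by ext; simp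
    have := hγ.hasDerivWithinAt_iteratedDerivWithin (k := 0) (by omega) ht
    rwa [h0] at this
  have hderV : ∀ t ∈ Icc (0 : ℝ) 1, HasDerivWithinAt V (W t) (Icc (0 : ℝ) 1) t := fun t ht =>
    hγ.hasDerivWithinAt_iteratedDerivWithin (k := 1) (by omega) ht
  have hcV : ContinuousOn V (Icc (0 : ℝ) 1) := hγ.continuousOn_iteratedDerivWithin (by omega)
  have hcW : ContinuousOn W (Icc (0 : ℝ) 1) := hγ.continuousOn_iteratedDerivWithin (by omega)
  obtain ⟨BV, hBV⟩ := isCompact_Icc.exists_bound_of_continuousOn hcV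
  obtain ⟨BW, hBW⟩ := isCompact_Icc.exists_bound_of_continuousOn hcW
  set x' : ℝ → ℝ := fun t => X (V t) with hx'
  set y' : ℝ → ℝ := fun t => Y (V t) with hy'
  set x'' : ℝ → ℝ := fun t => X (W t) with hx''
  set y'' : ℝ → ℝ := fun t => Y (W t) with hy''
  have hcx' : ContinuousOn x' (Icc (0 : ℝ) 1) := X.continuous.comp_continuousOn hcV
  have hcy' : ContinuousOn y' (Icc (0 : ℝ) 1) := Y.continuous.comp_continuousOn hcV
  have hcx'' : ContinuousOn x'' (Icc (0 : ℝ) 1) := X.continuous.comp_continuousOn hcW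
  have hcy'' : ContinuousOn y'' (Icc (0 : ℝ) 1) := Y.continuous.comp_continuousOn hcW
  -- This is the derivative of the slope `y' / x'`. The choice of `X` and `Y` makes it `1` at `t₀`,
  -- so by continuity it stays in `(1/2, 2)` nearby: the projected curve is uniformly convex.
  set m' : ℝ → ℝ := fun t => (y'' t * x' t - y' t * x'' t) / x' t ^ 2 with hm'
  have hx0 : x' t₀ = 1 := hX1
  have hm0 : m' t₀ = 1 := by
    simp only [hm', hx', hy', hx'', hy'']
    rw [hX1, hX2, hY1, hY2]; norm_num
  have hcm : ContinuousWithinAt m' (Icc (0 : ℝ) 1) t₀ := by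
    refine ContinuousWithinAt.div ?_ ((hcx' t₀ ht₀).pow 2) (by rw [hx0]; norm_num)
    exact ((hcy'' t₀ ht₀).mul (hcx' t₀ ht₀)).sub ((hcy' t₀ ht₀).mul (hcx'' t₀ ht₀))
  have hev1 : ∀ᶠ t in nhdsWithin t₀ (Icc (0 : ℝ) 1), x' t ∈ Ioo (1 / 2 : ℝ) 2 :=
    (hcx' t₀ ht₀) (Ioo_mem_nhds (by rw [hx0]; norm_num) (by rw [hx0]; norm_num))
  have hev2 : ∀ᶠ t in nhdsWithin t₀ (Icc (0 : ℝ) 1), m' t ∈ Ioo (1 / 2 : ℝ) 2 :=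
    hcm (Ioo_mem_nhds (by rw [hm0]; norm_num) (by rw [hm0]; norm_num))
  obtain ⟨δ, hδ, hball⟩ := Metric.mem_nhdsWithin_iff.1 (hev1.and hev2)
  -- The factors `2` come from `x' > 1/2`: one in the lower bound for the velocity, the other in the
  -- bound for the slope.
  set B := 1 + 2 * ‖X‖ + ‖Y‖ + |BV| + |BW| + 2 * (‖Y‖ * |BV|) with hB
  have hXn := norm_nonneg X
  have hYn := norm_nonneg Y
  have hYBV : 0 ≤ ‖Y‖ * |BV| := by positivity
  have hBV0 := abs_nonneg BV
  have hBW0 := abs_nonneg BW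
  refine ⟨δ, hδ, V, X, Y, fun t => y' t / x' t, B, fun a b hab => ?_⟩
  have h01 : ∀ t ∈ Icc a b, t ∈ Icc (0 : ℝ) 1 := fun t ht => (hab ht).1
  have hx_b : ∀ t ∈ Icc a b, x' t ∈ Ioo (1 / 2 : ℝ) 2 := fun t ht =>
    (hball ⟨(hab ht).2, (hab ht).1⟩).1
  have hm_b : ∀ t ∈ Icc a b, m' t ∈ Ioo (1 / 2 : ℝ) 2 := fun t ht =>
    (hball ⟨(hab ht).2, (hab ht).1⟩).2
  have hsub : ∀ s ∈ Icc a b, ∀ t ∈ Icc a b, Icc s t ⊆ Icc a b := fun s hs t ht =>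
    Icc_subset_Icc hs.1 ht.2
  have hnhds : ∀ s ∈ Icc a b, ∀ t ∈ Icc a b, ∀ r ∈ Ioo s t, Icc (0 : ℝ) 1 ∈ nhds r :=
    fun s hs t ht r hr => Icc_mem_nhds (lt_of_le_of_lt (h01 s hs).1 hr.1)
      (lt_of_lt_of_le hr.2 (h01 t ht).2)
  have hderγ' : ∀ s ∈ Icc a b, ∀ t ∈ Icc a b, ∀ r ∈ Ioo s t, HasDerivAt γ (V r) r :=
    fun s hs t ht r hr => (hderγ r (h01 r (hsub s hs t ht (Ioo_subset_Icc_self hr)))).hasDerivAt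
      (hnhds s hs t ht r hr)
  have hderV' : ∀ s ∈ Icc a b, ∀ t ∈ Icc a b, ∀ r ∈ Ioo s t, HasDerivAt V (W r) r :=
    fun s hs t ht r hr => (hderV r (h01 r (hsub s hs t ht (Ioo_subset_Icc_self hr)))).hasDerivAt
      (hnhds s hs t ht r hr)
  have hcγ : ContinuousOn γ (Icc a b) := fun t ht =>
    ((hderγ t (h01 t ht)).continuousWithinAt).mono (fun r hr => h01 r hr)
  have hVn : ∀ t ∈ Icc a b, ‖V t‖ ≤ |BV| := fun t ht => (hBV t (h01 t ht)).trans (le_abs_self _)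
  have hm_mvt : ∀ s ∈ Icc a b, ∀ t ∈ Icc a b, s < t → ∃ r ∈ Ioo s t,
      m' r = (y' t / x' t - y' s / x' s) / (t - s) := by
    intro s hs t ht hst
    refine exists_hasDerivAt_eq_slope (fun t => y' t / x' t) m' hst ?_ ?_
    · have hmono : Icc s t ⊆ Icc (0 : ℝ) 1 := fun r hr => h01 r (hsub s hs t ht hr)
      refine ContinuousOn.div (hcy'.mono hmono) (hcx'.mono hmono) fun r hr => ?_
      have := (hx_b r (hsub s hs t ht hr)).1
      linarith
    · intro r hr
      have hxr := (hx_b r (hsub s hs t ht (Ioo_subset_Icc_self hr))).1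
      have h1 : HasDerivAt x' (x'' r) r := X.hasFDerivAt.comp_hasDerivAt r (hderV' s hs t ht r hr)
      have h2 : HasDerivAt y' (y'' r) r := Y.hasFDerivAt.comp_hasDerivAt r (hderV' s hs t ht r hr)
      exact h2.div h1 (by linarith)
  have hchord_lt : ∀ s ∈ Icc a b, ∀ t ∈ Icc a b, s < t →
      (∃ r ∈ Ioo s t, Y (γ t - γ s) = (y' r / x' r) * X (γ t - γ s)) ∧
      (t - s) ≤ 2 * X (γ t - γ s) := by
    intro s hs t ht hst
    have hcX : ContinuousOn (fun t => X (γ t)) (Icc s t) :=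
      X.continuous.comp_continuousOn (hcγ.mono (hsub s hs t ht))
    have hcY : ContinuousOn (fun t => Y (γ t)) (Icc s t) :=
      Y.continuous.comp_continuousOn (hcγ.mono (hsub s hs t ht))
    have hdX : ∀ r ∈ Ioo s t, HasDerivAt (fun t => X (γ t)) (x' r) r := fun r hr =>
      X.hasFDerivAt.comp_hasDerivAt r (hderγ' s hs t ht r hr)
    have hdY : ∀ r ∈ Ioo s t, HasDerivAt (fun t => Y (γ t)) (y' r) r := fun r hr =>
      Y.hasFDerivAt.comp_hasDerivAt r (hderγ' s hs t ht r hr)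
    constructor
    · obtain ⟨r, hr, h⟩ := exists_ratio_hasDerivAt_eq_ratio_slope (fun t => X (γ t)) x' hst hcX hdX
        (fun t => Y (γ t)) y' hcY hdY
      refine ⟨r, hr, ?_⟩
      have hxr := (hx_b r (hsub s hs t ht (Ioo_subset_Icc_self hr))).1
      have hxr' : x' r ≠ 0 := by linarith
      rw [map_sub, map_sub]
      field_simp
      linarith
    · obtain ⟨r, hr, h⟩ := exists_hasDerivAt_eq_slope (fun t => X (γ t)) x' hst hcX hdX
      have hxr := (hx_b r (hsub s hs t ht (Ioo_subset_Icc_self hr))).1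
      have hts : 0 < t - s := by linarith
      rw [eq_div_iff hts.ne'] at h
      rw [map_sub, ← h]
      nlinarith
  exact
  { one_le := by linarith
    taylor := by
      intro r hr s hs t ht D htD hsD
      have hconv : Convex ℝ (uIcc s t) := convex_uIcc s t
      have hIs : uIcc s t ⊆ Icc a b := ordConnected_Icc.uIcc_subset hs ht
      have hD : ∀ τ ∈ uIcc s t, |τ - r| ≤ D := by
        intro τ hτ
        have h1 := abs_le.1 htD
        have h2 := abs_le.1 hsD
        rw [abs_le]
        rcases le_total s t with h | h
        · rw [uIcc_of_le h] at hτ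
          constructor <;> linarith [hτ.1, hτ.2]
        · rw [uIcc_of_ge h] at hτ
          constructor <;> linarith [hτ.1, hτ.2]
      have hVlip : ∀ τ ∈ Icc a b, ‖V τ - V r‖ ≤ |BW| * |τ - r| := by
        intro τ hτ
        exact (convex_Icc (0 : ℝ) 1).norm_image_sub_le_of_norm_hasDerivWithin_le
          (f := V) (f' := W) hderV (fun x hx => (hBW x hx).trans (le_abs_self _))
          (h01 r hr) (h01 τ hτ)
      -- Mean value inequality for `τ ↦ γ τ - τ • V r`, whose derivative `V τ - V r` is at most `B *
      -- D` by the bound on the second derivative.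
      have h := hconv.norm_image_sub_le_of_norm_hasDerivWithin_le
        (f := fun τ => γ τ - τ • V r) (f' := fun τ => V τ - (1 : ℝ) • V r) (C := B * D)
        (fun τ hτ => ((hderγ τ (h01 τ (hIs hτ))).mono (fun x hx => h01 x (hIs hx))).sub
          ((hasDerivWithinAt_id τ _).smul_const (V r)))
        (fun τ hτ => by
          rw [one_smul]
          refine (hVlip τ (hIs hτ)).trans ?_
          have h1 := hD τ hτ
          have h2 : 0 ≤ D := (abs_nonneg _).trans h1
          gcongr
          linarith) left_mem_uIcc right_mem_uIcc
      have h3 : γ t - γ s - (t - s) • V r = γ t - t • V r - (γ s - s • V r) := by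
        rw [sub_smul]; abel
      rw [h3]
      refine h.trans (le_of_eq ?_)
      rw [Real.norm_eq_abs]
      ring
    norm_velocity_le := fun r hr => by linarith [hVn r hr]
    le_norm_velocity := fun r hr => by
      have h1 := (hx_b r hr).1
      have h2 : x' r ≤ ‖X‖ * ‖V r‖ := (le_abs_self _).trans (X.le_opNorm _)
      have h3 : 1 ≤ B * ‖V r‖ := by nlinarith [norm_nonneg (V r)]
      rw [inv_le_iff_one_le_mul₀ (by linarith)]
      linarith
    norm_fst_le := by linarith
    norm_snd_le := by linarith
    abs_slope_le := fun r hr => by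
      have h1 := (hx_b r hr).1
      have h2 : |y' r| ≤ ‖Y‖ * |BV| := (Y.le_opNorm _).trans (by gcongr; exact hVn r hr)
      rw [abs_div, abs_of_pos (by linarith : 0 < x' r), div_le_iff₀ (by linarith)]
      nlinarith
    velocity := fun r hr => by
      have h1 := (hx_b r hr).1
      have h2 : x' r ≠ 0 := by linarith
      change y' r = y' r / x' r * x' r
      field_simp
    chord := by
      intro s hs t ht
      rcases lt_trichotomy s t with h | h | h
      · obtain ⟨r, hr, h1⟩ := (hchord_lt s hs t ht h).1
        exact ⟨r, by rw [uIcc_of_le h.le]; exact Ioo_subset_Icc_self hr, h1⟩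
      · subst h
        exact ⟨s, left_mem_uIcc, by simp⟩
      · obtain ⟨r, hr, h1⟩ := (hchord_lt t ht s hs h).1
        refine ⟨r, by rw [uIcc_of_ge h.le]; exact Ioo_subset_Icc_self hr, ?_⟩
        rw [← neg_sub (γ s), map_neg, map_neg, h1]
        ring
    slope_lower := by
      intro s hs t ht hst
      rcases hst.eq_or_lt with rfl | hst
      · simp
      · obtain ⟨r, hr, h⟩ := hm_mvt s hs t ht hst
        have h1 := (hm_b r (hsub s hs t ht (Ioo_subset_Icc_self hr))).1
        have hts : 0 < t - s := by linarith
        rw [eq_div_iff hts.ne'] at h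
        rw [← h]
        nlinarith
    slope_upper := by
      intro s hs t ht hst
      rcases hst.eq_or_lt with rfl | hst
      · simp
      · obtain ⟨r, hr, h⟩ := hm_mvt s hs t ht hst
        have h1 := (hm_b r (hsub s hs t ht (Ioo_subset_Icc_self hr))).2
        have hts : 0 < t - s := by linarith
        rw [eq_div_iff hts.ne'] at h
        rw [← h]
        nlinarith
    chord_lower := by
      intro s hs t ht
      rcases lt_trichotomy s t with h | h | h
      · have h1 := (hchord_lt s hs t ht h).2
        rw [abs_of_pos (by linarith)]
        linarith [le_abs_self (X (γ t - γ s))]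
      · subst h
        simp
      · have h1 := (hchord_lt t ht s hs h).2
        rw [abs_of_neg (by linarith), ← neg_sub (γ s), map_neg, abs_neg]
        linarith [le_abs_self (X (γ s - γ t))] }

/-- `[0,1]` is covered by finitely many intervals of equal length carrying local frames. -/
theorem exists_partition_localFrame (hγ : IsNondegenerateCurve γ) (hd : 2 ≤ d) :
    ∃ N : ℕ, 0 < N ∧ ∀ i < N, ∃ (V : ℝ → Rd d) (X Y : Rd d →L[ℝ] ℝ) (m : ℝ → ℝ) (B : ℝ),
      LocalFrame γ V X Y m ((i : ℝ) / N) ((i + 1 : ℝ) / N) B := by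
  choose! δ hδ V X Y m B hF using fun t₀ (ht₀ : t₀ ∈ Icc (0 : ℝ) 1) => hγ.exists_localFrame hd ht₀
  obtain ⟨η, hη, hleb⟩ := lebesgue_number_lemma_of_metric (s := Icc (0 : ℝ) 1)
    (c := fun t : Icc (0 : ℝ) 1 => Metric.ball (t : ℝ) (δ t)) isCompact_Icc
    (fun t => Metric.isOpen_ball)
    (fun t ht => mem_iUnion.2 ⟨⟨t, ht⟩, Metric.mem_ball_self (hδ t ht)⟩)
  obtain ⟨N, hN⟩ := exists_nat_one_div_lt hη
  refine ⟨N + 1, Nat.succ_pos _, fun i hi => ?_⟩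
  have hN0 : (0 : ℝ) < ((N + 1 : ℕ) : ℝ) := by positivity
  have hiN : (i : ℝ) + 1 ≤ ((N + 1 : ℕ) : ℝ) := by exact_mod_cast hi
  have hsub : Icc ((i : ℝ) / ((N + 1 : ℕ) : ℝ)) ((i + 1 : ℝ) / ((N + 1 : ℕ) : ℝ))
      ⊆ Icc (0 : ℝ) 1 := fun t ht =>
    ⟨le_trans (by positivity) ht.1, ht.2.trans ((div_le_one hN0).2 hiN)⟩
  have hle : (i : ℝ) / ((N + 1 : ℕ) : ℝ) ≤ (i + 1 : ℝ) / ((N + 1 : ℕ) : ℝ) := by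
    gcongr; linarith
  obtain ⟨⟨t, ht⟩, hball⟩ := hleb _ (hsub (left_mem_Icc.2 hle))
  refine ⟨V t, X t, Y t, m t, B t, hF t ht _ _ fun s hs => ⟨hsub hs, hball ?_⟩⟩
  rw [Metric.mem_ball, Real.dist_eq, abs_of_nonneg (by linarith [hs.1])]
  have h1 : (i + 1 : ℝ) / ((N + 1 : ℕ) : ℝ) - (i : ℝ) / ((N + 1 : ℕ) : ℝ)
      = 1 / ((N : ℝ) + 1) := by
    push_cast
    field_simp
    ring
  linarith [hs.2]

end IsNondegenerateCurve

/-! ### The three bilinear estimates at scale `θ`. -/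

theorem sq_enorm_fourierHat_le {d : ℕ} {g : Rd d → ℂ} (hg : Measurable g) (x : Rd d) :
    ‖fourierHat g x‖ₑ ^ 2 ≤ volume (Function.support g) * ∫⁻ ξ, ‖g ξ‖ₑ ^ 2 := by
  have hS : MeasurableSet (Function.support g) := measurableSet_support hg
  calc ‖fourierHat g x‖ₑ ^ 2 ≤ (∫⁻ ξ, ‖g ξ‖ₑ) ^ 2 := by
        gcongr
        exact enorm_fourierHat_le g x
    _ = (∫⁻ ξ in Function.support g, ‖g ξ‖ₑ) ^ 2 := by
        congr 1
        symm
        refine setLIntegral_eq_of_support_subset fun ξ hξ => ?_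
        simpa using hξ
    _ ≤ volume.restrict (Function.support g) univ * ∫⁻ ξ in Function.support g, ‖g ξ‖ₑ ^ 2 :=
        lintegral_sq_le (by fun_prop)
    _ ≤ _ := by
        rw [Measure.restrict_apply_univ]
        gcongr
        exact Measure.restrict_le_self

namespace LocalFrame

variable {d : ℕ} {γ V : ℝ → Rd d} {X Y : Rd d →L[ℝ] ℝ} {m : ℝ → ℝ} {a b B : ℝ}

/-- Bilinear estimates in `L¹(μ)`, `L²(μ)` and `L^∞` for two functions supported in
neighbourhoods of arcs of length `O(θ)` that are `θ`-separated (or `θ ≲ λ^{-1/2}`). -/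
theorem exists_bilinear_estimates (F : LocalFrame γ V X Y m a b B) (α : ℝ) {R D c : ℝ}
    (hR : 0 ≤ R) (hD : 0 ≤ D) (hc : 0 < c) (hab : b - a ≤ 1) :
    ∃ K : ℝ≥0, ∀ (μ : Measure (Rd d)) [SFinite μ], μ (Metric.closedBall (0 : Rd d) 1)ᶜ = 0 →
      ∀ lam θ t₀ : ℝ, 1 < lam → 0 < θ → θ ≤ 1 → 1 ≤ lam * θ ^ 2 → t₀ ∈ Icc a b →
      ∀ I₁ I₂ : Set ℝ, I₁.OrdConnected → I₂.OrdConnected → I₁ ⊆ Icc a b → I₂ ⊆ Icc a b →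
      (∀ t ∈ I₁, |t - t₀| ≤ D * θ) → (∀ t ∈ I₂, |t - t₀| ≤ D * θ) →
      ((∀ t ∈ I₁, ∀ s ∈ I₂, c * θ ≤ |t - s|) ∨ lam * θ ^ 2 ≤ 4) →
      ∀ g₁ g₂ : Rd d → ℂ, Measurable g₁ → Measurable g₂ → Integrable g₁ → Integrable g₂ →
      (∀ ξ, g₁ ξ ≠ 0 → ∃ t ∈ I₁, dist ξ (lam • γ t) ≤ R) →
      (∀ ξ, g₂ ξ ≠ 0 → ∃ t ∈ I₂, dist ξ (lam • γ t) ≤ R) →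
      ((∫⁻ x, ‖fourierHat g₁ x‖ₑ * ‖fourierHat g₂ x‖ₑ ∂μ) ^ 2
        ≤ K * growthNorm α μ ^ 2 * ENNReal.ofReal (lam ^ ((d : ℝ) - α)) *
          ((∫⁻ ξ, ‖g₁ ξ‖ₑ ^ 2) * ∫⁻ ξ, ‖g₂ ξ‖ₑ ^ 2)) ∧
      (∫⁻ x, (‖fourierHat g₁ x‖ₑ * ‖fourierHat g₂ x‖ₑ) ^ 2 ∂μ
        ≤ K * growthNorm α μ * ENNReal.ofReal ((lam * θ) ^ ((d : ℝ) - α) * θ⁻¹) *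
          ((∫⁻ ξ, ‖g₁ ξ‖ₑ ^ 2) * ∫⁻ ξ, ‖g₂ ξ‖ₑ ^ 2)) ∧
      (∀ x, (‖fourierHat g₁ x‖ₑ * ‖fourierHat g₂ x‖ₑ) ^ 2
        ≤ K * ENNReal.ofReal ((lam * θ) ^ 2) *
          ((∫⁻ ξ, ‖g₁ ξ‖ₑ ^ 2) * ∫⁻ ξ, ‖g₂ ξ‖ₑ ^ 2)) := by
  have hB := F.one_le
  obtain ⟨K₁, hK₁⟩ := sq_lintegral_fourierHat_mul_le (d := d) α (E₁ := B⁻¹) (E₂ := B)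
    (inv_pos.2 (by linarith))
  obtain ⟨K₂, hK₂⟩ := lintegral_fourierHat_mul_sq_le (d := d) α
  obtain ⟨C₁, hC₁⟩ := F.exists_volume_transverse_le hR hD hc
  obtain ⟨C₂, hC₂0, hC₂⟩ := F.exists_add_mem_closedBall hR hD hab
  obtain ⟨C₃, hC₃⟩ := F.exists_volume_nbhd_le (R := R) hD
  set Q : ℝ≥0 := Real.toNNReal (C₂ ^ ((d : ℝ) - α)) with hQ
  refine ⟨max (K₁ * Q * C₁) (max (K₂ * Q * C₁) (C₃ * C₃)), ?_⟩
  intro μ _ hμs lam θ t₀ hlam hθ hθ1 hlt ht₀ I₁ I₂ hI₁ hI₂ hI₁s hI₂s hI₁d hI₂d hsep g₁ g₂ hm₁ hm₂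
    hi₁ hi₂ hg₁ hg₂
  have hlam0 : 0 < lam := by linarith
  have hlt' : 1 ≤ lam * θ := by nlinarith
  set N := (∫⁻ ξ, ‖g₁ ξ‖ₑ ^ 2) * ∫⁻ ξ, ‖g₂ ξ‖ₑ ^ 2 with hN
  have hV := hC₁ lam θ t₀ hlam0 hθ hθ1 ht₀ I₁ I₂ hI₁ hI₂ hI₁s hI₂s hI₁d hI₂d hsep
    (Function.support g₁) (Function.support g₂) hg₁ hg₂
  have hball := hC₂ lam θ t₀ hlam0 hθ hθ1 hlt ht₀ I₁ I₂ hI₁s hI₂s hI₁d hI₂d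
    (Function.support g₁) (Function.support g₂) hg₁ hg₂
  have h0 : (0 : ℝ) ∈ Icc (-1 : ℝ) 1 := by constructor <;> norm_num
  have hρ : ENNReal.ofReal ((C₂ * (lam * θ)) ^ ((d : ℝ) - α))
      = Q * ENNReal.ofReal ((lam * θ) ^ ((d : ℝ) - α)) := by
    rw [Real.mul_rpow hC₂0.le (by positivity), ENNReal.ofReal_mul (by positivity)]
    rfl
  refine ⟨?_, ?_, ?_⟩
  · have h := hK₁ μ hμs θ hθ hθ1 (V t₀) (F.le_norm_velocity t₀ ht₀) (F.norm_velocity_le t₀ ht₀)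
      ((2 * lam) • γ t₀) (C₂ * (lam * θ)) (by positivity) g₁ g₂ hm₁ hm₂ hi₁ hi₂ hball _ hV
    refine h.trans ?_
    rw [hρ]
    -- Slab measure, frequency ball and overlap volume: their powers of `θ` cancel exactly.
    have h1 : ENNReal.ofReal (θ ^ (α - d + 1)) * ENNReal.ofReal ((lam * θ) ^ ((d : ℝ) - α)) *
        ENNReal.ofReal θ⁻¹ = ENNReal.ofReal (lam ^ ((d : ℝ) - α)) := by
      rw [← ENNReal.ofReal_mul (by positivity), ← ENNReal.ofReal_mul (by positivity)]
      congr 1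
      rw [Real.mul_rpow hlam0.le hθ.le, ← Real.rpow_neg_one θ]
      calc θ ^ (α - d + 1) * (lam ^ ((d : ℝ) - α) * θ ^ ((d : ℝ) - α)) * θ ^ (-1 : ℝ)
          = lam ^ ((d : ℝ) - α) * (θ ^ (α - d + 1) * θ ^ ((d : ℝ) - α) * θ ^ (-1 : ℝ)) := by ring
        _ = lam ^ ((d : ℝ) - α) * θ ^ (0 : ℝ) := by
            rw [← Real.rpow_add hθ, ← Real.rpow_add hθ]
            congr 2
            ring
        _ = _ := by simp
    calc _ = ((K₁ * Q * C₁ : ℝ≥0) : ℝ≥0∞) * growthNorm α μ ^ 2 *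
          (ENNReal.ofReal (θ ^ (α - d + 1)) * ENNReal.ofReal ((lam * θ) ^ ((d : ℝ) - α)) *
            ENNReal.ofReal θ⁻¹) * N := by push_cast; ring
      _ ≤ _ := by
        rw [h1]
        gcongr
        exact le_max_left _ _
  -- No slabs are needed here: the original supports sit inside the thickened ones, with `u = 0`.
  · have h := hK₂ μ ((2 * lam) • γ t₀) (C₂ * (lam * θ)) (by positivity) g₁ g₂ hm₁ hm₂ hi₁ hi₂
      (fun ξ η hξ hη => hball ξ η ⟨0, h0, by simpa using hξ⟩ ⟨0, h0, by simpa using hη⟩)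
      (C₁ * ENNReal.ofReal θ⁻¹)
      (fun ζ => (measure_mono fun ξ hξ => by
        exact ⟨⟨0, h0, by simpa using hξ.1⟩, ⟨0, h0, by simpa using hξ.2⟩⟩).trans (hV ζ))
    refine h.trans ?_
    rw [hρ, ENNReal.ofReal_mul (by positivity)]
    calc _ = ((K₂ * Q * C₁ : ℝ≥0) : ℝ≥0∞) * growthNorm α μ *
          (ENNReal.ofReal ((lam * θ) ^ ((d : ℝ) - α)) * ENNReal.ofReal θ⁻¹) * N := by
          push_cast; ring
      _ ≤ _ := by
        gcongr
        exact (le_max_left _ _).trans (le_max_right _ _)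
  · intro x
    have h1 : ∀ I : Set ℝ, I ⊆ Icc a b → (∀ t ∈ I, |t - t₀| ≤ D * θ) → ∀ g : Rd d → ℂ,
        (∀ ξ, g ξ ≠ 0 → ∃ t ∈ I, dist ξ (lam • γ t) ≤ R) →
        volume (Function.support g) ≤ C₃ * ENNReal.ofReal (lam * θ) := by
      intro I hI hId g hg
      refine hC₃ lam θ t₀ hlam hθ hlt' ht₀ _ fun ξ hξ => ?_
      obtain ⟨t, ht, hr⟩ := hg ξ hξ
      exact ⟨t, hI ht, hId t ht, hr⟩
    rw [mul_pow]
    calc ‖fourierHat g₁ x‖ₑ ^ 2 * ‖fourierHat g₂ x‖ₑ ^ 2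
        ≤ (C₃ * ENNReal.ofReal (lam * θ) * ∫⁻ ξ, ‖g₁ ξ‖ₑ ^ 2) *
          (C₃ * ENNReal.ofReal (lam * θ) * ∫⁻ ξ, ‖g₂ ξ‖ₑ ^ 2) := by
          refine mul_le_mul' ((sq_enorm_fourierHat_le hm₁ x).trans ?_)
            ((sq_enorm_fourierHat_le hm₂ x).trans ?_)
          · exact mul_le_mul_left (h1 I₁ hI₁s hI₁d g₁ hg₁) _
          · exact mul_le_mul_left (h1 I₂ hI₂s hI₂d g₂ hg₂) _
      _ = ((C₃ * C₃ : ℝ≥0) : ℝ≥0∞) * ENNReal.ofReal ((lam * θ) ^ 2) * N := by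
          rw [ENNReal.ofReal_pow (by positivity)]
          push_cast
          ring
      _ ≤ _ := by
          gcongr
          exact (le_max_right _ _).trans (le_max_right _ _)

end LocalFrame

/-! ### Interpolation of the bilinear bounds. -/

/-- Interpolation between `L¹`, `L²` and `L^∞` bounds in the form needed for the bilinear
estimate at scale `θ ≥ λ^{-1/2}`. -/
theorem lintegral_rpow_le_of_endpoints {Z : Type*} [MeasurableSpace Z] {μ : Measure Z}
    {f : Z → ℝ≥0∞} (hf : Measurable f) {K : ℝ≥0} {A N : ℝ≥0∞} {lam θ δ p E : ℝ} (hlam : 1 < lam)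
    (hθ : 0 < θ) (hθ1 : θ ≤ 1) (hlt : 1 ≤ lam * θ ^ 2) (hδ1 : δ ≤ 1) (hp : 1 ≤ p)
    (hE₁ : (p - 1 + δ) / 2 ≤ E) (hE₂ : p - 2 + δ ≤ E)
    (h1 : (∫⁻ x, f x ∂μ) ^ 2 ≤ K * A ^ 2 * ENNReal.ofReal (lam ^ δ) * N)
    (h2 : ∫⁻ x, f x ^ 2 ∂μ ≤ K * A * ENNReal.ofReal ((lam * θ) ^ δ * θ⁻¹) * N)
    (h3 : ∀ x, f x ^ 2 ≤ K * ENNReal.ofReal ((lam * θ) ^ 2) * N) :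
    ∫⁻ x, f x ^ p ∂μ ≤ (K : ℝ≥0∞) ^ (p / 2) * A * ENNReal.ofReal (lam ^ E) * N ^ (p / 2) := by
  have hlam0 : 0 < lam := by linarith
  have hl : 0 < Real.log lam := Real.log_pos hlam
  have hs : Real.log θ ≤ 0 := Real.log_nonpos hθ.le hθ1
  have hls : 0 ≤ Real.log lam + 2 * Real.log θ := by
    have h := Real.log_nonneg hlt
    rw [Real.log_mul hlam0.ne' (by positivity), Real.log_pow] at h
    exact_mod_cast h
  have hlt0 : 0 < lam * θ := by positivity
  have hlogmul : Real.log (lam * θ) = Real.log lam + Real.log θ :=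
    Real.log_mul hlam0.ne' hθ.ne'
  -- In logarithms each exponent is affine in `s`, which ranges over `[-l/2, 0]`, so only the two
  -- ends matter.
  set l := Real.log lam
  set s := Real.log θ
  have hMexp : (lam * θ) ^ δ * θ⁻¹ = Real.exp ((l + s) * δ - s) := by
    rw [Real.rpow_def_of_pos hlt0, hlogmul, ← Real.exp_log (inv_pos.2 hθ), Real.log_inv,
      ← Real.exp_add]
    rfl
  have hEexp : lam ^ E = Real.exp (l * E) := Real.rpow_def_of_pos hlam0 E
  have hpow : ∀ x : ℝ≥0∞, ∀ r : ℝ, (x ^ 2) ^ r = x ^ (2 * r) := fun x r => by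
    rw [← ENNReal.rpow_natCast, ← ENNReal.rpow_mul]; norm_num
  rcases le_total p 2 with hp2 | hp2
  · have hexp0 : 0 ≤ (2 - p) / 2 := by linarith
    have hexp1 : 0 ≤ p - 1 := by linarith
    -- The exponent of `θ` is `(p - 1) * (δ - 1) ≤ 0`, so the worst case is `θ = lam ^ (-1/2)`, with
    -- value `(p - 1 + δ) / 2`.
    have hreal : (lam ^ δ) ^ ((2 - p) / 2) * ((lam * θ) ^ δ * θ⁻¹) ^ (p - 1) ≤ lam ^ E := by
      rw [hMexp, hEexp, Real.rpow_def_of_pos hlam0, ← Real.exp_mul, ← Real.exp_mul,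
        ← Real.exp_add, Real.exp_le_exp]
      nlinarith [mul_nonneg (mul_nonneg hexp1 (sub_nonneg.2 hδ1)) hls,
        mul_nonneg hl.le (sub_nonneg.2 hE₁)]
    calc ∫⁻ x, f x ^ p ∂μ = ∫⁻ x, f x ^ (2 - p) * (f x ^ 2) ^ (p - 1) ∂μ := by
          congr 1
          ext x
          rw [hpow, ← ENNReal.rpow_add_of_nonneg _ _ (by linarith) (by linarith)]
          congr 1
          ring
      _ ≤ (∫⁻ x, f x ∂μ) ^ (2 - p) * (∫⁻ x, f x ^ 2 ∂μ) ^ (p - 1) :=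
          ENNReal.lintegral_mul_norm_pow_le hf.aemeasurable (hf.pow_const 2).aemeasurable
            (by linarith) hexp1 (by ring)
      _ = ((∫⁻ x, f x ∂μ) ^ 2) ^ ((2 - p) / 2) * (∫⁻ x, f x ^ 2 ∂μ) ^ (p - 1) := by
          rw [hpow]
          congr 2
          ring
      _ ≤ (K * A ^ 2 * ENNReal.ofReal (lam ^ δ) * N) ^ ((2 - p) / 2) *
          (K * A * ENNReal.ofReal ((lam * θ) ^ δ * θ⁻¹) * N) ^ (p - 1) :=
          mul_le_mul' (ENNReal.rpow_le_rpow h1 hexp0) (ENNReal.rpow_le_rpow h2 hexp1)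
      _ = ((K : ℝ≥0∞) ^ ((2 - p) / 2) * (K : ℝ≥0∞) ^ (p - 1)) * (A ^ (2 - p) * A ^ (p - 1)) *
          (ENNReal.ofReal (lam ^ δ) ^ ((2 - p) / 2) *
            ENNReal.ofReal ((lam * θ) ^ δ * θ⁻¹) ^ (p - 1)) *
          (N ^ ((2 - p) / 2) * N ^ (p - 1)) := by
          simp only [ENNReal.mul_rpow_of_nonneg _ _ hexp0, ENNReal.mul_rpow_of_nonneg _ _ hexp1]
          rw [hpow, show 2 * ((2 - p) / 2) = 2 - p by ring]
          ring
      _ = (K : ℝ≥0∞) ^ (p / 2) * A *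
          (ENNReal.ofReal ((lam ^ δ) ^ ((2 - p) / 2) * ((lam * θ) ^ δ * θ⁻¹) ^ (p - 1))) *
          N ^ (p / 2) := by
          rw [← ENNReal.rpow_add_of_nonneg _ _ hexp0 hexp1,
            ← ENNReal.rpow_add_of_nonneg _ _ hexp0 hexp1,
            ← ENNReal.rpow_add_of_nonneg _ _ (by linarith) hexp1,
            show (2 - p) / 2 + (p - 1) = p / 2 by ring, show 2 - p + (p - 1) = 1 by ring,
            ENNReal.rpow_one, ENNReal.ofReal_rpow_of_nonneg (by positivity) hexp0,
            ENNReal.ofReal_rpow_of_nonneg (by positivity) hexp1,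
            ← ENNReal.ofReal_mul (by positivity)]
      _ ≤ _ := by gcongr
  · have hexp : 0 ≤ (p - 2) / 2 := by linarith
    have hreal : (lam * θ) ^ δ * θ⁻¹ * ((lam * θ) ^ 2) ^ ((p - 2) / 2) ≤ lam ^ E := by
      have h4 : (lam * θ) ^ 2 = Real.exp (2 * (l + s)) := by
        rw [← Real.exp_log hlt0, hlogmul, ← Real.exp_nat_mul]
        norm_num
      rw [hMexp, hEexp, h4, ← Real.exp_mul, ← Real.exp_add, Real.exp_le_exp]
      -- The exponent of `θ` is `δ + p - 3`; its sign decides whether `θ = 1` or `θ = lam ^ (-1/2)`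
      -- is the worst case.
      rcases le_total 0 (δ + p - 3) with h5 | h5
      · nlinarith [mul_nonneg h5 (neg_nonneg.2 hs), mul_nonneg hl.le (sub_nonneg.2 hE₂)]
      · nlinarith [mul_nonneg (neg_nonneg.2 h5) hls, mul_nonneg hl.le (sub_nonneg.2 hE₁)]
    calc ∫⁻ x, f x ^ p ∂μ = ∫⁻ x, f x ^ 2 * (f x ^ 2) ^ ((p - 2) / 2) ∂μ := by
          congr 1
          ext x
          rw [hpow, ← ENNReal.rpow_natCast, ← ENNReal.rpow_add_of_nonneg _ _ (by norm_num)
            (by linarith)]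
          congr 1
          push_cast
          ring
      _ ≤ ∫⁻ x, f x ^ 2 * (K * ENNReal.ofReal ((lam * θ) ^ 2) * N) ^ ((p - 2) / 2) ∂μ := by
          gcongr with x
          exact h3 x
      _ = (∫⁻ x, f x ^ 2 ∂μ) * (K * ENNReal.ofReal ((lam * θ) ^ 2) * N) ^ ((p - 2) / 2) :=
          lintegral_mul_const _ (hf.pow_const 2)
      _ ≤ (K * A * ENNReal.ofReal ((lam * θ) ^ δ * θ⁻¹) * N) *
          (K * ENNReal.ofReal ((lam * θ) ^ 2) * N) ^ ((p - 2) / 2) := by gcongr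
      _ = ((K : ℝ≥0∞) ^ (1 : ℝ) * (K : ℝ≥0∞) ^ ((p - 2) / 2)) * A *
          (ENNReal.ofReal ((lam * θ) ^ δ * θ⁻¹) *
            ENNReal.ofReal ((lam * θ) ^ 2) ^ ((p - 2) / 2)) *
          (N ^ (1 : ℝ) * N ^ ((p - 2) / 2)) := by
          simp only [ENNReal.mul_rpow_of_nonneg _ _ hexp, ENNReal.rpow_one]
          ring
      _ = (K : ℝ≥0∞) ^ (p / 2) * A *
          (ENNReal.ofReal ((lam * θ) ^ δ * θ⁻¹ * ((lam * θ) ^ 2) ^ ((p - 2) / 2))) *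
          N ^ (p / 2) := by
          rw [← ENNReal.rpow_add_of_nonneg _ _ (by norm_num) hexp,
            ← ENNReal.rpow_add_of_nonneg _ _ (by norm_num) hexp,
            show 1 + (p - 2) / 2 = p / 2 by ring,
            ENNReal.ofReal_rpow_of_nonneg (by positivity) hexp,
            ← ENNReal.ofReal_mul (by positivity)]
      _ ≤ _ := by gcongr

/-! ### Whitney decomposition and cutting functions into pieces. -/

theorem sum_range_two_mul {M : Type*} [AddCommMonoid M] (f : ℕ → M) (n : ℕ) :
    ∑ K ∈ Finset.range (2 * n), f K = ∑ k ∈ Finset.range n, (f (2 * k) + f (2 * k + 1)) := by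
  induction n with
  | zero => simp
  | succ n ih =>
    rw [mul_add, mul_one, Finset.sum_range_succ, Finset.sum_range_succ, ih,
      Finset.sum_range_succ, add_assoc]

/-- Whitney decomposition of the square `a 0 0 * a 0 0` into products over pairs of dyadic
intervals of generation `j ≤ n` at distance comparable to their length; at the last generation
also adjacent pairs are allowed. -/
theorem mul_self_le_whitney_sum (a : ℕ → ℕ → ℝ≥0∞) (n : ℕ)
    (ha : ∀ j < n, ∀ k, a j k ≤ a (j + 1) (2 * k) + a (j + 1) (2 * k + 1)) :
    a 0 0 * a 0 0 ≤ ∑ j ∈ Finset.range (n + 1), ∑ k ∈ Finset.range (2 ^ j),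
      ∑ k' ∈ Finset.range (2 ^ j),
        if (k ≤ k' + 3 ∧ k' ≤ k + 3) ∧ (¬(k ≤ k' + 1 ∧ k' ≤ k + 1) ∨ j = n)
        then a j k * a j k' else 0 := by
  set S : ℕ → ℝ≥0∞ := fun j => ∑ k ∈ Finset.range (2 ^ j), ∑ k' ∈ Finset.range (2 ^ j),
    if k ≤ k' + 1 ∧ k' ≤ k + 1 then a j k * a j k' else 0 with hS
  set W : ℕ → ℝ≥0∞ := fun j => ∑ k ∈ Finset.range (2 ^ j), ∑ k' ∈ Finset.range (2 ^ j),
    if (k ≤ k' + 3 ∧ k' ≤ k + 3) ∧ ¬(k ≤ k' + 1 ∧ k' ≤ k + 1) then a j k * a j k' else 0 with hW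
  have hSW : ∀ j, S j + W j = ∑ k ∈ Finset.range (2 ^ j), ∑ k' ∈ Finset.range (2 ^ j),
      if k ≤ k' + 3 ∧ k' ≤ k + 3 then a j k * a j k' else 0 := by
    intro j
    simp only [hS, hW, ← Finset.sum_add_distrib]
    refine Finset.sum_congr rfl fun k _ => Finset.sum_congr rfl fun k' _ => ?_
    by_cases h1 : k ≤ k' + 1 ∧ k' ≤ k + 1
    · rw [if_pos h1, if_neg (by tauto), if_pos (by omega), add_zero]
    · rw [if_neg h1, zero_add]
      simp [h1]
  -- Children of intervals whose indices differ by at most `1` have indices differing by at most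
  -- `3`. Pairs still within `1` are subdivided again; the others are final.
  have hstep : ∀ j < n, S j ≤ S (j + 1) + W (j + 1) := by
    intro j hj
    rw [hSW, pow_succ, mul_comm (2 ^ j) 2, sum_range_two_mul]
    simp_rw [sum_range_two_mul]
    refine Finset.sum_le_sum fun k _ => ?_
    rw [← Finset.sum_add_distrib]
    refine Finset.sum_le_sum fun k' _ => ?_
    by_cases h1 : k ≤ k' + 1 ∧ k' ≤ k + 1
    · rw [if_pos h1, if_pos (by omega), if_pos (by omega), if_pos (by omega), if_pos (by omega)]
      refine (mul_le_mul' (ha j hj k) (ha j hj k')).trans (le_of_eq ?_)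
      ring
    · rw [if_neg h1]
      exact zero_le
  have hind : ∀ l ≤ n, S 0 ≤ S l + ∑ j ∈ Finset.range (l + 1), W j := by
    intro l
    induction l with
    | zero => intro _; exact le_self_add
    | succ l ih =>
      intro hl
      refine (ih (by omega)).trans ?_
      rw [Finset.sum_range_succ _ (l + 1), ← add_assoc, add_right_comm]
      gcongr
      exact hstep l (by omega)
  have h0 : a 0 0 * a 0 0 = S 0 := by simp [hS]
  rw [h0]
  refine (hind n le_rfl).trans ?_
  -- The leftover `S n` is merged with `W n`, so generation `n` keeps every pair within index
  -- distance `3`.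
  rw [Finset.sum_range_succ, Finset.sum_range_succ, ← add_assoc, add_right_comm, add_comm]
  refine add_le_add ?_ ?_
  · refine Finset.sum_le_sum fun j _ => Finset.sum_le_sum fun k _ =>
      Finset.sum_le_sum fun k' _ => ?_
    split_ifs with h1 h2
    · exact le_rfl
    · exact absurd ⟨h1.1, Or.inl h1.2⟩ h2
    · exact zero_le
    · exact le_rfl
  · rw [hSW]
    simp

/-- Each index has at most `7` neighbours within distance `3`, and each pair is charged to both
members. -/
theorem sum_sum_near_le (N : ℕ → ℝ≥0∞) (M : ℕ) :
    ∑ k ∈ Finset.range M, ∑ k' ∈ Finset.range M,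
      (if k ≤ k' + 3 ∧ k' ≤ k + 3 then N k + N k' else 0) ≤ 14 * ∑ k ∈ Finset.range M, N k := by
  have h1 : ∑ k ∈ Finset.range M, ∑ k' ∈ Finset.range M,
      (if k ≤ k' + 3 ∧ k' ≤ k + 3 then N k else 0) ≤ 7 * ∑ k ∈ Finset.range M, N k := by
    rw [Finset.mul_sum]
    refine Finset.sum_le_sum fun k _ => ?_
    rw [← Finset.sum_filter, Finset.sum_const, nsmul_eq_mul]
    gcongr
    have hsub : (Finset.range M).filter (fun k' => k ≤ k' + 3 ∧ k' ≤ k + 3)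
        ⊆ Finset.Icc (k - 3) (k + 3) := by
      intro k' hk'
      simp only [Finset.mem_filter, Finset.mem_range, Finset.mem_Icc] at hk' ⊢
      omega
    have hcard := Finset.card_le_card hsub
    rw [Nat.card_Icc] at hcard
    have : ((Finset.range M).filter (fun k' => k ≤ k' + 3 ∧ k' ≤ k + 3)).card ≤ 7 := by omega
    exact_mod_cast this
  have h2 : ∑ k ∈ Finset.range M, ∑ k' ∈ Finset.range M,
      (if k ≤ k' + 3 ∧ k' ≤ k + 3 then N k' else 0)
      = ∑ k ∈ Finset.range M, ∑ k' ∈ Finset.range M,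
      (if k ≤ k' + 3 ∧ k' ≤ k + 3 then N k else 0) := by
    rw [Finset.sum_comm]
    refine Finset.sum_congr rfl fun k _ => Finset.sum_congr rfl fun k' _ => ?_
    simp only [and_comm]
  calc _ = ∑ k ∈ Finset.range M, ∑ k' ∈ Finset.range M,
        (if k ≤ k' + 3 ∧ k' ≤ k + 3 then N k else 0)
        + ∑ k ∈ Finset.range M, ∑ k' ∈ Finset.range M,
        (if k ≤ k' + 3 ∧ k' ≤ k + 3 then N k' else 0) := by
        simp_rw [← Finset.sum_add_distrib]
        refine Finset.sum_congr rfl fun k _ => Finset.sum_congr rfl fun k' _ => ?_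
        split_ifs <;> simp
    _ ≤ 7 * ∑ k ∈ Finset.range M, N k + 7 * ∑ k ∈ Finset.range M, N k := by
        rw [h2]
        exact add_le_add h1 h1
    _ = _ := by ring

theorem lintegral_Lp_sum_le {Z ι : Type*} [MeasurableSpace Z] {μ : Measure Z} {p : ℝ} (hp : 1 ≤ p)
    (s : Finset ι) {f : ι → Z → ℝ≥0∞} (hf : ∀ i ∈ s, Measurable (f i)) :
    (∫⁻ x, (∑ i ∈ s, f i x) ^ p ∂μ) ^ (1 / p)
      ≤ ∑ i ∈ s, (∫⁻ x, f i x ^ p ∂μ) ^ (1 / p) := by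
  classical
  have hp0 : 0 < p := by linarith
  induction s using Finset.induction_on with
  | empty => simp [hp0]
  | insert i s his ih =>
    rw [Finset.sum_insert his]
    have h := ENNReal.lintegral_Lp_add_le (μ := μ) (f := f i) (g := fun x => ∑ j ∈ s, f j x)
      (hf i (Finset.mem_insert_self _ _)).aemeasurable
      (Finset.measurable_fun_sum s fun j hj => hf j (Finset.mem_insert_of_mem hj)).aemeasurable hp
    simp_rw [Finset.sum_insert his]
    exact h.trans (by
      gcongr
      exact ih fun j hj => hf j (Finset.mem_insert_of_mem hj))

/-- A measurable choice of an index of a covering set. -/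
theorem exists_measurable_index {Z : Type*} [MeasurableSpace Z] {A : ℕ → Set Z}
    (hA : ∀ k, MeasurableSet (A k)) {M : ℕ} {S : Set Z} (hS : ∀ x ∈ S, ∃ k < M, x ∈ A k) :
    ∃ τ : Z → ℕ, Measurable τ ∧ ∀ x ∈ S, τ x < M ∧ x ∈ A (τ x) := by
  classical
  -- The default `M` makes the search total; on `S` a genuine index below `M` is found first.
  have hex : ∀ x, ∃ k, x ∈ A k ∨ k = M := fun x => ⟨M, Or.inr rfl⟩
  refine ⟨fun x => Nat.find (hex x), measurable_find hex fun k => ?_, fun x hx => ?_⟩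
  · by_cases hk : k = M
    · simp [hk]
    · simpa [hk] using hA k
  · obtain ⟨k, hk, hxk⟩ := hS x hx
    have h1 : Nat.find (hex x) ≤ k := Nat.find_min' _ (Or.inl hxk)
    have h2 := Nat.find_spec (hex x)
    have h3 := lt_of_le_of_lt h1 hk
    exact ⟨h3, h2.resolve_right h3.ne⟩

/-- The arc is compact, so this set is its closed thickening. -/
theorem measurableSet_arcNbhd {d : ℕ} {γ : ℝ → Rd d} {p q : ℝ} (hγ : ContinuousOn γ (Icc p q))
    (lam : ℝ) {R : ℝ} (hR : 0 ≤ R) :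
    MeasurableSet {ξ : Rd d | ∃ t ∈ Icc p q, dist ξ (lam • γ t) ≤ R} := by
  have hK : IsCompact ((fun t => lam • γ t) '' Icc p q) :=
    isCompact_Icc.image_of_continuousOn (hγ.const_smul lam)
  have h := hK.cthickening_eq_biUnion_closedBall hR
  have h2 : {ξ : Rd d | ∃ t ∈ Icc p q, dist ξ (lam • γ t) ≤ R}
      = Metric.cthickening R ((fun t => lam • γ t) '' Icc p q) := by
    rw [h]
    ext ξ
    simp
  rw [h2]
  exact Metric.isClosed_cthickening.measurableSet

theorem fourierHat_add {d : ℕ} {g h : Rd d → ℂ} (hg : Integrable g) (hh : Integrable h)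
    (x : Rd d) : fourierHat (g + h) x = fourierHat g x + fourierHat h x := by
  unfold fourierHat
  rw [← integral_add (integrable_cexp_inner_mul hg x) (integrable_cexp_inner_mul hh x)]
  simp [mul_add]

theorem sum_lintegral_sq_indicator_le {d : ℕ} {g : Rd d → ℂ} (hg : Measurable g)
    {σ : Rd d → ℕ} (hσ : Measurable σ) (M : ℕ) :
    ∑ k ∈ Finset.range M, ∫⁻ ξ, ‖{ξ | σ ξ = k}.indicator g ξ‖ₑ ^ 2 ≤ ∫⁻ ξ, ‖g ξ‖ₑ ^ 2 := by
  have hm : ∀ k, MeasurableSet {ξ | σ ξ = k} := fun k => hσ (measurableSet_singleton k)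
  rw [← lintegral_finsetSum _ fun k _ => ((hg.indicator (hm k)).enorm.pow_const 2)]
  refine lintegral_mono fun ξ => ?_
  calc ∑ k ∈ Finset.range M, ‖{ξ | σ ξ = k}.indicator g ξ‖ₑ ^ 2
      = ∑ k ∈ Finset.range M, if σ ξ = k then ‖g ξ‖ₑ ^ 2 else 0 := by
        refine Finset.sum_congr rfl fun k _ => ?_
        by_cases h : σ ξ = k
        · rw [if_pos h, indicator_of_mem (by exact h)]
        · rw [if_neg h, indicator_of_notMem (by exact h)]; simp
    _ ≤ _ := by
        rw [Finset.sum_ite_eq]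
        split_ifs <;> simp

theorem ennreal_sqrt_mul_le_add (x y : ℝ≥0∞) : (x * y) ^ (1 / 2 : ℝ) ≤ x + y := by
  have h : x * y ≤ (x + y) ^ 2 := by
    rw [sq]
    exact mul_le_mul' le_self_add le_add_self
  calc (x * y) ^ (1 / 2 : ℝ) ≤ ((x + y) ^ 2) ^ (1 / 2 : ℝ) := ENNReal.rpow_le_rpow h (by norm_num)
    _ = x + y := by rw [← ENNReal.rpow_natCast, ← ENNReal.rpow_mul]; simp

/-! ### The linear estimate on a single arc. -/

namespace LocalFrame

variable {d : ℕ} {γ V : ℝ → Rd d} {X Y : Rd d →L[ℝ] ℝ} {m : ℝ → ℝ} {a b B : ℝ}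

/-- The linear estimate on an arc carrying a local frame, by summing the bilinear estimates over
a Whitney decomposition. -/
theorem exists_linear_estimate (F : LocalFrame γ V X Y m a b B) (hγ : ContinuousOn γ (Icc a b))
    (hab0 : a < b) (hab : b - a ≤ 1) {α : ℝ} (hα : (d : ℝ) - α ≤ 1) {R : ℝ} (hR : 0 ≤ R)
    {p E : ℝ} (hp : 1 ≤ p) (hE₁ : (p - 1 + (d - α)) / 2 ≤ E) (hE₂ : p - 2 + (d - α) ≤ E) :
    ∃ K : ℝ≥0, ∀ (μ : Measure (Rd d)) [SFinite μ], μ (Metric.closedBall (0 : Rd d) 1)ᶜ = 0 →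
      ∀ lam : ℝ, 1 < lam → ∀ g : Rd d → ℂ, Measurable g → Integrable g →
      (∀ ξ, g ξ ≠ 0 → ∃ t ∈ Icc a b, dist ξ (lam • γ t) ≤ R) →
      (∫⁻ x, (‖fourierHat g x‖ₑ * ‖fourierHat g x‖ₑ) ^ p ∂μ) ^ (1 / p)
        ≤ K * ENNReal.ofReal (1 + Real.log lam) * growthNorm α μ ^ (1 / p) *
          ENNReal.ofReal (lam ^ (E / p)) * ∫⁻ ξ, ‖g ξ‖ₑ ^ 2 := by
  set ℓ := b - a with hℓ
  have hℓ0 : 0 < ℓ := by linarith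
  have hp0 : 0 < p := by linarith
  -- Index distance `3` plus one interval length gives `D = 4`, measured from the left end of the
  -- first interval; non-adjacent intervals are at least one length `ℓ * θ` apart, so `c = ℓ`.
  obtain ⟨K, hK⟩ := F.exists_bilinear_estimates α hR (D := 4) (by norm_num) hℓ0 hab
  refine ⟨14 * K ^ (1 / 2 : ℝ), ?_⟩
  intro μ _ hμs lam hlam g hgm hg hsupp
  have hlam0 : 0 < lam := by linarith
  -- The last generation has `4 ^ n ≤ lam < 4 ^ (n + 1)`, so that `1 ≤ lam * θ n ^ 2 ≤ 4`.
  obtain ⟨n, hn1, hn2⟩ := exists_nat_pow_near hlam.le (show (1 : ℝ) < 4 by norm_num)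
  set θ : ℕ → ℝ := fun j => ((2 : ℝ) ^ j)⁻¹ with hθ
  have hθ0 : ∀ j, 0 < θ j := fun j => by positivity
  have hθ1 : ∀ j, θ j ≤ 1 := fun j => inv_le_one_of_one_le₀ (one_le_pow₀ (by norm_num))
  have hθsq : ∀ j, θ j ^ 2 = ((4 : ℝ) ^ j)⁻¹ := fun j => by
    simp only [hθ]
    rw [inv_pow, ← pow_mul, mul_comm j 2, pow_mul]
    norm_num
  have hθlow : ∀ j ≤ n, 1 ≤ lam * θ j ^ 2 := fun j hj => by
    rw [hθsq, ← div_eq_mul_inv, one_le_div (by positivity)]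
    exact (pow_le_pow_right₀ (by norm_num) hj).trans hn1
  have hθn : lam * θ n ^ 2 ≤ 4 := by
    rw [hθsq, ← div_eq_mul_inv, div_le_iff₀ (by positivity)]
    rw [pow_succ] at hn2
    linarith
  set I : ℕ → ℕ → Set ℝ := fun j k => Icc (a + k * (ℓ * θ j)) (a + (k + 1) * (ℓ * θ j)) with hI
  have hIsub : ∀ j, ∀ k < 2 ^ j, I j k ⊆ Icc a b := by
    intro j k hk t ht
    have h1 : ((k : ℝ) + 1) * θ j ≤ 1 := by
      simp only [hθ]
      rw [← div_eq_mul_inv, div_le_one (by positivity)]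
      exact_mod_cast hk
    have h2 : 0 ≤ (k : ℝ) * (ℓ * θ j) := by positivity
    refine ⟨by linarith [ht.1], ht.2.trans ?_⟩
    have h3 : ((k : ℝ) + 1) * (ℓ * θ j) ≤ ℓ := by
      calc ((k : ℝ) + 1) * (ℓ * θ j) = ℓ * (((k : ℝ) + 1) * θ j) := by ring
        _ ≤ ℓ * 1 := by gcongr
        _ = ℓ := mul_one _
    linarith
  -- Neighbourhoods of different subarcs overlap, so each frequency is assigned to a single finest
  -- one; the pieces of `g` are then disjointly supported. The `min` keeps the arcs inside `[a, b]`
  -- for every index.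
  obtain ⟨τ, hτm, hτ⟩ := exists_measurable_index (Z := Rd d)
    (A := fun k => {ξ : Rd d | ∃ t ∈ Icc (a + k * (ℓ * θ n)) (min b (a + (k + 1) * (ℓ * θ n))),
      dist ξ (lam • γ t) ≤ R}) (M := 2 ^ n) (S := Function.support g)
    (fun k => measurableSet_arcNbhd (hγ.mono (Icc_subset_Icc
      (by have := hθ0 n; nlinarith [mul_nonneg (Nat.cast_nonneg (α := ℝ) k) (mul_pos hℓ0 this).le])
      (min_le_left _ _))) lam hR)
    (by
      intro ξ hξ
      obtain ⟨t, ht, hr⟩ := hsupp ξ hξ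
      have hs : 0 < ℓ * θ n := mul_pos hℓ0 (hθ0 n)
      have h0 : 0 ≤ (t - a) / (ℓ * θ n) := div_nonneg (by linarith [ht.1]) hs.le
      rcases lt_or_eq_of_le ht.2 with htb | htb
      · refine ⟨⌊(t - a) / (ℓ * θ n)⌋₊, ?_, t, ⟨?_, le_min ht.2 ?_⟩, hr⟩
        · rw [Nat.floor_lt h0, div_lt_iff₀ hs]
          have : ((2 ^ n : ℕ) : ℝ) * (ℓ * θ n) = ℓ := by
            simp only [hθ]; push_cast; field_simp
          linarith
        · have := Nat.floor_le h0
          rw [le_div_iff₀ hs] at this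
          linarith
        · have := Nat.lt_floor_add_one ((t - a) / (ℓ * θ n))
          rw [div_lt_iff₀ hs] at this
          linarith
      -- At the right endpoint the floor would give `2 ^ n`; the last interval is used instead.
      · have h2 : (1 : ℕ) ≤ 2 ^ n := Nat.one_le_two_pow
        have h3 : (((2 ^ n - 1 : ℕ) : ℝ) + 1) * (ℓ * θ n) = ℓ := by
          rw [Nat.cast_sub h2]
          simp only [hθ]; push_cast; field_simp; ring
        refine ⟨2 ^ n - 1, by omega, t, ⟨?_, le_min ht.2 ?_⟩, hr⟩
        · linarith
        · linarith)
  -- Integer division gives the generation-`j` ancestor of the finest interval.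
  set σ : ℕ → Rd d → ℕ := fun j ξ => τ ξ / 2 ^ (n - j) with hσ
  have hσm : ∀ j, Measurable (σ j) := fun j =>
    (measurable_from_top (f := fun k : ℕ => k / 2 ^ (n - j))).comp hτm
  have hσset : ∀ j k, MeasurableSet {ξ | σ j ξ = k} := fun j k => hσm j (measurableSet_singleton k)
  set G : ℕ → ℕ → Rd d → ℂ := fun j k => {ξ | σ j ξ = k}.indicator g with hG
  have hGm : ∀ j k, Measurable (G j k) := fun j k => hgm.indicator (hσset j k)
  have hGi : ∀ j k, Integrable (G j k) := fun j k => hg.indicator (hσset j k)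
  have hG0 : G 0 0 = g := by
    ext ξ
    by_cases h : g ξ = 0
    · simp [hG, h]
    · have h1 := (hτ ξ h).1
      simp only [hG]
      rw [indicator_of_mem]
      simp only [hσ, mem_ofPred_eq, Nat.sub_zero]
      exact Nat.div_eq_of_lt h1
  have hGsplit : ∀ j < n, ∀ k, G j k = G (j + 1) (2 * k) + G (j + 1) (2 * k + 1) := by
    intro j hj k
    ext ξ
    have h1 : σ j ξ = σ (j + 1) ξ / 2 := by
      simp only [hσ]
      rw [Nat.div_div_eq_div_mul, ← pow_succ]
      congr 2
      omega
    simp only [hG, indicator, mem_ofPred_eq, Pi.add_apply, h1]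
    by_cases h2 : σ (j + 1) ξ = 2 * k
    · rw [if_pos (by omega), if_pos h2, if_neg (by omega), add_zero]
    · by_cases h3 : σ (j + 1) ξ = 2 * k + 1
      · rw [if_pos (by omega), if_neg h2, if_pos h3, zero_add]
      · rw [if_neg (by omega), if_neg h2, if_neg h3, add_zero]
  have hGsupp : ∀ j ≤ n, ∀ k, ∀ ξ, G j k ξ ≠ 0 → ∃ t ∈ I j k, dist ξ (lam • γ t) ≤ R := by
    intro j hj k ξ hξ
    have hk : σ j ξ = k := by
      by_contra hne
      exact hξ (indicator_of_notMem (by exact hne) _)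
    have hgξ : g ξ ≠ 0 := by
      intro h
      refine hξ ?_
      simp only [hG]
      rw [indicator_of_mem (by exact hk), h]
    obtain ⟨hlt, t, ht, hr⟩ := hτ ξ hgξ
    refine ⟨t, ?_, hr⟩
    have h2 : (0 : ℕ) < 2 ^ (n - j) := by positivity
    have hθj : θ j = ((2 ^ (n - j) : ℕ) : ℝ) * θ n := by
      simp only [hθ]
      have : (2 : ℝ) ^ n = 2 ^ (n - j) * 2 ^ j := by rw [← pow_add]; congr 1; omega
      rw [this]
      push_cast
      field_simp
    have h3 : k * 2 ^ (n - j) ≤ τ ξ := by rw [← hk]; exact Nat.div_mul_le_self _ _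
    have h4 : τ ξ + 1 ≤ (k + 1) * 2 ^ (n - j) := by
      rw [← hk]
      exact Nat.lt_mul_of_div_lt (Nat.lt_succ_self _) h2
    have h3' : (k : ℝ) * ((2 ^ (n - j) : ℕ) : ℝ) ≤ τ ξ := by exact_mod_cast h3
    have h4' : (τ ξ : ℝ) + 1 ≤ ((k : ℝ) + 1) * ((2 ^ (n - j) : ℕ) : ℝ) := by exact_mod_cast h4
    have hs : 0 < ℓ * θ n := mul_pos hℓ0 (hθ0 n)
    have h5 := ht.2.trans (min_le_right _ _)
    have h6 := ht.1
    constructor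
    · refine le_trans ?_ h6
      rw [hθj]
      have := mul_le_mul_of_nonneg_right h3' hs.le
      linarith
    · refine h5.trans ?_
      rw [hθj]
      have := mul_le_mul_of_nonneg_right h4' hs.le
      linarith
  set A : ℕ → ℕ → Rd d → ℝ≥0∞ := fun j k x => ‖fourierHat (G j k) x‖ₑ with hA
  have hAm : ∀ j k, Measurable (A j k) := fun j k =>
    (continuous_fourierHat (hGi j k)).measurable.enorm
  set N : ℕ → ℕ → ℝ≥0∞ := fun j k => ∫⁻ ξ, ‖G j k ξ‖ₑ ^ 2 with hN
  set L : ℝ≥0∞ := (K : ℝ≥0∞) ^ (1 / 2 : ℝ) * growthNorm α μ ^ (1 / p) *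
    ENNReal.ofReal (lam ^ (E / p)) with hL
  -- the bilinear estimate for an admissible pair
  have hpair : ∀ j ≤ n, ∀ k < 2 ^ j, ∀ k' < 2 ^ j, (k ≤ k' + 3 ∧ k' ≤ k + 3) →
      (¬(k ≤ k' + 1 ∧ k' ≤ k + 1) ∨ j = n) →
      (∫⁻ x, (A j k x * A j k' x) ^ p ∂μ) ^ (1 / p) ≤ L * (N j k + N j k') := by
    intro j hj k hk k' hk' hnear hfar
    have hs : 0 < ℓ * θ j := mul_pos hℓ0 (hθ0 j)
    have hsθ : ℓ * θ j ≤ θ j := mul_le_of_le_one_left (hθ0 j).le hab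
    have hn1' : (k : ℝ) ≤ k' + 3 := by exact_mod_cast hnear.1
    have hn2' : (k' : ℝ) ≤ k + 3 := by exact_mod_cast hnear.2
    have hpos1 := mul_le_mul_of_nonneg_right hn1' hs.le
    have hpos2 := mul_le_mul_of_nonneg_right hn2' hs.le
    have ht₀ : a + k * (ℓ * θ j) ∈ Icc a b := hIsub j k hk ⟨le_rfl, by linarith⟩
    obtain ⟨e1, e2, e3⟩ := hK μ hμs lam (θ j) (a + k * (ℓ * θ j)) hlam (hθ0 j) (hθ1 j)
      (hθlow j hj) ht₀ (I j k) (I j k') ordConnected_Icc ordConnected_Icc (hIsub j k hk)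
      (hIsub j k' hk')
      (fun t ht => by
        have h1 := ht.1
        have h2 := ht.2
        rw [abs_le]
        constructor <;> linarith)
      (fun t ht => by
        have h1 := ht.1
        have h2 := ht.2
        rw [abs_le]
        constructor <;> linarith)
      (by
        rcases hfar with hfar | hfar
        · left
          intro t ht s hs'
          rcases (by omega : k' + 2 ≤ k ∨ k + 2 ≤ k') with h | h
          · have h1 : (k' : ℝ) + 2 ≤ k := by exact_mod_cast h
            have h2 := mul_le_mul_of_nonneg_right h1 hs.le
            refine le_trans ?_ (le_abs_self _)
            linarith [ht.1, hs'.2]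
          · have h1 : (k : ℝ) + 2 ≤ k' := by exact_mod_cast h
            have h2 := mul_le_mul_of_nonneg_right h1 hs.le
            refine le_trans ?_ (neg_le_abs _)
            linarith [ht.2, hs'.1]
        · right
          rw [hfar]
          exact hθn)
      (G j k) (G j k') (hGm j k) (hGm j k') (hGi j k) (hGi j k') (hGsupp j hj k) (hGsupp j hj k')
    have h := lintegral_rpow_le_of_endpoints ((hAm j k).mul (hAm j k')) hlam (hθ0 j) (hθ1 j)
      (hθlow j hj) hα hp hE₁ hE₂ e1 e2 e3
    calc (∫⁻ x, (A j k x * A j k' x) ^ p ∂μ) ^ (1 / p)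
        ≤ ((K : ℝ≥0∞) ^ (p / 2) * growthNorm α μ * ENNReal.ofReal (lam ^ E) *
          (N j k * N j k') ^ (p / 2)) ^ (1 / p) := ENNReal.rpow_le_rpow h (by positivity)
      _ = L * (N j k * N j k') ^ (1 / 2 : ℝ) := by
          have hp' : (0 : ℝ) ≤ 1 / p := by positivity
          simp only [ENNReal.mul_rpow_of_nonneg _ _ hp', ← ENNReal.rpow_mul]
          rw [ENNReal.ofReal_rpow_of_nonneg (by positivity) hp', ← Real.rpow_mul hlam0.le,
            show p / 2 * (1 / p) = 1 / 2 by field_simp, show E * (1 / p) = E / p by ring]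
      _ ≤ _ := by
          gcongr
          exact ennreal_sqrt_mul_le_add _ _
  have hNsum : ∀ j, ∑ k ∈ Finset.range (2 ^ j), N j k ≤ ∫⁻ ξ, ‖g ξ‖ₑ ^ 2 := fun j =>
    sum_lintegral_sq_indicator_le hgm (hσm j) _
  have hWhit : ∀ x, ‖fourierHat g x‖ₑ * ‖fourierHat g x‖ₑ
      ≤ ∑ j ∈ Finset.range (n + 1), ∑ k ∈ Finset.range (2 ^ j), ∑ k' ∈ Finset.range (2 ^ j),
        if (k ≤ k' + 3 ∧ k' ≤ k + 3) ∧ (¬(k ≤ k' + 1 ∧ k' ≤ k + 1) ∨ j = n)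
        then A j k x * A j k' x else 0 := by
    intro x
    have h := mul_self_le_whitney_sum (fun j k => A j k x) n (fun j hj k => by
      simp only [hA]
      rw [hGsplit j hj k, fourierHat_add (hGi _ _) (hGi _ _)]
      exact enorm_add_le _ _)
    simp only [hA, hG0] at h
    exact h
  have hterm : ∀ j k k', Measurable fun x =>
      if (k ≤ k' + 3 ∧ k' ≤ k + 3) ∧ (¬(k ≤ k' + 1 ∧ k' ≤ k + 1) ∨ j = n)
        then A j k x * A j k' x else 0 := by
    intro j k k'
    split_ifs
    · exact (hAm j k).mul (hAm j k')
    · exact measurable_const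
  -- The number of scales is the only loss in the summation.
  have hlog : ((n + 1 : ℕ) : ℝ≥0∞) ≤ ENNReal.ofReal (1 + Real.log lam) := by
    rw [← ENNReal.ofReal_natCast]
    refine ENNReal.ofReal_le_ofReal ?_
    have h1 := Real.log_le_log (by positivity) hn1
    rw [Real.log_pow] at h1
    have h2 : 1 ≤ Real.log 4 := by
      rw [show (4 : ℝ) = 2 ^ 2 by norm_num, Real.log_pow]
      push_cast
      linarith [Real.log_two_gt_d9]
    push_cast
    nlinarith [Nat.cast_nonneg (α := ℝ) n]
  calc (∫⁻ x, (‖fourierHat g x‖ₑ * ‖fourierHat g x‖ₑ) ^ p ∂μ) ^ (1 / p)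
      ≤ (∫⁻ x, (∑ j ∈ Finset.range (n + 1), ∑ k ∈ Finset.range (2 ^ j),
        ∑ k' ∈ Finset.range (2 ^ j),
        if (k ≤ k' + 3 ∧ k' ≤ k + 3) ∧ (¬(k ≤ k' + 1 ∧ k' ≤ k + 1) ∨ j = n)
        then A j k x * A j k' x else 0) ^ p ∂μ) ^ (1 / p) := by
        gcongr with x
        exact hWhit x
    _ ≤ ∑ j ∈ Finset.range (n + 1), ∑ k ∈ Finset.range (2 ^ j), ∑ k' ∈ Finset.range (2 ^ j),
        (∫⁻ x, (if (k ≤ k' + 3 ∧ k' ≤ k + 3) ∧ (¬(k ≤ k' + 1 ∧ k' ≤ k + 1) ∨ j = n)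
        then A j k x * A j k' x else 0) ^ p ∂μ) ^ (1 / p) := by
        refine (lintegral_Lp_sum_le hp _ fun j _ => Finset.measurable_fun_sum _ fun k _ =>
          Finset.measurable_fun_sum _ fun k' _ => hterm j k k').trans ?_
        refine Finset.sum_le_sum fun j _ => ?_
        refine (lintegral_Lp_sum_le hp _ fun k _ =>
          Finset.measurable_fun_sum _ fun k' _ => hterm j k k').trans ?_
        refine Finset.sum_le_sum fun k _ => ?_
        exact lintegral_Lp_sum_le hp _ fun k' _ => hterm j k k'
    _ ≤ ∑ j ∈ Finset.range (n + 1), ∑ k ∈ Finset.range (2 ^ j), ∑ k' ∈ Finset.range (2 ^ j),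
        L * (if k ≤ k' + 3 ∧ k' ≤ k + 3 then N j k + N j k' else 0) := by
        refine Finset.sum_le_sum fun j hj => Finset.sum_le_sum fun k hk =>
          Finset.sum_le_sum fun k' hk' => ?_
        rw [Finset.mem_range] at hj hk hk'
        by_cases h : (k ≤ k' + 3 ∧ k' ≤ k + 3) ∧ (¬(k ≤ k' + 1 ∧ k' ≤ k + 1) ∨ j = n)
        · simp only [if_pos h, if_pos h.1]
          exact hpair j (by omega) k hk k' hk' h.1 h.2
        · simp only [if_neg h]
          simp [hp0]
    _ ≤ ∑ j ∈ Finset.range (n + 1), L * (14 * ∫⁻ ξ, ‖g ξ‖ₑ ^ 2) := by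
        refine Finset.sum_le_sum fun j _ => ?_
        simp_rw [← Finset.mul_sum]
        gcongr
        refine (sum_sum_near_le (N j) (2 ^ j)).trans ?_
        gcongr
        exact hNsum j
    _ = ((n + 1 : ℕ) : ℝ≥0∞) * (L * (14 * ∫⁻ ξ, ‖g ξ‖ₑ ^ 2)) := by simp
    _ ≤ ENNReal.ofReal (1 + Real.log lam) * (L * (14 * ∫⁻ ξ, ‖g ξ‖ₑ ^ 2)) := by gcongr
    _ = _ := by
        rw [hL, ENNReal.coe_mul, ENNReal.coe_rpow_of_nonneg _ (by norm_num : (0 : ℝ) ≤ 1 / 2)]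
        push_cast
        ring

end LocalFrame

theorem le_of_sq_le_mul_sq {x y c : ℝ≥0∞} (h : x ^ 2 ≤ c * y ^ 2) :
    x ≤ c ^ (1 / 2 : ℝ) * y := by
  have hs : ∀ z : ℝ≥0∞, (z ^ 2) ^ (1 / 2 : ℝ) = z := fun z => by
    rw [← ENNReal.rpow_natCast, ← ENNReal.rpow_mul]; simp
  have := ENNReal.rpow_le_rpow h (show (0 : ℝ) ≤ 1 / 2 by norm_num)
  rwa [hs, ENNReal.mul_rpow_of_nonneg _ _ (by norm_num), hs] at this

theorem one_add_log_le {ε : ℝ} (hε : 0 < ε) {lam : ℝ} (hlam : 1 < lam) :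
    1 + Real.log lam ≤ (1 + 1 / ε) * lam ^ ε := by
  have h1 := Real.log_le_rpow_div (by linarith : (0 : ℝ) ≤ lam) hε
  have h2 : 1 ≤ lam ^ ε := Real.one_le_rpow hlam.le hε.le
  have h3 : (1 + 1 / ε) * lam ^ ε = lam ^ ε + lam ^ ε / ε := by ring
  linarith

namespace LocalFrame

variable {d : ℕ} {γ V : ℝ → Rd d} {X Y : Rd d →L[ℝ] ℝ} {m : ℝ → ℝ} {a b B : ℝ}

/-- The case `q = ∞` needs no bilinear argument: the neighbourhood of the whole arc has volume
`O(λ)`, and Cauchy–Schwarz suffices. -/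
theorem exists_eLpNorm_top_le (F : LocalFrame γ V X Y m a b B) (hab0 : a < b) (hab : b - a ≤ 1)
    {R : ℝ} :
    ∃ K : ℝ≥0, ∀ (μ : Measure (Rd d)), ∀ lam : ℝ, 1 < lam → ∀ g : Rd d → ℂ, Measurable g →
      (∀ ξ, g ξ ≠ 0 → ∃ t ∈ Icc a b, dist ξ (lam • γ t) ≤ R) →
      eLpNorm (fourierHat g) ∞ μ
        ≤ K * ENNReal.ofReal (lam ^ (1 / 2 : ℝ)) * eLpNorm g 2 volume := by
  obtain ⟨C, hC⟩ := F.exists_volume_nbhd_le (R := R) (D := 1) zero_le_one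
  refine ⟨C ^ (1 / 2 : ℝ), ?_⟩
  intro μ lam hlam g hgm hsupp
  have hlam0 : 0 < lam := by linarith
  have hvol := hC lam 1 a hlam one_pos (by linarith) (left_mem_Icc.2 hab0.le) (Function.support g)
    (fun ξ hξ => by
      obtain ⟨t, ht, hr⟩ := hsupp ξ hξ
      refine ⟨t, ht, ?_, hr⟩
      rw [abs_of_nonneg (by linarith [ht.1])]
      linarith [ht.2])
  rw [mul_one] at hvol
  rw [eLpNorm_exponent_top]
  refine essSup_le_of_ae_le _ (Filter.Eventually.of_forall fun x => ?_)
  have h1 : ‖fourierHat g x‖ₑ ^ 2 ≤ (C * ENNReal.ofReal lam) * eLpNorm g 2 volume ^ 2 := by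
    rw [eLpNorm_two_sq]
    exact (sq_enorm_fourierHat_le hgm x).trans (by gcongr)
  refine (le_of_sq_le_mul_sq h1).trans (le_of_eq ?_)
  rw [ENNReal.mul_rpow_of_nonneg _ _ (by norm_num),
    ENNReal.coe_rpow_of_nonneg _ (by norm_num : (0 : ℝ) ≤ 1 / 2),
    ENNReal.ofReal_rpow_of_nonneg hlam0.le (by norm_num)]

/-- For finite `q` the bilinear exponents are `p = q / 2` and `E = q * κ`; the two lower bounds on
`E` are then exactly the two entries of the maximum. The resulting bound is for the squared norm, so
the logarithm may cost `λ ^ (2ε)`. -/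
theorem exists_eLpNorm_le (F : LocalFrame γ V X Y m a b B) (hγ : ContinuousOn γ (Icc a b))
    (hab0 : a < b) (hab : b - a ≤ 1) {α : ℝ} (hα : (d : ℝ) - α ≤ 1) {R : ℝ} (hR : 0 ≤ R)
    {q : ℝ≥0∞} (hq : 2 ≤ q) {ε : ℝ} (hε : 0 < ε) :
    ∃ K : ℝ≥0, ∀ (μ : Measure (Rd d)) [SFinite μ], μ (Metric.closedBall (0 : Rd d) 1)ᶜ = 0 →
      ∀ lam : ℝ, 1 < lam → ∀ g : Rd d → ℂ, Measurable g → Integrable g →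
      (∀ ξ, g ξ ≠ 0 → ∃ t ∈ Icc a b, dist ξ (lam • γ t) ≤ R) →
      eLpNorm (fourierHat g) q μ
        ≤ K * growthNorm α μ ^ (1 / q).toReal * ENNReal.ofReal (lam ^ (kappa d α q + ε)) *
          eLpNorm g 2 volume := by
  rcases eq_or_ne q ∞ with rfl | hqt
  · obtain ⟨K, hK⟩ := F.exists_eLpNorm_top_le hab0 hab (R := R)
    refine ⟨K, fun μ _ _ lam hlam g hgm _ hsupp => (hK μ lam hlam g hgm hsupp).trans ?_⟩
    have h1 : (1 : ℝ) / 2 ≤ kappa d α ∞ + ε := by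
      have : (1 : ℝ) / 2 ≤ kappa d α ∞ := by
        unfold kappa
        refine le_max_of_le_right ?_
        simp
      linarith
    have h2 : growthNorm α μ ^ (1 / ∞ : ℝ≥0∞).toReal = 1 := by simp
    rw [h2, mul_one]
    gcongr
    exact hlam.le
  · set r := q.toReal with hr
    have hr2 : 2 ≤ r := by
      have := ENNReal.toReal_mono hqt hq
      simpa using this
    have hr0 : 0 < r := by linarith
    have hq1 : (1 / q).toReal = 1 / r := by simp [hr]
    set κ := kappa d α q with hκ
    have hκ1 : 1 / 4 + ((d : ℝ) - α - 1) / 2 * (1 / r) ≤ κ := by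
      rw [hκ, kappa, hq1]; exact le_max_left _ _
    have hκ2 : 1 / 2 + ((d : ℝ) - α - 2) * (1 / r) ≤ κ := by
      rw [hκ, kappa, hq1]; exact le_max_right _ _
    have hE1 : (r / 2 - 1 + ((d : ℝ) - α)) / 2 ≤ r * κ := by
      have := mul_le_mul_of_nonneg_left hκ1 hr0.le
      refine le_trans (le_of_eq ?_) this
      field_simp
      ring
    have hE2 : r / 2 - 2 + ((d : ℝ) - α) ≤ r * κ := by
      have := mul_le_mul_of_nonneg_left hκ2 hr0.le
      refine le_trans (le_of_eq ?_) this
      field_simp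
      ring
    obtain ⟨K, hK⟩ := F.exists_linear_estimate hγ hab0 hab hα hR (p := r / 2) (by linarith) hE1 hE2
    have h2ε : 0 < 2 * ε := by linarith
    refine ⟨(K * Real.toNNReal (1 + 1 / (2 * ε))) ^ (1 / 2 : ℝ), ?_⟩
    intro μ _ hμs lam hlam g hgm hgi hsupp
    have hlam0 : 0 < lam := by linarith
    have h := hK μ hμs lam hlam g hgm hgi hsupp
    have hq0 : q ≠ 0 := by
      rintro rfl
      simp at hq
    have hLHS : (∫⁻ x, (‖fourierHat g x‖ₑ * ‖fourierHat g x‖ₑ) ^ (r / 2) ∂μ) ^ (1 / (r / 2))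
        = eLpNorm (fourierHat g) q μ ^ 2 := by
      rw [eLpNorm_eq_lintegral_rpow_enorm_toReal hq0 hqt, ← hr, ← ENNReal.rpow_natCast,
        ← ENNReal.rpow_mul]
      have h1 : ∀ y : ℝ≥0∞, (y * y) ^ (r / 2) = y ^ r := fun y => by
        rw [← sq, ← ENNReal.rpow_natCast, ← ENNReal.rpow_mul]
        congr 1
        push_cast
        ring
      simp_rw [h1]
      congr 1
      push_cast
      field_simp
    rw [hLHS, ← eLpNorm_two_sq] at h
    have h3 : eLpNorm (fourierHat g) q μ ^ 2
        ≤ ((K * Real.toNNReal (1 + 1 / (2 * ε)) : ℝ≥0) * growthNorm α μ ^ (1 / (r / 2)) *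
          ENNReal.ofReal (lam ^ (2 * (κ + ε)))) * eLpNorm g 2 volume ^ 2 := by
      refine h.trans ?_
      refine mul_le_mul_left ?_ _
      have h4 : ENNReal.ofReal (1 + Real.log lam)
          ≤ Real.toNNReal (1 + 1 / (2 * ε)) * ENNReal.ofReal (lam ^ (2 * ε)) := by
        change _ ≤ ENNReal.ofReal _ * _
        rw [← ENNReal.ofReal_mul (by positivity)]
        exact ENNReal.ofReal_le_ofReal (one_add_log_le h2ε hlam)
      have h5 : lam ^ (2 * (κ + ε)) = lam ^ (2 * ε) * lam ^ (r * κ / (r / 2)) := by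
        rw [← Real.rpow_add hlam0]
        congr 1
        field_simp
        ring
      rw [h5, ENNReal.ofReal_mul (by positivity)]
      calc (K : ℝ≥0∞) * ENNReal.ofReal (1 + Real.log lam) * growthNorm α μ ^ (1 / (r / 2)) *
            ENNReal.ofReal (lam ^ (r * κ / (r / 2)))
          ≤ (K : ℝ≥0∞) * (Real.toNNReal (1 + 1 / (2 * ε)) * ENNReal.ofReal (lam ^ (2 * ε))) *
            growthNorm α μ ^ (1 / (r / 2)) * ENNReal.ofReal (lam ^ (r * κ / (r / 2))) := by gcongr
        _ = _ := by push_cast; ring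
    refine (le_of_sq_le_mul_sq h3).trans (le_of_eq ?_)
    rw [hq1, ENNReal.mul_rpow_of_nonneg _ _ (by norm_num),
      ENNReal.mul_rpow_of_nonneg _ _ (by norm_num),
      ENNReal.coe_rpow_of_nonneg _ (by norm_num : (0 : ℝ) ≤ 1 / 2),
      ENNReal.ofReal_rpow_of_nonneg (by positivity) (by norm_num), ← Real.rpow_mul hlam0.le,
      ← ENNReal.rpow_mul]
    congr 4
    · field_simp
    · ring_nf

end LocalFrame

/-! ### Assembling the arcs and passing to general `g`. -/

theorem fourierHat_finset_sum {d : ℕ} {ι : Type*} (s : Finset ι) {g : ι → Rd d → ℂ}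
    (hg : ∀ i ∈ s, Integrable (g i)) :
    fourierHat (∑ i ∈ s, g i) = ∑ i ∈ s, fourierHat (g i) := by
  ext x
  rw [Finset.sum_apply]
  unfold fourierHat
  rw [← integral_finsetSum s fun i hi => integrable_cexp_inner_mul (hg i hi) x]
  simp [Finset.mul_sum]

/-- The estimate for measurable integrable functions, obtained by summing over a partition of the
curve into arcs with local frames. -/
theorem IsNondegenerateCurve.exists_eLpNorm_le {d : ℕ} (hd : 2 ≤ d) {α : ℝ}
    (hα : (d : ℝ) - α ≤ 1) {γ : ℝ → Rd d} (hγ : IsNondegenerateCurve γ) {R : ℝ} (hR : 0 ≤ R)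
    {q : ℝ≥0∞} (hq : 2 ≤ q) {ε : ℝ} (hε : 0 < ε) :
    ∃ K : ℝ≥0, ∀ (μ : Measure (Rd d)) [SFinite μ], μ (Metric.closedBall (0 : Rd d) 1)ᶜ = 0 →
      ∀ lam : ℝ, 1 < lam → ∀ g : Rd d → ℂ, Measurable g → Integrable g →
      Function.support g ⊆ curveNbhd γ lam R →
      eLpNorm (fourierHat g) q μ
        ≤ K * growthNorm α μ ^ (1 / q).toReal * ENNReal.ofReal (lam ^ (kappa d α q + ε)) *
          eLpNorm g 2 volume := by
  obtain ⟨N, hN0, hN⟩ := hγ.exists_partition_localFrame hd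
  have hNpos : (0 : ℝ) < N := by exact_mod_cast hN0
  have hsub : ∀ i < N, Icc ((i : ℝ) / N) ((i + 1 : ℝ) / N) ⊆ Icc (0 : ℝ) 1 := fun i hi t ht =>
    ⟨le_trans (by positivity) ht.1, ht.2.trans ((div_le_one hNpos).2 (by exact_mod_cast hi))⟩
  have hcont : ∀ i < N, ContinuousOn γ (Icc ((i : ℝ) / N) ((i + 1 : ℝ) / N)) := fun i hi =>
    hγ.contDiffOn.continuousOn.mono (hsub i hi)
  have hloc : ∀ i < N, ∃ K : ℝ≥0, ∀ (μ : Measure (Rd d)) [SFinite μ],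
      μ (Metric.closedBall (0 : Rd d) 1)ᶜ = 0 →
      ∀ lam : ℝ, 1 < lam → ∀ g : Rd d → ℂ, Measurable g → Integrable g →
      (∀ ξ, g ξ ≠ 0 → ∃ t ∈ Icc ((i : ℝ) / N) ((i + 1 : ℝ) / N), dist ξ (lam • γ t) ≤ R) →
      eLpNorm (fourierHat g) q μ
        ≤ K * growthNorm α μ ^ (1 / q).toReal * ENNReal.ofReal (lam ^ (kappa d α q + ε)) *
          eLpNorm g 2 volume := by
    intro i hi
    obtain ⟨V, X, Y, m, B, F⟩ := hN i hi
    have hlen : (i + 1 : ℝ) / N - (i : ℝ) / N = 1 / N := by rw [← sub_div]; simp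
    have h1N : (1 : ℝ) ≤ N := by exact_mod_cast hN0
    refine F.exists_eLpNorm_le (hcont i hi) ?_ ?_ hα hR hq hε
    · have : (0 : ℝ) < 1 / N := by positivity
      linarith
    · rw [hlen, div_le_one hNpos]
      exact h1N
  choose! K hK using hloc
  refine ⟨∑ i ∈ Finset.range N, K i, ?_⟩
  intro μ _ hμs lam hlam g hgm hgi hsupp
  set A : ℕ → Set (Rd d) := fun i => {ξ | ∃ t ∈ Icc ((i : ℝ) / N) (min 1 ((i + 1 : ℝ) / N)),
    dist ξ (lam • γ t) ≤ R} with hA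
  obtain ⟨τ, hτm, hτ⟩ := exists_measurable_index (A := A) (M := N) (S := Function.support g)
    (fun i => measurableSet_arcNbhd (hγ.contDiffOn.continuousOn.mono
      (Icc_subset_Icc (by positivity) (min_le_left _ _))) lam hR)
    (by
      intro ξ hξ
      obtain ⟨t, ht, hr⟩ := hsupp hξ
      rcases lt_or_eq_of_le ht.2 with h1 | h1
      · have h0 : 0 ≤ t * N := mul_nonneg ht.1 hNpos.le
        refine ⟨⌊t * N⌋₊, ?_, t, ⟨?_, le_min h1.le ?_⟩, hr⟩
        · rw [Nat.floor_lt h0]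
          nlinarith
        · rw [div_le_iff₀ hNpos]
          exact Nat.floor_le h0
        · rw [le_div_iff₀ hNpos]
          exact (Nat.lt_floor_add_one _).le
      · have h2 : (((N - 1 : ℕ) : ℝ) + 1) = N := by
          rw [Nat.cast_sub hN0]; simp
        refine ⟨N - 1, by omega, t, ⟨?_, le_min ht.2 ?_⟩, hr⟩
        · rw [div_le_iff₀ hNpos, h1, one_mul]; linarith
        · rw [le_div_iff₀ hNpos, h1, one_mul]; linarith)
  have hset : ∀ i, MeasurableSet {ξ | τ ξ = i} := fun i => hτm (measurableSet_singleton i)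
  set G : ℕ → Rd d → ℂ := fun i => {ξ | τ ξ = i}.indicator g with hG
  have hGi : ∀ i, Integrable (G i) := fun i => hgi.indicator (hset i)
  have hGsum : g = ∑ i ∈ Finset.range N, G i := by
    ext ξ
    rw [Finset.sum_apply]
    by_cases h : g ξ = 0
    · rw [h]
      symm
      refine Finset.sum_eq_zero fun i _ => ?_
      simp [hG, indicator, h]
    · have h1 := (hτ ξ h).1
      rw [Finset.sum_eq_single_of_mem (f := fun i => G i ξ) (τ ξ) (Finset.mem_range.2 h1)
        fun i _ hi => indicator_of_notMem (s := {η | τ η = i}) (fun h' => hi (Eq.symm h')) _]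
      exact (indicator_of_mem (show ξ ∈ {η | τ η = τ ξ} from rfl) _).symm
  calc eLpNorm (fourierHat g) q μ
      = eLpNorm (∑ i ∈ Finset.range N, fourierHat (G i)) q μ := by
        conv_lhs => rw [hGsum, fourierHat_finset_sum _ fun i _ => hGi i]
    _ ≤ ∑ i ∈ Finset.range N, eLpNorm (fourierHat (G i)) q μ :=
        eLpNorm_sum_le (fun i _ => (continuous_fourierHat (hGi i)).aestronglyMeasurable)
          (le_trans (by norm_num) hq)
    _ ≤ ∑ i ∈ Finset.range N, (K i : ℝ≥0∞) * growthNorm α μ ^ (1 / q).toReal *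
          ENNReal.ofReal (lam ^ (kappa d α q + ε)) * eLpNorm g 2 volume := by
        refine Finset.sum_le_sum fun i hi => ?_
        refine (hK i (Finset.mem_range.1 hi) μ hμs lam hlam (G i) (hgm.indicator (hset i))
          (hGi i) fun ξ hξ => ?_).trans ?_
        · have h1 : τ ξ = i := by
            by_contra hne
            exact hξ (indicator_of_notMem (by exact hne) _)
          have h2 : g ξ ≠ 0 := by
            intro h
            refine hξ ?_
            simp [hG, indicator, h]
          obtain ⟨t, ht, hr⟩ := (hτ ξ h2).2
          rw [h1] at ht
          exact ⟨t, ⟨ht.1, ht.2.trans (min_le_right _ _)⟩, hr⟩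
        · gcongr
          exact eLpNorm_indicator_le _
    _ = _ := by
        rw [← Finset.sum_mul, ← Finset.sum_mul, ← Finset.sum_mul]
        push_cast
        rfl

theorem theorem3p4 (d : ℕ) (hd : 2 ≤ d) (α : ℝ) (hα₁ : (d : ℝ) - 1 ≤ α) (hα₂ : α ≤ (d : ℝ))
    (γ : ℝ → Rd d) (hγ : IsNondegenerateCurve γ)
    (R : ℝ) (hR : 0 < R) (q : ℝ≥0∞) (hq : 2 ≤ q) (ε : ℝ) (hε : 0 < ε) :
    ∃ C : ℝ, 0 < C ∧
      ∀ lam : ℝ, 1 < lam →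
      ∀ μ : Measure (Rd d), μ (Metric.closedBall (0 : Rd d) 1)ᶜ = 0 → IsAlphaDimensional α μ →
      ∀ g : Rd d → ℂ, MemLp g 2 volume → Function.support g ⊆ curveNbhd γ lam R →
        eLpNorm (fourierHat g) q μ ≤
          ENNReal.ofReal C * growthNorm α μ ^ (1 / q).toReal *
            ENNReal.ofReal (lam ^ (kappa d α q + ε)) * eLpNorm g 2 volume := by
  obtain ⟨K, hK⟩ := hγ.exists_eLpNorm_le hd (by linarith : (d : ℝ) - α ≤ 1) hR.le hq hε
  refine ⟨K + 1, by positivity, ?_⟩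
  intro lam hlam μ hμs hμ g hg hsupp
  have := isFiniteMeasure_of_isAlphaDimensional hμ hμs
  have hNm : MeasurableSet (curveNbhd γ lam R) :=
    measurableSet_arcNbhd hγ.contDiffOn.continuousOn lam hR.le
  have hNfin : volume (curveNbhd γ lam R) < ∞ := by
    have hK : IsCompact ((fun t => lam • γ t) '' Icc (0 : ℝ) 1) :=
      isCompact_Icc.image_of_continuousOn (hγ.contDiffOn.continuousOn.const_smul lam)
    refine (hK.isBounded.cthickening (δ := R)).measure_lt_top.trans_le' (measure_mono ?_)
    rw [hK.cthickening_eq_biUnion_closedBall hR.le]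
    rintro ξ ⟨t, ht, hr⟩
    exact mem_biUnion (mem_image_of_mem _ ht) hr
  -- A measurable representative, cut off so that its support lies in the neighbourhood everywhere
  -- and not just almost everywhere. The neighbourhood has finite volume, so `L²` gives
  -- integrability, and the Fourier integral is unchanged.
  set g' : Rd d → ℂ := (curveNbhd γ lam R).indicator (hg.1.mk g) with hg'
  have hgm' : Measurable g' := hg.1.stronglyMeasurable_mk.measurable.indicator hNm
  have hae : g =ᵐ[volume] g' := by
    filter_upwards [hg.1.ae_eq_mk] with ξ hξ
    by_cases h : ξ ∈ curveNbhd γ lam R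
    · rw [hg', indicator_of_mem h, hξ]
    · rw [hg', indicator_of_notMem h]
      by_contra hne
      exact h (hsupp hne)
  have hgi' : Integrable g' := by
    have : IsFiniteMeasure (volume.restrict (curveNbhd γ lam R)) := ⟨by simpa using hNfin⟩
    rw [hg', integrable_indicator_iff hNm]
    exact (((memLp_congr_ae hg.1.ae_eq_mk).1 hg).restrict _).integrable (by norm_num)
  have hhat : fourierHat g = fourierHat g' := by
    ext x
    refine integral_congr_ae ?_
    filter_upwards [hae] with ξ hξ
    rw [hξ]
  rw [hhat, eLpNorm_congr_ae hae]
  refine (hK μ hμs lam hlam g' hgm' hgi' ?_).trans ?_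
  · intro ξ hξ
    by_contra h
    exact hξ (indicator_of_notMem h _)
  · gcongr
    rw [← ENNReal.ofReal_coe_nnreal]
    exact ENNReal.ofReal_le_ofReal (by linarith)
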